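/- Let $\mathcal M$ be a $W^*$-algebra and $p_0\in\mathcal M$ an orthogonal projection. For $x\in\mathcal M$ let $l(x)$ and $r(x)$ be the left and right support projections of $x$. Let $\mathcal G(\mathcal M)$ be the groupoid of partially invertible elements, that is of those $x\in\mathcal M$ for which $|x|=(x^*x)^{1/2}$ is invertible in $p\mathcal Mp$, $p$ being the support of $|x|$; its source map is $r$, its target map is $l$, and its product is the product of $\mathcal M$. Let $\mathcal L_{p_0}(\mathcal M)=\{l(x): x\in\mathcal G(\mathcal M),\ r(x)=p_0\}$ be the orbit of $p_0$, let $\mathcal G_{p_0}(\mathcal M)\rightrightarrows\mathcal L_{p_0}(\mathcal M)$ be the subgroupoid of the $x\in\mathcal G(\mathcal M)$ with $l(x),r(x)\in\mathcal L_{p_0}(\mathcal M)$, and let $\mathcal U_{p_0}(\mathcal M)\subset\mathcal G_{p_0}(\mathcal M)$ be the set of those of its elements which are partial isometries. For projections $p,q$ with $\mathcal M=q\mathcal M\oplus(1-p)\mathcal M$ write $p=\sigma_p(q)-\varphi_p(q)$ with $\sigma_p(q)\in q\mathcal M$ and $\varphi_p(q)\in(1-p)\mathcal M$; then $\varphi_p(q)\in(1-p)\mathcal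 Mp$. The manifold $\mathcal L_{p_0}(\mathcal M)$ has the charts $q\mapsto\varphi_p(q)$, and $\mathcal G_{p_0}(\mathcal M)$ has the charts $x\mapsto\big(\varphi_{\tilde p}(l(x)),\ \sigma_{\tilde p}(l(x))^{-1}\,x\,\sigma_p(r(x)),\ \varphi_p(r(x))\big)$, for $p,\tilde p\in\mathcal L_{p_0}(\mathcal M)$, where $^{-1}$ is the groupoid inverse; both are regarded as real smooth Banach manifolds (the Banach spaces in which the charts take their values may differ from chart to chart). Let $P_0=\mathcal G_{p_0}(\mathcal M)\cap\mathcal Mp_0$ and $P_0^u=\{\eta\in P_0:\eta^*\eta=p_0\}$. Let $U_0$ be the unitary group of $p_0\mathcal Mp_0$, acting on $P_0^u$ and diagonally on $P_0^u\times P_0^u$ by multiplication from the right, and write $[\eta]$ and $\langle\eta,\xi\rangle$ for the orbits of $\eta$ and $(\eta,\xi)$. The gauge groupoid $(P_0^u\times P_0^u)/U_0\rightrightarrows P_0^u/U_0$ has source $\langle\eta,\xi\rangle\mapsto[\xi]$, target $\langle\eta,\xi\rangle\mapsto[\eta]$, units $\langle\eta,\eta\rangle$, inversion $\langle\eta,\xi\rangle^{-1}=\langle\xi,\eta\rangle$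 and product $\langle\eta,\xi\rangle\cdot\langle\lambda,\kappa\rangle=\langle\eta,\kappa g\rangle$ for $\xi=\lambda g$, $g\in U_0$. Then $P_0^u$ is a (split) real Banach submanifold of the Banach space $\mathcal Mp_0$, the quotients $P_0^u/U_0$ and $(P_0^u\times P_0^u)/U_0$ are quotient manifolds (their projections are submersions), $\mathcal U_{p_0}(\mathcal M)$ is a (split) real Banach submanifold of $\mathcal G_{p_0}(\mathcal M)$, and with these smooth structures $(P_0^u\times P_0^u)/U_0\rightrightarrows P_0^u/U_0$ and $\mathcal U_{p_0}(\mathcal M)\rightrightarrows\mathcal L_{p_0}(\mathcal M)$ are real Banach–Lie groupoids. The maps $$\phi^u:\frac{P_0^u\times P_0^u}{U_0}\to\mathcal U_{p_0}(\mathcal M),\quad \langle\eta,\xi\rangle\mapsto\eta\xi^*,\qquad \varphi^u:P_0^u/U_0\to\mathcal L_{p_0}(\mathcal M),\quad[\eta]\mapsto\eta\eta^*,$$ are well defined and form an isomorphism of real Banach–Lie groupoids: both are diffeomorphisms, and together they form a morphism of groupoids. In particular $\mathcal U_{p_0}(\mathcal M)\rightrightarrows\mathcal L_{p_0}(\mathcal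 M)$ is a subgroupoid of $\mathcal G_{p_0}(\mathcal M)\rightrightarrows\mathcal L_{p_0}(\mathcal M)$, and a real submanifold of it. -/

import Mathlib

open Set Function
open scoped ContDiff

universe u

set_option linter.unusedSectionVars false

noncomputable section

/-! ### Smooth real Banach manifolds whose charts may take values in different Banach spaces -/

/-- Data of a chart of `X`: a domain and a map into some real Banach space
(only the values of `map` on `dom` matter). -/
structure BanachChart (X : Type u) where
  E : Type u
  [normed : NormedAddCommGroup E]
  [space : NormedSpace ℝ E]
  [complete : CompleteSpace E]
  dom : Set X
  map : X → E

attribute [instance] BanachChart.normed BanachChart.space BanachChart.complete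

namespace BanachChart

variable {X Y : Type u}

/-- `c` is a bijection of its domain onto an open subset of its Banach space. -/
def IsChart (c : BanachChart X) : Prop :=
  InjOn c.map c.dom ∧ IsOpen (c.map '' c.dom)

/-- The change of coordinates from `c` to `d` is a smooth map defined on an open set. -/
def SmoothTransition (c d : BanachChart X) : Prop :=
  IsOpen (c.map '' (c.dom ∩ d.dom)) ∧
    ∃ T : c.E → d.E, ContDiffOn ℝ ∞ T (c.map '' (c.dom ∩ d.dom)) ∧
      ∀ x ∈ c.dom ∩ d.dom, T (c.map x) = d.map x

/-- `V` is an open neighbourhood of the coordinates of `x`, on which `f` is expressed in the charts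
`c` and `d` by the smooth map `T`. -/
def Represents (c : BanachChart X) (d : BanachChart Y) (f : X → Y) (x : X)
    (V : Set c.E) (T : c.E → d.E) : Prop :=
  x ∈ c.dom ∧ IsOpen V ∧ c.map x ∈ V ∧ ContDiffOn ℝ ∞ T V ∧
    ∀ x' ∈ c.dom, c.map x' ∈ V → f x' ∈ d.dom ∧ T (c.map x') = d.map (f x')

/-- `f` is smooth at `x`, with a differential at `x` which has a bounded linear right inverse
(i.e. is surjective with complemented kernel), as seen in the charts `c` and `d`. -/
def SubmersiveAt (c : BanachChart X) (d : BanachChart Y) (f : X → Y) (x : X) : Prop :=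
  ∃ (V : Set c.E) (T : c.E → d.E), c.Represents d f x V T ∧
    ∃ R : d.E →L[ℝ] c.E, (fderiv ℝ T (c.map x)).comp R = ContinuousLinearMap.id ℝ d.E

/-- The product chart. -/
def prod (c : BanachChart X) (d : BanachChart Y) : BanachChart (X × Y) where
  E := c.E × d.E
  dom := c.dom ×ˢ d.dom
  map := Prod.map c.map d.map

end BanachChart

variable {X Y Z : Type u}

/-- `A` is an atlas of a (Hausdorff) smooth real Banach manifold structure on `X`. -/
structure IsSmoothAtlas (A : Set (BanachChart X)) : Prop where
  cover : ∀ x, ∃ c ∈ A, x ∈ c.dom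
  chart : ∀ c ∈ A, c.IsChart
  transition : ∀ c ∈ A, ∀ d ∈ A, c.SmoothTransition d
  hausdorff : ∀ x y : X, x ≠ y → ∃ c ∈ A, ∃ d ∈ A, ∃ (V : Set c.E) (W : Set d.E),
    IsOpen V ∧ IsOpen W ∧ x ∈ c.dom ∩ c.map ⁻¹' V ∧ y ∈ d.dom ∩ d.map ⁻¹' W ∧
      Disjoint (c.dom ∩ c.map ⁻¹' V) (d.dom ∩ d.map ⁻¹' W)

/-- The charts compatible with all the charts of `A`. -/
def maximalAtlas (A : Set (BanachChart X)) : Set (BanachChart X) :=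
  {c | c.IsChart ∧ ∀ d ∈ A, c.SmoothTransition d ∧ d.SmoothTransition c}

/-- Smooth maps between manifolds given by atlases. -/
def IsSmoothMap (A : Set (BanachChart X)) (B : Set (BanachChart Y)) (f : X → Y) : Prop :=
  ∀ x, ∃ c ∈ A, ∃ d ∈ B, ∃ (V : Set c.E) (T : c.E → d.E), c.Represents d f x V T

/-- Submersions between manifolds given by atlases. -/
def IsSubmersion (A : Set (BanachChart X)) (B : Set (BanachChart Y)) (f : X → Y) : Prop :=
  ∀ x, ∃ c ∈ A, ∃ d ∈ B, c.SubmersiveAt d f x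

/-- Diffeomorphisms between manifolds given by atlases. -/
def IsDiffeo (A : Set (BanachChart X)) (B : Set (BanachChart Y)) (f : X → Y) : Prop :=
  IsSmoothMap A B f ∧ ∃ g : Y → X, LeftInverse g f ∧ RightInverse g f ∧ IsSmoothMap B A g

/-- The atlas of a Banach space regarded as a manifold. -/
def vectorAtlas (E : Type u) [NormedAddCommGroup E] [NormedSpace ℝ E] [CompleteSpace E] :
    Set (BanachChart E) :=
  {{ E := E, dom := univ, map := id }}

/-- The atlas of the product of two manifolds. -/
def prodAtlas (A : Set (BanachChart X)) (B : Set (BanachChart Y)) :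
    Set (BanachChart (X × Y)) :=
  {e | ∃ c ∈ A, ∃ d ∈ B, e = c.prod d}

/-- An element of `E`, regarded as an element of the subspace `F` if it lies there
(and replaced by `0` otherwise). -/
def toSubspace {E : Type u} [NormedAddCommGroup E] [NormedSpace ℝ E] (F : Submodule ℝ E) (v : E) :
    F :=
  open Classical in if h : v ∈ F then ⟨v, h⟩ else 0

/-- The chart induced by `c` along `i : Y → X`, with values in the closed subspace `F`. -/
def BanachChart.slice (c : BanachChart X) (i : Y → X) (F : Submodule ℝ c.E)
    (hF : F.ClosedComplemented) : BanachChart Y where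
  E := F
  complete := hF.isClosed.completeSpace_coe
  dom := i ⁻¹' c.dom
  map := fun y => toSubspace F (c.map (i y))

/-- For an injective map `i : Y → X` into a manifold: all the charts of `Y` that are induced by
slice charts of `X`, that is charts in which the image of `Y` is a complemented closed subspace.
The image of `i` is a (split, embedded) submanifold of `X` exactly if these charts cover `Y`, and
then they form the atlas of the submanifold structure. -/
def submanifoldAtlas (A : Set (BanachChart X)) (i : Y → X) : Set (BanachChart Y) :=
  {e | ∃ c ∈ maximalAtlas A, ∃ (F : Submodule ℝ c.E) (hF : F.ClosedComplemented),
    c.map '' (c.dom ∩ range i) = c.map '' c.dom ∩ F ∧ e = c.slice i F hF}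

/-- For a surjection `π : X → Q` from a manifold: all the charts of `Q` in which `π` is a
submersion. If these charts cover `Q`, they form the atlas of the quotient manifold structure, the
only one for which `π` is a submersion. -/
def quotientAtlas (A : Set (BanachChart X)) {Q : Type u} (π : X → Q) : Set (BanachChart Q) :=
  {d | d.IsChart ∧ ∀ x, π x ∈ d.dom → ∃ c ∈ A, c.SubmersiveAt d π x}

/-! ### Groupoids and Banach-Lie groupoids -/

/-- A groupoid with set of arrows `G` and set of objects `B`; the product `g h` is defined if the
source of `g` is the target of `h`. -/
structure SetGroupoid (G B : Type u) where
  src : G → B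
  tgt : G → B
  unit : B → G
  inv : G → G
  mul : ∀ g h : G, src g = tgt h → G
  src_mul : ∀ g h e, src (mul g h e) = src h
  tgt_mul : ∀ g h e, tgt (mul g h e) = tgt g
  mul_assoc : ∀ g h k (e : src g = tgt h) (e' : src h = tgt k),
    mul (mul g h e) k ((src_mul g h e).trans e') = mul g (mul h k e') (e.trans (tgt_mul h k e').symm)
  src_unit : ∀ b, src (unit b) = b
  tgt_unit : ∀ b, tgt (unit b) = b
  unit_mul : ∀ g, mul (unit (tgt g)) g (src_unit _) = g
  mul_unit : ∀ g, mul g (unit (src g)) (tgt_unit _).symm = g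
  src_inv : ∀ g, src (inv g) = tgt g
  tgt_inv : ∀ g, tgt (inv g) = src g
  inv_mul : ∀ g, mul (inv g) g (src_inv g) = unit (src g)
  mul_inv : ∀ g, mul g (inv g) (tgt_inv g).symm = unit (tgt g)

namespace SetGroupoid

variable {G B G' B' : Type u}

/-- The composable pairs of arrows. -/
def Composable (Γ : SetGroupoid G B) : Type u := {z : G × G // Γ.src z.1 = Γ.tgt z.2}

/-- Morphisms of groupoids. -/
structure IsHom (Γ : SetGroupoid G B) (Γ' : SetGroupoid G' B') (F : G → G') (f : B → B') :
    Prop where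
  map_src : ∀ g, Γ'.src (F g) = f (Γ.src g)
  map_tgt : ∀ g, Γ'.tgt (F g) = f (Γ.tgt g)
  map_unit : ∀ b, F (Γ.unit b) = Γ'.unit (f b)
  map_inv : ∀ g, F (Γ.inv g) = Γ'.inv (F g)
  map_mul : ∀ g h (e : Γ.src g = Γ.tgt h) (e' : Γ'.src (F g) = Γ'.tgt (F h)),
    F (Γ.mul g h e) = Γ'.mul (F g) (F h) e'

/-- The atlas of the manifold of composable pairs, as a submanifold of the product. -/
def composableAtlas (Γ : SetGroupoid G B) (A : Set (BanachChart G)) :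
    Set (BanachChart Γ.Composable) :=
  submanifoldAtlas (prodAtlas A A) Subtype.val

/-- Real Banach-Lie groupoids: `G` and `B` are smooth Banach manifolds, source and target are
surjective submersions (so that the composable pairs form a submanifold), and the product, the
inversion and the inclusion of the objects are smooth. -/
structure IsBanachLie (Γ : SetGroupoid G B) (A : Set (BanachChart G)) (A₀ : Set (BanachChart B)) :
    Prop where
  arrows : IsSmoothAtlas A
  objects : IsSmoothAtlas A₀
  src_surjective : Surjective Γ.src
  tgt_surjective : Surjective Γ.tgt
  src_submersion : IsSubmersion A A₀ Γ.src
  tgt_submersion : IsSubmersion A A₀ Γ.tgt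
  composable : IsSmoothAtlas (Γ.composableAtlas A)
  smooth_mul : IsSmoothMap (Γ.composableAtlas A) A fun z => Γ.mul z.1.1 z.1.2 z.2
  smooth_inv : IsSmoothMap A A Γ.inv
  smooth_unit : IsSmoothMap A₀ A Γ.unit

end SetGroupoid

/-! ### Partially invertible elements of a `W*`-algebra -/

section Algebra

variable {M : Type u} [CStarAlgebra M]

section Corners

/-- The Banach space `p M q`, for idempotents `p` and `q`, as a real Banach space. -/
def corner (p q : M) : Submodule ℝ M where
  carrier := {a | p * a * q = a}
  add_mem' := by
    intro a b ha hb
    simp only [mem_ofPred_eq] at *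
    rw [mul_add, add_mul, ha, hb]
  zero_mem' := by simp
  smul_mem' := by
    intro r a ha
    simp only [mem_ofPred_eq] at *
    rw [mul_smul_comm, smul_mul_assoc, ha]

instance corner.completeSpace (p q : M) : CompleteSpace (corner p q) := by
  have h : IsClosed {a : M | p * a * q = a} :=
    isClosed_eq (by fun_prop) continuous_id
  exact h.completeSpace_coe

/-- The right ideal `q M`. -/
def rightIdeal (q : M) : Submodule ℂ M := LinearMap.range (LinearMap.mulLeft ℂ q)

end Corners

/-- `y` is the Moore-Penrose inverse of `x`. -/
structure IsMoorePenrose (x y : M) : Prop where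
  h1 : x * y * x = x
  h2 : y * x * y = y
  h3 : star (x * y) = x * y
  h4 : star (y * x) = y * x

namespace IsMoorePenrose

variable {x y x' y' : M}

theorem symm (h : IsMoorePenrose x y) : IsMoorePenrose y x := ⟨h.h2, h.h1, h.h4, h.h3⟩

theorem left_proj (h : IsMoorePenrose x y) : IsStarProjection (x * y) :=
  ⟨by rw [IsIdempotentElem, ← mul_assoc, h.h1], h.h3⟩

theorem right_proj (h : IsMoorePenrose x y) : IsStarProjection (y * x) := h.symm.left_proj

theorem mul (h : IsMoorePenrose x y) (h' : IsMoorePenrose x' y') (e : y * x = x' * y') :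
    IsMoorePenrose (x * x') (y' * y) ∧ (x * x') * (y' * y) = x * y ∧
      (y' * y) * (x * x') = y' * x' := by
  have e1 : (x * x') * (y' * y) = x * y := by
    calc (x * x') * (y' * y) = x * (x' * y') * y := by noncomm_ring
      _ = x * y * x * y := by rw [← e]; noncomm_ring
      _ = x * y := by rw [h.h1]
  have e2 : (y' * y) * (x * x') = y' * x' := by
    calc (y' * y) * (x * x') = y' * (y * x) * x' := by noncomm_ring
      _ = y' * x' * y' * x' := by rw [e]; noncomm_ring
      _ = y' * x' := by rw [h'.h2]
  refine ⟨⟨?_, ?_, ?_, ?_⟩, e1, e2⟩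
  · rw [e1, ← mul_assoc, h.h1]
  · rw [e2, ← mul_assoc, h'.h2]
  · rw [e1, h.h3]
  · rw [e2, h'.h4]

end IsMoorePenrose

theorem mul_eq_self_of_star_mul {x p : M} (hp : IsStarProjection p)
    (h : star x * x * p = star x * x) : x * p = x := by
  have : star (x * p - x) * (x * p - x) = 0 := by
    rw [star_sub, star_mul, hp.isSelfAdjoint.star_eq]
    have : (p * star x - star x) * (x * p - x) =
      p * (star x * x * p) - p * (star x * x) - (star x * x * p) + star x * x := by noncomm_ring
    rw [this, h]; abel
  exact sub_eq_zero.mp ((CStarRing.star_mul_self_eq_zero_iff _).mp this)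

theorem IsMoorePenrose.of_proj {p : M} (hp : IsStarProjection p) : IsMoorePenrose p p := by
  have h := hp.isIdempotentElem.eq
  refine ⟨?_, ?_, ?_, ?_⟩ <;> simp [h, hp.isSelfAdjoint.star_eq]

theorem IsMoorePenrose.of_isometry {u : M} (hu : IsStarProjection (star u * u)) :
    IsMoorePenrose u (star u) := by
  have h : u * star u * u = u := by
    rw [mul_assoc]
    exact mul_eq_self_of_star_mul hu hu.isIdempotentElem.eq
  refine ⟨h, ?_, by simp, by simp⟩
  simpa [mul_assoc] using congrArg star h

variable [PartialOrder M] [StarOrderedRing M]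

/-- `q` is the smallest projection with `q x = x`. -/
def IsLeftSupport (x q : M) : Prop := IsLeast {q : M | IsStarProjection q ∧ q * x = x} q

/-- `p` is the smallest projection with `x p = x`. -/
def IsRightSupport (x p : M) : Prop := IsLeast {p : M | IsStarProjection p ∧ x * p = x} p

/-- The left support `l(x)`. -/
def leftSupport (x : M) : M := open Classical in if h : ∃ q, IsLeftSupport x q then h.choose else 0

/-- The right support `r(x)`. -/
def rightSupport (x : M) : M :=
  open Classical in if h : ∃ p, IsRightSupport x p then h.choose else 0

variable (M) in
/-- The set of partially invertible elements: `|x|` is invertible in `p M p`, where `p` is the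
support of `|x|`. -/
def partiallyInvertible : Set M :=
  {x | ∃ p, IsRightSupport (CFC.abs x) p ∧
    ∃ b, p * b * p = b ∧ CFC.abs x * b = p ∧ b * CFC.abs x = p}

/-- The groupoid inverse `x⁻¹`: the element `y` with `y x = r(x) = l(y)` and `x y = l(x) = r(y)`. -/
def partialInverse (x : M) : M :=
  open Classical in
  if h : ∃ y, y * x = rightSupport x ∧ x * y = leftSupport x ∧
      IsLeftSupport y (rightSupport x) ∧ IsRightSupport y (leftSupport x) then h.choose else 0

/-- The projections `l(x)` of the `x` with `r(x) = p₀`, that is the orbit of `p₀`. -/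
def projOrbit (p₀ : M) : Set M :=
  {q | ∃ x ∈ partiallyInvertible M, rightSupport x = p₀ ∧ leftSupport x = q}

/-- The arrows of the transitive groupoid of partially invertible elements over the orbit. -/
def invertibleArrows (p₀ : M) : Set M :=
  {x | x ∈ partiallyInvertible M ∧ leftSupport x ∈ projOrbit p₀ ∧ rightSupport x ∈ projOrbit p₀}

/-- The arrows of the groupoid of partial isometries over the orbit. -/
def isometryArrows (p₀ : M) : Set M :=
  {u | IsStarProjection (star u * u) ∧ u ∈ invertibleArrows p₀}

/-! #### The groupoids of partially invertible elements and of partial isometries -/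

theorem leftSupport_eq_of {x q : M} (h : IsLeftSupport x q) : leftSupport x = q := by
  have hex : ∃ q, IsLeftSupport x q := ⟨q, h⟩
  rw [leftSupport, dif_pos hex]
  exact hex.choose_spec.unique h

theorem rightSupport_eq_of {x q : M} (h : IsRightSupport x q) : rightSupport x = q := by
  have hex : ∃ q, IsRightSupport x q := ⟨q, h⟩
  rw [rightSupport, dif_pos hex]
  exact hex.choose_spec.unique h

theorem IsMoorePenrose.isLeftSupport {x y : M} (h : IsMoorePenrose x y) :
    IsLeftSupport x (x * y) := by
  refine ⟨⟨h.left_proj, h.h1⟩, ?_⟩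
  rintro q ⟨hq, hqx⟩
  rw [h.left_proj.le_iff_mul_eq_right hq, ← mul_assoc, hqx]

theorem IsMoorePenrose.isRightSupport {x y : M} (h : IsMoorePenrose x y) :
    IsRightSupport x (y * x) := by
  refine ⟨⟨h.right_proj, by rw [← mul_assoc, h.h1]⟩, ?_⟩
  rintro q ⟨hq, hqx⟩
  rw [h.right_proj.le_iff_mul_eq_left hq, mul_assoc, hqx]

theorem IsMoorePenrose.leftSupport_eq {x y : M} (h : IsMoorePenrose x y) :
    leftSupport x = x * y := leftSupport_eq_of h.isLeftSupport

theorem IsMoorePenrose.rightSupport_eq {x y : M} (h : IsMoorePenrose x y) :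
    rightSupport x = y * x := rightSupport_eq_of h.isRightSupport

theorem IsMoorePenrose.partialInverse_eq {x y : M} (h : IsMoorePenrose x y) :
    partialInverse x = y := by
  have hex : ∃ y, y * x = rightSupport x ∧ x * y = leftSupport x ∧
      IsLeftSupport y (rightSupport x) ∧ IsRightSupport y (leftSupport x) := by
    refine ⟨y, h.rightSupport_eq.symm, h.leftSupport_eq.symm, ?_, ?_⟩
    · rw [h.rightSupport_eq]; exact h.symm.isLeftSupport
    · rw [h.leftSupport_eq]; exact h.symm.isRightSupport
  rw [partialInverse, dif_pos hex]
  obtain ⟨-, e2, e3, -⟩ := hex.choose_spec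
  generalize hex.choose = z at e2 e3 ⊢
  rw [h.rightSupport_eq] at e3
  rw [h.leftSupport_eq] at e2
  have e5 : y * x * z = z := e3.1.2
  rw [← e5, mul_assoc, e2, ← mul_assoc, h.h2]

theorem mem_partiallyInvertible_iff {x : M} :
    x ∈ partiallyInvertible M ↔ ∃ y, IsMoorePenrose x y := by
  have habs : CFC.abs x * CFC.abs x = star x * x := CFC.abs_mul_abs x
  have hsa : star (CFC.abs x) = CFC.abs x := (CFC.abs_nonneg x).isSelfAdjoint.star_eq
  constructor
  · rintro ⟨p, ⟨⟨hp, hxp⟩, -⟩, b, hb, hxb, hbx⟩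
    have hpx : p * CFC.abs x = CFC.abs x := by
      have := congrArg star hxp
      rwa [star_mul, hsa, hp.isSelfAdjoint.star_eq] at this
    have hpb : p * b = b := by
      calc p * b = p * (p * b * p) := by rw [hb]
        _ = (p * p) * b * p := by noncomm_ring
        _ = b := by rw [hp.isIdempotentElem.eq, hb]
    have hbp : b * p = b := by
      calc b * p = (p * b * p) * p := by rw [hb]
        _ = p * b * (p * p) := by noncomm_ring
        _ = b := by rw [hp.isIdempotentElem.eq, hb]
    have hbs : star b = b := by
      have h1 : CFC.abs x * star b = p := by
        have := congrArg star hbx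
        rwa [star_mul, hsa, hp.isSelfAdjoint.star_eq] at this
      have h2 : p * star b = star b := by
        have := congrArg star hbp
        rwa [star_mul, hp.isSelfAdjoint.star_eq] at this
      calc star b = b * CFC.abs x * star b := by rw [hbx, h2]
        _ = b := by rw [mul_assoc, h1, hbp]
    have hxp' : x * p = x :=
      mul_eq_self_of_star_mul hp (by rw [← habs, mul_assoc, hxp])
    have hyx : b * b * star x * x = p := by
      calc b * b * star x * x = b * (b * (CFC.abs x * CFC.abs x)) := by rw [habs]; noncomm_ring
        _ = b * (b * CFC.abs x * CFC.abs x) := by noncomm_ring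
        _ = p := by rw [hbx, hpx, hbx]
    refine ⟨b * b * star x, ?_, ?_, ?_, ?_⟩
    · rw [mul_assoc, hyx, hxp']
    · rw [hyx]
      calc p * (b * b * star x) = (p * b) * b * star x := by noncomm_ring
        _ = _ := by rw [hpb]
    · simp only [star_mul, star_star, hbs]; noncomm_ring
    · rw [hyx, hp.isSelfAdjoint.star_eq]
  · rintro ⟨y, h⟩
    have hpx : x * (y * x) = x := by rw [← mul_assoc, h.h1]
    have hax : CFC.abs x * (y * x) = CFC.abs x := by
      apply mul_eq_self_of_star_mul h.right_proj
      rw [hsa, habs, mul_assoc, hpx]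
    have hxa : y * x * CFC.abs x = CFC.abs x := by
      have := congrArg star hax
      rwa [star_mul, hsa, h.h4] at this
    have hinv : y * star y * (star x * x) = y * x := by
      calc y * star y * (star x * x) = y * star (x * y) * x := by rw [star_mul]; noncomm_ring
        _ = (y * x * y) * x := by rw [h.h3]; noncomm_ring
        _ = y * x := by rw [h.h2]
    have hinv' : (star x * x) * (y * star y) = y * x := by
      have := congrArg star hinv
      rw [h.h4] at this
      simpa [star_mul, mul_assoc] using this
    have hbl : y * star y * CFC.abs x * CFC.abs x = y * x := by rw [mul_assoc, habs, hinv]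
    have hbr : CFC.abs x * (CFC.abs x * (y * star y)) = y * x := by rw [← mul_assoc, habs, hinv']
    have heq : y * star y * CFC.abs x = CFC.abs x * (y * star y) := by
      calc y * star y * CFC.abs x = y * star y * CFC.abs x * (y * x) := by
            rw [mul_assoc (y * star y), hax]
        _ = y * star y * CFC.abs x * CFC.abs x * (CFC.abs x * (y * star y)) := by
            rw [← hbr]; noncomm_ring
        _ = (y * x * CFC.abs x) * (y * star y) := by rw [hbl]; noncomm_ring
        _ = _ := by rw [hxa]
    refine ⟨y * x, ⟨⟨h.right_proj, hax⟩, ?_⟩, y * star y * CFC.abs x, ?_, ?_, ?_⟩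
    · rintro q ⟨hq, hqx⟩
      have : x * q = x :=
        mul_eq_self_of_star_mul hq (by rw [← habs, mul_assoc, hqx])
      exact h.isRightSupport.2 ⟨hq, this⟩
    · calc y * x * (y * star y * CFC.abs x) * (y * x)
          = (y * x * y) * star y * (CFC.abs x * (y * x)) := by noncomm_ring
        _ = _ := by rw [h.h2, hax]
    · rw [heq, hbr]
    · exact hbl

/-- The set `S` of arrows over the orbit of `p₀` is closed under the groupoid operations. -/
structure IsArrowSet (p₀ : M) (S : Set M) : Prop where
  subset : S ⊆ invertibleArrows p₀
  unit : ∀ p ∈ projOrbit p₀, p ∈ S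
  inv : ∀ x ∈ S, partialInverse x ∈ S
  mul : ∀ x ∈ S, ∀ y ∈ S, rightSupport x = leftSupport y → x * y ∈ S

theorem isStarProjection_of_mem_projOrbit {p₀ p : M} (hp : p ∈ projOrbit p₀) :
    IsStarProjection p := by
  obtain ⟨x, hx, -, rfl⟩ := hp
  obtain ⟨y, h⟩ := mem_partiallyInvertible_iff.1 hx
  rw [h.leftSupport_eq]; exact h.left_proj

theorem leftSupport_proj {p : M} (hp : IsStarProjection p) : leftSupport p = p := by
  rw [(IsMoorePenrose.of_proj hp).leftSupport_eq, hp.isIdempotentElem.eq]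

theorem rightSupport_proj {p : M} (hp : IsStarProjection p) : rightSupport p = p := by
  rw [(IsMoorePenrose.of_proj hp).rightSupport_eq, hp.isIdempotentElem.eq]

theorem mem_invertibleArrows_of_mem_projOrbit {p₀ p : M} (hp : p ∈ projOrbit p₀) :
    p ∈ invertibleArrows p₀ := by
  have h := isStarProjection_of_mem_projOrbit hp
  refine ⟨mem_partiallyInvertible_iff.2 ⟨p, .of_proj h⟩, ?_, ?_⟩
  · rwa [leftSupport_proj h]
  · rwa [rightSupport_proj h]

theorem isArrowSet_invertibleArrows (p₀ : M) : IsArrowSet p₀ (invertibleArrows p₀) where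
  subset := Subset.rfl
  unit _ hp := mem_invertibleArrows_of_mem_projOrbit hp
  inv := by
    rintro x ⟨hx, hl, hr⟩
    obtain ⟨y, h⟩ := mem_partiallyInvertible_iff.1 hx
    rw [h.partialInverse_eq]
    refine ⟨mem_partiallyInvertible_iff.2 ⟨x, h.symm⟩, ?_, ?_⟩
    · rwa [h.symm.leftSupport_eq, ← h.rightSupport_eq]
    · rwa [h.symm.rightSupport_eq, ← h.leftSupport_eq]
  mul := by
    rintro x ⟨hx, hl, hr⟩ x' ⟨hx', hl', hr'⟩ e
    obtain ⟨y, h⟩ := mem_partiallyInvertible_iff.1 hx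
    obtain ⟨y', h'⟩ := mem_partiallyInvertible_iff.1 hx'
    rw [h.rightSupport_eq, h'.leftSupport_eq] at e
    obtain ⟨hm, e1, e2⟩ := h.mul h' e
    refine ⟨mem_partiallyInvertible_iff.2 ⟨_, hm⟩, ?_, ?_⟩
    · rwa [hm.leftSupport_eq, e1, ← h.leftSupport_eq]
    · rwa [hm.rightSupport_eq, e2, ← h'.rightSupport_eq]

theorem isArrowSet_isometryArrows (p₀ : M) : IsArrowSet p₀ (isometryArrows p₀) where
  subset _ hx := hx.2
  unit p hp := by
    have h := isStarProjection_of_mem_projOrbit hp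
    refine ⟨?_, mem_invertibleArrows_of_mem_projOrbit hp⟩
    rwa [h.isSelfAdjoint.star_eq, h.isIdempotentElem.eq]
  inv := by
    rintro u ⟨hu, hu'⟩
    refine ⟨?_, (isArrowSet_invertibleArrows p₀).inv u hu'⟩
    have h := IsMoorePenrose.of_isometry hu
    rw [h.partialInverse_eq, star_star]
    exact h.left_proj
  mul := by
    rintro u ⟨hu, hu'⟩ v ⟨hv, hv'⟩ e
    refine ⟨?_, (isArrowSet_invertibleArrows p₀).mul u hu' v hv' e⟩
    have h := IsMoorePenrose.of_isometry hu
    have h' := IsMoorePenrose.of_isometry hv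
    rw [h.rightSupport_eq, h'.leftSupport_eq] at e
    rw [star_mul, (h.mul h' e).2.2]
    exact hv

/-- The groupoid structure on a closed set of arrows: the source is the right support, the target
is the left support, and the product is the product of the algebra. -/
def arrowGroupoid {p₀ : M} {S : Set M} (hS : IsArrowSet p₀ S) : SetGroupoid S (projOrbit p₀) where
  src x := ⟨rightSupport x.1, (hS.subset x.2).2.2⟩
  tgt x := ⟨leftSupport x.1, (hS.subset x.2).2.1⟩
  unit p := ⟨p.1, hS.unit p.1 p.2⟩
  inv x := ⟨partialInverse x.1, hS.inv x.1 x.2⟩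
  mul x y e := ⟨x.1 * y.1, hS.mul x.1 x.2 y.1 y.2 (congrArg Subtype.val e)⟩
  src_mul := by
    rintro ⟨x, hx⟩ ⟨x', hx'⟩ e
    obtain ⟨y, h⟩ := mem_partiallyInvertible_iff.1 (hS.subset hx).1
    obtain ⟨y', h'⟩ := mem_partiallyInvertible_iff.1 (hS.subset hx').1
    have e := congrArg Subtype.val e
    simp only [h.rightSupport_eq, h'.leftSupport_eq] at e
    obtain ⟨hm, e1, e2⟩ := h.mul h' e
    apply Subtype.ext
    simp only [hm.rightSupport_eq, e2, h'.rightSupport_eq]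
  tgt_mul := by
    rintro ⟨x, hx⟩ ⟨x', hx'⟩ e
    obtain ⟨y, h⟩ := mem_partiallyInvertible_iff.1 (hS.subset hx).1
    obtain ⟨y', h'⟩ := mem_partiallyInvertible_iff.1 (hS.subset hx').1
    have e := congrArg Subtype.val e
    simp only [h.rightSupport_eq, h'.leftSupport_eq] at e
    obtain ⟨hm, e1, e2⟩ := h.mul h' e
    apply Subtype.ext
    simp only [hm.leftSupport_eq, e1, h.leftSupport_eq]
  mul_assoc _ _ _ _ _ := Subtype.ext (mul_assoc _ _ _)
  src_unit p := Subtype.ext (rightSupport_proj (isStarProjection_of_mem_projOrbit p.2))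
  tgt_unit p := Subtype.ext (leftSupport_proj (isStarProjection_of_mem_projOrbit p.2))
  unit_mul := by
    rintro ⟨x, hx⟩
    obtain ⟨y, h⟩ := mem_partiallyInvertible_iff.1 (hS.subset hx).1
    exact Subtype.ext (by simp only [h.leftSupport_eq, h.h1])
  mul_unit := by
    rintro ⟨x, hx⟩
    obtain ⟨y, h⟩ := mem_partiallyInvertible_iff.1 (hS.subset hx).1
    exact Subtype.ext (by simp only [h.rightSupport_eq, ← mul_assoc, h.h1])
  src_inv := by
    rintro ⟨x, hx⟩
    obtain ⟨y, h⟩ := mem_partiallyInvertible_iff.1 (hS.subset hx).1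
    exact Subtype.ext (by simp only [h.partialInverse_eq, h.symm.rightSupport_eq, h.leftSupport_eq])
  tgt_inv := by
    rintro ⟨x, hx⟩
    obtain ⟨y, h⟩ := mem_partiallyInvertible_iff.1 (hS.subset hx).1
    exact Subtype.ext (by simp only [h.partialInverse_eq, h.symm.leftSupport_eq, h.rightSupport_eq])
  inv_mul := by
    rintro ⟨x, hx⟩
    obtain ⟨y, h⟩ := mem_partiallyInvertible_iff.1 (hS.subset hx).1
    exact Subtype.ext (by simp only [h.partialInverse_eq, h.rightSupport_eq])
  mul_inv := by
    rintro ⟨x, hx⟩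
    obtain ⟨y, h⟩ := mem_partiallyInvertible_iff.1 (hS.subset hx).1
    exact Subtype.ext (by simp only [h.partialInverse_eq, h.leftSupport_eq])

/-- The groupoid of partially invertible elements over the orbit of `p₀`. -/
def invertibleGroupoid (p₀ : M) : SetGroupoid (invertibleArrows p₀) (projOrbit p₀) :=
  arrowGroupoid (isArrowSet_invertibleArrows p₀)

/-- The groupoid of partial isometries over the orbit of `p₀`. -/
def isometryGroupoid (p₀ : M) : SetGroupoid (isometryArrows p₀) (projOrbit p₀) :=
  arrowGroupoid (isArrowSet_isometryArrows p₀)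

/-! ### The manifolds of projections and of partially invertible elements -/

/-- The domain `Π_p`: the algebra is the direct sum of the right ideals `q M` and `(1 - p) M`. -/
def IsTransversal (p q : M) : Prop := IsCompl (rightIdeal q) (rightIdeal (1 - p))

/-- The component `σ_p(q)` of `p` in `q M`, along `(1 - p) M`. -/
def sectionAt (p q : M) : M :=
  open Classical in
  if h : IsTransversal p q then (rightIdeal q).projection (rightIdeal (1 - p)) h p else 0

/-- The coordinate `φ_p(q) = σ_p(q) - p` of `q`, an element of `(1 - p) M p`. -/
def projCoord (p q : M) : corner (1 - p) p := toSubspace (corner (1 - p) p) (sectionAt p q - p)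

theorem projCoord_coe {p q : M} (hp : IsStarProjection p)
    (h : IsTransversal p q) : (projCoord p q : M) = sectionAt p q - p := by
  have hs : sectionAt p q = (rightIdeal q).projection (rightIdeal (1 - p)) h p := by
    rw [sectionAt, dif_pos h]
  obtain ⟨m, hm⟩ : sectionAt p q ∈ rightIdeal q := by
    rw [hs]; exact ((rightIdeal q).projectionOnto _ h p).2
  obtain ⟨n, hn⟩ : p - sectionAt p q ∈ rightIdeal (1 - p) := by
    rw [hs]; exact Submodule.sub_projection_mem h p
  rw [LinearMap.mulLeft_apply] at hm hn
  have hpp := hp.isIdempotentElem.eq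
  have hz : sectionAt p q * (1 - p) = 0 := by
    have h1 : sectionAt p q * (1 - p) ∈ rightIdeal q := ⟨m * (1 - p), by simp [← hm, mul_assoc]⟩
    have h2 : sectionAt p q * (1 - p) ∈ rightIdeal (1 - p) := by
      refine ⟨-(n * (1 - p)), ?_⟩
      have : sectionAt p q = p - (1 - p) * n := by rw [hn]; abel
      rw [LinearMap.mulLeft_apply, this, sub_mul p, hp.mul_one_sub_self, zero_sub, mul_neg,
        mul_assoc]
    exact Submodule.disjoint_def.1 h.disjoint _ h1 h2
  have hmem : sectionAt p q - p ∈ corner (1 - p) p := by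
    have e1 : sectionAt p q * p = sectionAt p q := by
      rw [mul_sub, mul_one, sub_eq_zero] at hz; exact hz.symm
    have e2 : (1 - p) * (sectionAt p q - p) = sectionAt p q - p := by
      have : sectionAt p q - p = -((1 - p) * n) := by rw [hn]; abel
      rw [this, mul_neg, ← mul_assoc, hp.one_sub.isIdempotentElem.eq]
    change (1 - p) * (sectionAt p q - p) * p = sectionAt p q - p
    rw [e2, sub_mul, e1, hpp]
  rw [projCoord, toSubspace, dif_pos hmem]

/-- The chart `(Π_p, φ_p)` of the orbit of `p₀`. -/
def projChart (p₀ p : M) : BanachChart (projOrbit p₀) where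
  E := corner (1 - p) p
  dom := {q | IsTransversal p q.1}
  map q := projCoord p q.1

/-- The atlas of the orbit of `p₀` in the set of projections. -/
def projAtlas (p₀ : M) : Set (BanachChart (projOrbit p₀)) := {c | ∃ p ∈ projOrbit p₀, c = projChart p₀ p}

/-- The chart of the partially invertible elements at a pair of projections, with coordinates
`φ_{p'}(l(x))`, `σ_{p'}(l(x))⁻¹ x σ_p(r(x))` and `φ_p(r(x))`. -/
def arrowChart (p₀ p' p : M) : BanachChart (invertibleArrows p₀) where
  E := corner (1 - p') p' × corner p' p × corner (1 - p) p
  dom := {x | IsTransversal p' (leftSupport x.1) ∧ IsTransversal p (rightSupport x.1)}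
  map x := (projCoord p' (leftSupport x.1),
    toSubspace (corner p' p) (partialInverse (sectionAt p' (leftSupport x.1)) * x.1 *
      sectionAt p (rightSupport x.1)),
    projCoord p (rightSupport x.1))

/-- The atlas of the groupoid of partially invertible elements over the orbit of `p₀`. -/
def invertibleAtlas (p₀ : M) : Set (BanachChart (invertibleArrows p₀)) :=
  {c | ∃ p' ∈ projOrbit p₀, ∃ p ∈ projOrbit p₀, c = arrowChart p₀ p' p}

/-- The atlas of the groupoid of partial isometries over the orbit of `p₀`, as a real submanifold
of the groupoid of partially invertible elements. -/
def isometryAtlas (p₀ : M) : Set (BanachChart (isometryArrows p₀)) :=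
  submanifoldAtlas (invertibleAtlas p₀) (inclusion (isArrowSet_isometryArrows p₀).subset)

/-! ### The unitary bundle and its gauge groupoid -/

/-- `P₀`, the arrows over the orbit of `p₀` which lie in the left ideal `M p₀`. -/
def bundle (p₀ : M) : Set M := {η | η ∈ invertibleArrows p₀ ∧ η * p₀ = η}

/-- `P₀ᵘ`, the set of the `η` in `P₀` with `η* η = p₀`. -/
def isometryBundle (p₀ : M) : Set M := {η | η ∈ bundle p₀ ∧ star η * η = p₀}

/-- `U₀`, the unitary group of the algebra `p₀ M p₀`, whose unit is `p₀`. -/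
def cornerUnitary (p₀ : M) : Set M :=
  {g | p₀ * g * p₀ = g ∧ star g * g = p₀ ∧ g * star g = p₀}

/-- The inclusion of `P₀ᵘ` into the Banach space `M p₀`. -/
def bundleInclusion (p₀ : M) (η : isometryBundle p₀) : corner 1 p₀ :=
  ⟨η.1, by change 1 * η.1 * p₀ = η.1; rw [one_mul, η.2.1.2]⟩

/-- The atlas of `P₀ᵘ` as a real submanifold of the Banach space `M p₀`. -/
def bundleAtlas (p₀ : M) : Set (BanachChart (isometryBundle p₀)) :=
  submanifoldAtlas (vectorAtlas (corner 1 p₀)) (bundleInclusion p₀)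

theorem mem_isometryBundle {p₀ η : M} (hp₀ : IsStarProjection p₀) (h : star η * η = p₀) :
    η ∈ isometryBundle p₀ := by
  subst h
  have hm := IsMoorePenrose.of_isometry hp₀
  have hG := mem_partiallyInvertible_iff.2 ⟨_, hm⟩
  have hm' := IsMoorePenrose.of_proj hp₀
  refine ⟨⟨⟨hG, ⟨η, hG, hm.rightSupport_eq, rfl⟩, ?_⟩, by rw [← mul_assoc, hm.h1]⟩, rfl⟩
  rw [hm.rightSupport_eq]
  exact ⟨_, mem_partiallyInvertible_iff.2 ⟨_, hm'⟩, rightSupport_proj hp₀, leftSupport_proj hp₀⟩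

section Unitary

variable {p₀ g h : M}

theorem cornerUnitary_left (hp₀ : IsStarProjection p₀) (hg : g ∈ cornerUnitary p₀) :
    p₀ * g = g := by
  rw [← hg.1, ← mul_assoc, ← mul_assoc, hp₀.isIdempotentElem.eq]

theorem cornerUnitary_right (hp₀ : IsStarProjection p₀) (hg : g ∈ cornerUnitary p₀) :
    g * p₀ = g := by
  rw [← hg.1, mul_assoc, hp₀.isIdempotentElem.eq]

theorem cornerUnitary_one (hp₀ : IsStarProjection p₀) : p₀ ∈ cornerUnitary p₀ := by
  have h := hp₀.isIdempotentElem.eq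
  refine ⟨?_, ?_, ?_⟩ <;> simp [h, hp₀.isSelfAdjoint.star_eq]

theorem cornerUnitary_star (hp₀ : IsStarProjection p₀) (hg : g ∈ cornerUnitary p₀) :
    star g ∈ cornerUnitary p₀ := by
  refine ⟨?_, by rw [star_star, hg.2.2], by rw [star_star, hg.2.1]⟩
  have := congrArg star hg.1
  simpa [mul_assoc, hp₀.isSelfAdjoint.star_eq] using this

theorem cornerUnitary_mul (hp₀ : IsStarProjection p₀) (hg : g ∈ cornerUnitary p₀)
    (hh : h ∈ cornerUnitary p₀) : g * h ∈ cornerUnitary p₀ := by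
  refine ⟨?_, ?_, ?_⟩
  · rw [← mul_assoc, cornerUnitary_left hp₀ hg, mul_assoc, cornerUnitary_right hp₀ hh]
  · calc star (g * h) * (g * h) = star h * ((star g * g) * h) := by rw [star_mul]; noncomm_ring
      _ = p₀ := by rw [hg.2.1, cornerUnitary_left hp₀ hh, hh.2.1]
  · calc (g * h) * star (g * h) = g * (h * star h) * star g := by rw [star_mul]; noncomm_ring
      _ = p₀ := by rw [hh.2.2, cornerUnitary_right hp₀ hg, hg.2.2]

/-- The right action of `U₀` on `P₀ᵘ`. -/
def bundleAct (hp₀ : IsStarProjection p₀) (η : isometryBundle p₀) (g : cornerUnitary p₀) :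
    isometryBundle p₀ :=
  ⟨η.1 * g.1, mem_isometryBundle hp₀ <| by
    calc star (η.1 * g.1) * (η.1 * g.1) = star g.1 * ((star η.1 * η.1) * g.1) := by
          rw [star_mul]; noncomm_ring
      _ = p₀ := by rw [η.2.2, cornerUnitary_left hp₀ g.2, g.2.2.1]⟩

theorem bundleAct_one (hp₀ : IsStarProjection p₀) (η : isometryBundle p₀) :
    bundleAct hp₀ η ⟨p₀, cornerUnitary_one hp₀⟩ = η := Subtype.ext η.2.1.2

theorem bundleAct_star (hp₀ : IsStarProjection p₀) (η : isometryBundle p₀)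
    (g : cornerUnitary p₀) :
    bundleAct hp₀ (bundleAct hp₀ η g) ⟨star g.1, cornerUnitary_star hp₀ g.2⟩ = η :=
  Subtype.ext <| by
    change η.1 * g.1 * star g.1 = η.1
    rw [mul_assoc, g.2.2.2, η.2.1.2]

theorem bundleAct_mul (hp₀ : IsStarProjection p₀) (η : isometryBundle p₀)
    (g h : cornerUnitary p₀) :
    bundleAct hp₀ (bundleAct hp₀ η g) h =
      bundleAct hp₀ η ⟨g.1 * h.1, cornerUnitary_mul hp₀ g.2 h.2⟩ :=
  Subtype.ext (mul_assoc _ _ _)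

theorem bundleAct_injective (hp₀ : IsStarProjection p₀) {η : isometryBundle p₀}
    {g h : cornerUnitary p₀} (e : bundleAct hp₀ η g = bundleAct hp₀ η h) : g = h := by
  have e := congrArg (fun x : isometryBundle p₀ => star η.1 * x.1) e
  simp only [bundleAct, ← mul_assoc, η.2.2, cornerUnitary_left hp₀ g.2,
    cornerUnitary_left hp₀ h.2] at e
  exact Subtype.ext e

/-- `η` and `η g` are equivalent, for `g` in `U₀`. -/
def bundleSetoid (hp₀ : IsStarProjection p₀) : Setoid (isometryBundle p₀) where
  r η η' := ∃ g : cornerUnitary p₀, η' = bundleAct hp₀ η g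
  iseqv := by
    refine ⟨fun η => ⟨_, (bundleAct_one hp₀ η).symm⟩, ?_, ?_⟩
    · rintro η _ ⟨g, rfl⟩
      exact ⟨_, (bundleAct_star hp₀ η g).symm⟩
    · rintro η _ _ ⟨g, rfl⟩ ⟨h, rfl⟩
      exact ⟨_, bundleAct_mul hp₀ η g h⟩

/-- `(η, ξ)` and `(η g, ξ g)` are equivalent, for `g` in `U₀`. -/
def pairSetoid (hp₀ : IsStarProjection p₀) : Setoid (isometryBundle p₀ × isometryBundle p₀) where
  r a b := ∃ g : cornerUnitary p₀, b = (bundleAct hp₀ a.1 g, bundleAct hp₀ a.2 g)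
  iseqv := by
    refine ⟨fun a => ⟨⟨p₀, cornerUnitary_one hp₀⟩, ?_⟩, ?_, ?_⟩
    · simp only [bundleAct_one]
    · rintro a _ ⟨g, rfl⟩
      exact ⟨⟨star g.1, cornerUnitary_star hp₀ g.2⟩, by simp only [bundleAct_star]⟩
    · rintro a _ _ ⟨g, rfl⟩ ⟨h, rfl⟩
      exact ⟨⟨g.1 * h.1, cornerUnitary_mul hp₀ g.2 h.2⟩, by simp only [bundleAct_mul]⟩

/-- `P₀ᵘ / U₀`. -/
abbrev GaugeBase (hp₀ : IsStarProjection p₀) : Type u := Quotient (bundleSetoid hp₀)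

/-- `(P₀ᵘ × P₀ᵘ) / U₀`. -/
abbrev GaugeArrows (hp₀ : IsStarProjection p₀) : Type u := Quotient (pairSetoid hp₀)

/-- The class `[η]`. -/
def baseClass (hp₀ : IsStarProjection p₀) (η : isometryBundle p₀) : GaugeBase hp₀ :=
  Quotient.mk (bundleSetoid hp₀) η

/-- The class `⟨η, ξ⟩`. -/
def pairClass (hp₀ : IsStarProjection p₀) (a : isometryBundle p₀ × isometryBundle p₀) :
    GaugeArrows hp₀ :=
  Quotient.mk (pairSetoid hp₀) a

theorem baseClass_eq (hp₀ : IsStarProjection p₀) {η η' : isometryBundle p₀} :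
    baseClass hp₀ η = baseClass hp₀ η' ↔ ∃ g, η' = bundleAct hp₀ η g :=
  ⟨fun h => Quotient.exact h, fun h => Quotient.sound h⟩

theorem pairClass_eq (hp₀ : IsStarProjection p₀) {a b : isometryBundle p₀ × isometryBundle p₀} :
    pairClass hp₀ a = pairClass hp₀ b ↔
      ∃ g, b = (bundleAct hp₀ a.1 g, bundleAct hp₀ a.2 g) :=
  ⟨fun h => Quotient.exact h, fun h => Quotient.sound h⟩

theorem baseClass_act (hp₀ : IsStarProjection p₀) (η : isometryBundle p₀) (g : cornerUnitary p₀) :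
    baseClass hp₀ (bundleAct hp₀ η g) = baseClass hp₀ η :=
  ((baseClass_eq hp₀).2 ⟨g, rfl⟩).symm

theorem pairClass_act (hp₀ : IsStarProjection p₀) (η ξ : isometryBundle p₀)
    (g : cornerUnitary p₀) :
    pairClass hp₀ (bundleAct hp₀ η g, bundleAct hp₀ ξ g) = pairClass hp₀ (η, ξ) :=
  ((pairClass_eq hp₀ (a := (η, ξ))).2 ⟨g, rfl⟩).symm

/-- The source `[ξ]` of `⟨η, ξ⟩`. -/
def gaugeSrc (hp₀ : IsStarProjection p₀) : GaugeArrows hp₀ → GaugeBase hp₀ :=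
  Quotient.lift (fun a => baseClass hp₀ a.2) <| by
    rintro a _ ⟨g, rfl⟩; exact (baseClass_act hp₀ a.2 g).symm

/-- The target `[η]` of `⟨η, ξ⟩`. -/
def gaugeTgt (hp₀ : IsStarProjection p₀) : GaugeArrows hp₀ → GaugeBase hp₀ :=
  Quotient.lift (fun a => baseClass hp₀ a.1) <| by
    rintro a _ ⟨g, rfl⟩; exact (baseClass_act hp₀ a.1 g).symm

/-- The unit `⟨η, η⟩` at `[η]`. -/
def gaugeUnit (hp₀ : IsStarProjection p₀) : GaugeBase hp₀ → GaugeArrows hp₀ :=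
  Quotient.lift (fun η => pairClass hp₀ (η, η)) <| by
    rintro η _ ⟨g, rfl⟩; exact (pairClass_act hp₀ η η g).symm

/-- The inverse `⟨ξ, η⟩` of `⟨η, ξ⟩`. -/
def gaugeInv (hp₀ : IsStarProjection p₀) : GaugeArrows hp₀ → GaugeArrows hp₀ :=
  Quotient.lift (fun a => pairClass hp₀ (a.2, a.1)) <| by
    rintro a _ ⟨g, rfl⟩; exact (pairClass_act hp₀ a.2 a.1 g).symm

theorem gauge_composable (hp₀ : IsStarProjection p₀) {x y : GaugeArrows hp₀}
    (e : gaugeSrc hp₀ x = gaugeTgt hp₀ y) :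
    ∃ g, x.out.2 = bundleAct hp₀ y.out.1 g := by
  rw [← baseClass_eq, eq_comm]
  rw [← Quotient.out_eq x, ← Quotient.out_eq y] at e
  exact e

/-- The product `⟨η, ξ⟩ ⟨l, k⟩ = ⟨η, k g⟩`, where `g` in `U₀` is given by `ξ = l g`. -/
def gaugeMul (hp₀ : IsStarProjection p₀) (x y : GaugeArrows hp₀)
    (e : gaugeSrc hp₀ x = gaugeTgt hp₀ y) : GaugeArrows hp₀ :=
  pairClass hp₀ (x.out.1, bundleAct hp₀ y.out.2 (gauge_composable hp₀ e).choose)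

theorem gaugeMul_mk (hp₀ : IsStarProjection p₀) (η ξ l k : isometryBundle p₀)
    (g : cornerUnitary p₀) (hg : ξ = bundleAct hp₀ l g)
    (e : gaugeSrc hp₀ (pairClass hp₀ (η, ξ)) = gaugeTgt hp₀ (pairClass hp₀ (l, k))) :
    gaugeMul hp₀ (pairClass hp₀ (η, ξ)) (pairClass hp₀ (l, k)) e =
      pairClass hp₀ (η, bundleAct hp₀ k g) := by
  have e3 := (gauge_composable hp₀ e).choose_spec
  rw [gaugeMul]
  generalize (gauge_composable hp₀ e).choose = g' at e3 ⊢
  obtain ⟨s, hs⟩ := (pairClass_eq hp₀).1 (Quotient.out_eq (pairClass hp₀ (η, ξ))).symm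
  obtain ⟨t, ht⟩ := (pairClass_eq hp₀).1 (Quotient.out_eq (pairClass hp₀ (l, k))).symm
  rw [hs, ht] at e3
  simp only [hg, bundleAct_mul] at e3
  have e4 := bundleAct_injective hp₀ e3
  rw [hs, ht]
  simp only [bundleAct_mul]
  rw [← e4, ← bundleAct_mul hp₀ k g s, pairClass_act]

/-- The gauge groupoid of the bundle `P₀ᵘ` with structure group `U₀`. -/
def gaugeGroupoid (hp₀ : IsStarProjection p₀) : SetGroupoid (GaugeArrows hp₀) (GaugeBase hp₀) where
  src := gaugeSrc hp₀
  tgt := gaugeTgt hp₀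
  unit := gaugeUnit hp₀
  inv := gaugeInv hp₀
  mul := gaugeMul hp₀
  src_mul := by
    rintro ⟨η, ξ⟩ ⟨l, k⟩ e
    obtain ⟨g, hg⟩ := (baseClass_eq hp₀).1 (Eq.symm e)
    exact (congrArg _ (gaugeMul_mk hp₀ η ξ l k g hg e)).trans (baseClass_act hp₀ k g)
  tgt_mul := by
    rintro ⟨η, ξ⟩ ⟨l, k⟩ e
    obtain ⟨g, hg⟩ := (baseClass_eq hp₀).1 (Eq.symm e)
    exact (congrArg (gaugeTgt hp₀) (gaugeMul_mk hp₀ η ξ l k g hg e)).trans rfl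
  mul_assoc := by
    rintro ⟨η, ξ⟩ ⟨l, k⟩ ⟨m, n⟩ e e'
    obtain ⟨g, hg⟩ := (baseClass_eq hp₀).1 (Eq.symm e)
    obtain ⟨h, hh⟩ := (baseClass_eq hp₀).1 (Eq.symm e')
    have a1 := gaugeMul_mk hp₀ η ξ l k g hg e
    have a2 := gaugeMul_mk hp₀ l k m n h hh e'
    change gaugeMul hp₀ (gaugeMul hp₀ (pairClass hp₀ (η, ξ)) (pairClass hp₀ (l, k)) e)
      (pairClass hp₀ (m, n)) _ = gaugeMul hp₀ (pairClass hp₀ (η, ξ))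
        (gaugeMul hp₀ (pairClass hp₀ (l, k)) (pairClass hp₀ (m, n)) e') _
    simp only [a1, a2]
    rw [gaugeMul_mk hp₀ η (bundleAct hp₀ k g) m n _ (by
        rw [show k = bundleAct hp₀ m h from hh, bundleAct_mul]),
      gaugeMul_mk hp₀ η ξ l (bundleAct hp₀ n h) g hg, bundleAct_mul]
  src_unit := by rintro ⟨η⟩; rfl
  tgt_unit := by rintro ⟨η⟩; rfl
  unit_mul := by
    rintro ⟨η, ξ⟩
    refine (gaugeMul_mk hp₀ η η η ξ _ (bundleAct_one hp₀ η).symm _).trans ?_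
    rw [bundleAct_one]; rfl
  mul_unit := by
    rintro ⟨η, ξ⟩
    refine (gaugeMul_mk hp₀ η ξ ξ ξ _ (bundleAct_one hp₀ ξ).symm _).trans ?_
    rw [bundleAct_one]; rfl
  src_inv := by rintro ⟨η, ξ⟩; rfl
  tgt_inv := by rintro ⟨η, ξ⟩; rfl
  inv_mul := by
    rintro ⟨η, ξ⟩
    refine (gaugeMul_mk hp₀ ξ η η ξ _ (bundleAct_one hp₀ η).symm _).trans ?_
    rw [bundleAct_one]; rfl
  mul_inv := by
    rintro ⟨η, ξ⟩
    refine (gaugeMul_mk hp₀ η ξ ξ η _ (bundleAct_one hp₀ ξ).symm _).trans ?_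
    rw [bundleAct_one]; rfl

/-- The quotient manifold structure on `P₀ᵘ / U₀`. -/
def gaugeBaseAtlas (hp₀ : IsStarProjection p₀) : Set (BanachChart (GaugeBase hp₀)) :=
  quotientAtlas (bundleAtlas p₀) (baseClass hp₀)

/-- The quotient manifold structure on `(P₀ᵘ × P₀ᵘ) / U₀`. -/
def gaugeAtlas (hp₀ : IsStarProjection p₀) : Set (BanachChart (GaugeArrows hp₀)) :=
  quotientAtlas (prodAtlas (bundleAtlas p₀) (bundleAtlas p₀)) (pairClass hp₀)

end Unitary

end Algebra

end

/-! Every manifold of the statement sits in a Banach space built from `M` so that, locally, its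
charts and its inclusion are smooth functions of each other; the charts are even restrictions of
smooth maps defined on neighbourhoods in the ambient space. This is `IsEmbeddedAtlas`. For such
manifolds the transition maps, the Hausdorff property and the smoothness of maps given by formulas
like u*u or ηξ* can be read off in the ambient space. A bijection which pulls one embedding back to
the other is automatically a diffeomorphism (`IsEmbeddedAtlas.isDiffeo`).

Submersions are handled through smooth local sections. By the inverse function theorem, having one
is the same as having a differential with bounded right inverse (`isSubmersion_iff`). All the
sections needed come from one construction, `exists_isometry_section`: for projections q near ηη*,
the polar part qη(η*qη)^(-1/2) of qη is a partial isometry with the initial projection of η and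
final projection q, and it depends smoothly on q. The square root is the local inverse of squaring
at the unit.

The charts of the orbit have the explicit inverse `projOfCoord`, where p + φ is an idempotent and
the point is its range projection. The arrows x are embedded by the triple (l(x), x, r(x)). In a
chart with coordinates (φ', a, φ) at (p', p), the partial isometries are cut out by a*(1 + φ'*φ')a =
p + φ*φ. At a partial isometry u taken as the centre of the chart, the left side minus the right
side has differential k ↦ u*k + k*u in the middle coordinate, and m ↦ um/2 inverts this on the right
for the values that occur. `exists_mem_submanifoldAtlas` turns this into slice charts. The equation
η*η = p₀ is treated in the same way.

By polar decomposition (`exists_isometry_of_mem_projOrbit`) the two maps of the theorem are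
bijections, and their composites with the quotient projections have smooth local sections. By
`IsEmbeddedAtlas.quotient` the quotients are therefore manifolds, embedded in `M` by these maps.
Since the maps also respect the groupoid operations, `isBanachLie_of_isometries` applies to both
groupoids. -/

noncomputable section

open Filter Topology

/-! ### Maps which are smooth near a point of a Banach space -/

section SmoothNear

variable {E F G : Type*} [NormedAddCommGroup E] [NormedSpace ℝ E] [NormedAddCommGroup F]
  [NormedSpace ℝ F] [NormedAddCommGroup G] [NormedSpace ℝ G]

/-- `f` is smooth on a neighbourhood of `v`. -/
def SmoothNear (f : E → F) (v : E) : Prop := ∀ᶠ w in 𝓝 v, ContDiffAt ℝ ∞ f w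

theorem SmoothNear.contDiffAt {f : E → F} {v : E} (h : SmoothNear f v) : ContDiffAt ℝ ∞ f v :=
  h.self_of_nhds

theorem SmoothNear.continuousAt {f : E → F} {v : E} (h : SmoothNear f v) : ContinuousAt f v :=
  h.contDiffAt.continuousAt

theorem SmoothNear.hasFDerivAt {f : E → F} {v : E} (h : SmoothNear f v) :
    HasFDerivAt f (fderiv ℝ f v) v :=
  (h.contDiffAt.differentiableAt (by simp)).hasFDerivAt

theorem SmoothNear.eventually {f : E → F} {v : E} (h : SmoothNear f v) :
    ∀ᶠ w in 𝓝 v, SmoothNear f w :=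
  eventually_eventually_nhds.2 h

theorem ContDiff.smoothNear {f : E → F} (h : ContDiff ℝ ∞ f) (v : E) : SmoothNear f v :=
  Eventually.of_forall fun _ => h.contDiffAt

theorem ContinuousLinearMap.smoothNear (f : E →L[ℝ] F) (v : E) : SmoothNear f v :=
  f.contDiff.smoothNear v

theorem ContDiffOn.smoothNear {f : E → F} {s : Set E} (h : ContDiffOn ℝ ∞ f s) (hs : IsOpen s)
    {v : E} (hv : v ∈ s) : SmoothNear f v := by
  filter_upwards [hs.mem_nhds hv] with w hw using h.contDiffAt (hs.mem_nhds hw)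

theorem SmoothNear.congr {f g : E → F} {v : E} (h : SmoothNear f v) (e : g =ᶠ[𝓝 v] f) :
    SmoothNear g v := by
  filter_upwards [h, eventually_eventually_nhds.2 e] with w hw hw' using hw.congr_of_eventuallyEq hw'

theorem SmoothNear.comp {g : F → G} {f : E → F} {v : E} (hg : SmoothNear g (f v))
    (hf : SmoothNear f v) : SmoothNear (fun w => g (f w)) v := by
  filter_upwards [hf, hf.continuousAt.eventually hg] with w hw hw' using hw'.comp w hw

theorem SmoothNear.clm_comp {f : E → F} {v : E} (L : F →L[ℝ] G) (hf : SmoothNear f v) :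
    SmoothNear (fun w => L (f w)) v :=
  SmoothNear.comp (L.smoothNear _) hf

theorem SmoothNear.prodMk {f : E → F} {g : E → G} {v : E} (hf : SmoothNear f v)
    (hg : SmoothNear g v) : SmoothNear (fun w => (f w, g w)) v := by
  filter_upwards [hf, hg] with w hw hw' using hw.prodMk hw'

theorem SmoothNear.fst {f : E → F × G} {v : E} (hf : SmoothNear f v) :
    SmoothNear (fun w => (f w).1) v := hf.clm_comp (ContinuousLinearMap.fst ℝ F G)

theorem SmoothNear.snd {f : E → F × G} {v : E} (hf : SmoothNear f v) :
    SmoothNear (fun w => (f w).2) v := hf.clm_comp (ContinuousLinearMap.snd ℝ F G)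

theorem smoothNear_id {v : E} : SmoothNear (fun w : E => w) v := contDiff_id.smoothNear v

theorem smoothNear_const {c : F} {v : E} : SmoothNear (fun _ : E => c) v :=
  contDiff_const.smoothNear v

theorem SmoothNear.add {f g : E → F} {v : E} (hf : SmoothNear f v) (hg : SmoothNear g v) :
    SmoothNear (fun w => f w + g w) v := by
  filter_upwards [hf, hg] with w hw hw' using hw.add hw'

theorem SmoothNear.sub {f g : E → F} {v : E} (hf : SmoothNear f v) (hg : SmoothNear g v) :
    SmoothNear (fun w => f w - g w) v := by
  filter_upwards [hf, hg] with w hw hw' using hw.sub hw'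

section Ring

variable {A : Type*} [NormedRing A] [NormedAlgebra ℝ A]

theorem SmoothNear.mul {f g : E → A} {v : E} (hf : SmoothNear f v) (hg : SmoothNear g v) :
    SmoothNear (fun w => f w * g w) v := by
  filter_upwards [hf, hg] with w hw hw' using hw.mul hw'

theorem SmoothNear.ringInverse [CompleteSpace A] {f : E → A} {v : E} (hf : SmoothNear f v)
    (h : IsUnit (f v)) : SmoothNear (fun w => Ring.inverse (f w)) v := by
  refine SmoothNear.comp (g := Ring.inverse) ?_ hf
  filter_upwards [Units.isOpen.mem_nhds h] with w hw
  obtain ⟨w, rfl⟩ := hw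
  exact contDiffAt_ringInverse ℝ w

end Ring

/-- The inverse function theorem for maps which are smooth near a point. -/
theorem SmoothNear.exists_openPartialHomeomorph [CompleteSpace E] {f : E → F} {v : E}
    (hf : SmoothNear f v) (e : E ≃L[ℝ] F) (he : HasFDerivAt f (e : E →L[ℝ] F) v) :
    ∃ h : OpenPartialHomeomorph E F, v ∈ h.source ∧ (h : E → F) = f ∧
      (∀ w ∈ h.source, SmoothNear f w) ∧ ∀ w ∈ h.target, SmoothNear h.symm w := by
  have hn : (∞ : WithTop ℕ∞) ≠ 0 := by simp
  -- Invertible operators form an open set, so the derivative stays invertible near v. Cutting the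
  -- source down to such points makes the inverse smooth on the whole target, not only at the image
  -- of v.
  have h1 : ∀ᶠ w in 𝓝 v, fderiv ℝ f w ∈ range ((↑) : (E ≃L[ℝ] F) → E →L[ℝ] F) := by
    have hc : ContinuousAt (fderiv ℝ f) v :=
      (hf.contDiffAt.fderiv_right (m := 0) (by simp)).continuousAt
    refine hc.eventually (ContinuousLinearEquiv.isOpen.mem_nhds ?_)
    rw [he.fderiv]; exact mem_range_self e
  obtain ⟨U, hU, hUo, hv⟩ := eventually_nhds_iff.1 (hf.eventually.and h1)
  let h₀ := hf.contDiffAt.toOpenPartialHomeomorph f he hn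
  refine ⟨h₀.restrOpen U hUo, ⟨hf.contDiffAt.mem_toOpenPartialHomeomorph_source he hn, hv⟩, rfl,
    fun w hw => (hU w hw.2).1, fun w hw => ?_⟩
  have key : ∀ w' ∈ (h₀.restrOpen U hUo).target, ContDiffAt ℝ ∞ (h₀.restrOpen U hUo).symm w' := by
    intro w' hw'
    have hs := (h₀.restrOpen U hUo).map_target hw'
    obtain ⟨hs1, e', he'⟩ := hU _ hs.2
    refine (h₀.restrOpen U hUo).contDiffAt_symm (f₀' := e') hw' ?_ hs1.contDiffAt
    rw [he']
    exact hs1.hasFDerivAt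
  filter_upwards [(h₀.restrOpen U hUo).open_target.mem_nhds hw] with w' hw' using key w' hw'

/-- A map whose derivative has a right inverse has a smooth local section. -/
theorem SmoothNear.exists_section [CompleteSpace F] {f : E → F} {v : E} (hf : SmoothNear f v)
    (R : F →L[ℝ] E) (hR : (fderiv ℝ f v).comp R = ContinuousLinearMap.id ℝ F) :
    ∃ s : F → E, SmoothNear s (f v) ∧ s (f v) = v ∧ ∀ᶠ w in 𝓝 (f v), f (s w) = w := by
  have hv : v + R 0 = v := by simp
  -- On the affine slice v + range R the derivative of f becomes the identity, so the inverse
  -- function theorem applies to w ↦ f (v + R w); the section takes its values in this slice.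
  have h1 : SmoothNear (fun w => f (v + R w)) 0 :=
    SmoothNear.comp (by rwa [hv]) (smoothNear_const.add (R.smoothNear _))
  have h2 : HasFDerivAt (fun w => f (v + R w)) ((ContinuousLinearEquiv.refl ℝ F : F ≃L[ℝ] F) :
      F →L[ℝ] F) 0 := by
    have h3 : HasFDerivAt f (fderiv ℝ f v) (v + R 0) := by rw [hv]; exact hf.hasFDerivAt
    have h4 : HasFDerivAt (fun w => v + R w) R 0 := R.hasFDerivAt.const_add v
    have := h3.comp (0 : F) h4
    rw [hR] at this
    exact this
  obtain ⟨h, h0, hh, -, hs⟩ := h1.exists_openPartialHomeomorph _ h2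
  have hfv : h 0 = f v := by rw [hh]; simp
  have ht : f v ∈ h.target := hfv ▸ h.map_source h0
  refine ⟨fun w => v + R (h.symm w), smoothNear_const.add ((hs _ ht).clm_comp R), ?_, ?_⟩
  · change v + R (h.symm (f v)) = v
    rw [← hfv, h.left_inv h0, hv]
  · filter_upwards [h.open_target.mem_nhds ht] with w hw
    have := h.right_inv hw
    rwa [hh] at this

/-- The squaring map of a Banach algebra has a smooth inverse near the unit. -/
theorem exists_smooth_sqrt (A : Type*) [NormedRing A] [NormedAlgebra ℝ A] [CompleteSpace A] :
    ∃ S : A → A, SmoothNear S 1 ∧ S 1 = 1 ∧ (∀ᶠ a in 𝓝 (1 : A), S a * S a = a) ∧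
      ∀ᶠ s in 𝓝 (1 : A), S (s * s) = s := by
  have h1 : SmoothNear (fun s : A => s * s) 1 := smoothNear_id.mul smoothNear_id
  -- The derivative of s ↦ s² at 1 is multiplication by 2.
  let e : A ≃L[ℝ] A := ContinuousLinearEquiv.smulLeft (Units.mk0 (2 : ℝ) two_ne_zero)
  have h2 : HasFDerivAt (fun s : A => s * s) (e : A →L[ℝ] A) 1 := by
    have := (hasFDerivAt_id (𝕜 := ℝ) (1 : A)).mul' (hasFDerivAt_id (1 : A))
    refine this.congr_fderiv ?_
    ext x
    simp [e, two_smul, Units.smul_def]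
  obtain ⟨h, h0, hh, -, hs⟩ := h1.exists_openPartialHomeomorph _ h2
  have hfv : h 1 = 1 := by rw [hh]; simp
  have ht : (1 : A) ∈ h.target := hfv ▸ h.map_source h0
  refine ⟨h.symm, hs _ ht, by nth_rw 1 [← hfv]; exact h.left_inv h0, ?_, ?_⟩
  · filter_upwards [h.open_target.mem_nhds ht] with w hw
    have := h.right_inv hw
    rwa [hh] at this
  · filter_upwards [h.open_source.mem_nhds h0] with w hw
    have := h.left_inv hw
    rwa [hh] at this

end SmoothNear

/-! ### Smooth maps in charts -/

section Charts

variable {X Y Z : Type u}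

namespace BanachChart

/-- The filter of neighbourhoods of `x` in the domain of the chart `c`. -/
def nhd (c : BanachChart X) (x : X) : Filter X := comap c.map (𝓝 (c.map x)) ⊓ 𝓟 c.dom

theorem eventually_nhd {c : BanachChart X} {x : X} {P : X → Prop} :
    (∀ᶠ y in c.nhd x, P y) ↔ ∀ᶠ v in 𝓝 (c.map x), ∀ y ∈ c.dom, c.map y = v → P y := by
  rw [nhd, eventually_inf_principal, eventually_comap]
  exact eventually_congr (Eventually.of_forall fun v =>
    ⟨fun h y hy e => h y e hy, fun h y e hy => h y hy e⟩)

theorem eventually_nhd_iff {c : BanachChart X} {x : X} {P : X → Prop} :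
    (∀ᶠ y in c.nhd x, P y) ↔
      ∃ V : Set c.E, IsOpen V ∧ c.map x ∈ V ∧ ∀ y ∈ c.dom, c.map y ∈ V → P y := by
  rw [eventually_nhd, eventually_nhds_iff]
  constructor
  · rintro ⟨V, h, hV, hx⟩
    exact ⟨V, hV, hx, fun y hy hyV => h _ hyV y hy rfl⟩
  · rintro ⟨V, hV, hx, h⟩
    exact ⟨V, by rintro _ hv y hy rfl; exact h y hy hv, hV, hx⟩

theorem self_of_nhd {c : BanachChart X} {x : X} {P : X → Prop} (h : ∀ᶠ y in c.nhd x, P y)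
    (hx : x ∈ c.dom) : P x :=
  (eventually_nhd.1 h).self_of_nhds x hx rfl

theorem eventually_mem_dom (c : BanachChart X) (x : X) : ∀ᶠ y in c.nhd x, y ∈ c.dom :=
  mem_inf_of_right (mem_principal_self _)

theorem tendsto_map (c : BanachChart X) (x : X) : Tendsto c.map (c.nhd x) (𝓝 (c.map x)) :=
  tendsto_comap.mono_left inf_le_left

theorem IsChart.eventually_mem_image {c : BanachChart X} (hc : c.IsChart) {x : X}
    (hx : x ∈ c.dom) : ∀ᶠ v in 𝓝 (c.map x), v ∈ c.map '' c.dom :=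
  hc.2.mem_nhds (mem_image_of_mem _ hx)

/-- `f` is smooth near `x`, as seen in the charts `c` and `d`. -/
def SmoothAt (c : BanachChart X) (d : BanachChart Y) (f : X → Y) (x : X) : Prop :=
  x ∈ c.dom ∧ ∃ T : c.E → d.E, SmoothNear T (c.map x) ∧
    ∀ᶠ y in c.nhd x, f y ∈ d.dom ∧ T (c.map y) = d.map (f y)

theorem Represents.smoothNear {c : BanachChart X} {d : BanachChart Y} {f : X → Y} {x : X}
    {V : Set c.E} {T : c.E → d.E} (h : c.Represents d f x V T) : SmoothNear T (c.map x) :=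
  h.2.2.2.1.smoothNear h.2.1 h.2.2.1

theorem Represents.eventually {c : BanachChart X} {d : BanachChart Y} {f : X → Y} {x : X}
    {V : Set c.E} {T : c.E → d.E} (h : c.Represents d f x V T) :
    ∀ᶠ y in c.nhd x, f y ∈ d.dom ∧ T (c.map y) = d.map (f y) :=
  eventually_nhd_iff.2 ⟨V, h.2.1, h.2.2.1, h.2.2.2.2⟩

theorem exists_represents {c : BanachChart X} {d : BanachChart Y} {f : X → Y} {x : X}
    {T : c.E → d.E} (hx : x ∈ c.dom) (hT : SmoothNear T (c.map x))
    (h : ∀ᶠ y in c.nhd x, f y ∈ d.dom ∧ T (c.map y) = d.map (f y)) :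
    ∃ V, c.Represents d f x V T := by
  obtain ⟨V, hV, hVo, hxV⟩ := eventually_nhds_iff.1 (hT.and (eventually_nhd.1 h))
  exact ⟨V, hx, hVo, hxV, fun v hv => (hV v hv).1.contDiffWithinAt,
    fun y hy hyV => (hV _ hyV).2 y hy rfl⟩

theorem smoothAt_iff {c : BanachChart X} {d : BanachChart Y} {f : X → Y} {x : X} :
    c.SmoothAt d f x ↔ ∃ (V : Set c.E) (T : c.E → d.E), c.Represents d f x V T := by
  constructor
  · rintro ⟨hx, T, hT, h⟩
    obtain ⟨V, hV⟩ := exists_represents hx hT h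
    exact ⟨V, T, hV⟩
  · rintro ⟨V, T, h⟩
    exact ⟨h.1, T, h.smoothNear, h.eventually⟩

namespace SmoothAt

variable {c : BanachChart X} {d : BanachChart Y} {e : BanachChart Z} {f : X → Y} {g : Y → Z}
  {x : X}

theorem mem (h : c.SmoothAt d f x) : f x ∈ d.dom := by
  obtain ⟨hx, T, hT, h⟩ := h
  exact (self_of_nhd h hx).1

theorem tendsto (h : c.SmoothAt d f x) : Tendsto f (c.nhd x) (d.nhd (f x)) := by
  obtain ⟨hx, T, hT, h⟩ := h
  refine tendsto_inf.2 ⟨tendsto_comap_iff.2 ?_, tendsto_principal.2 (h.mono fun y hy => hy.1)⟩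
  rw [← (self_of_nhd h hx).2]
  exact (hT.continuousAt.tendsto.comp (c.tendsto_map x)).congr' (h.mono fun y hy => hy.2)

theorem comp (hg : d.SmoothAt e g (f x)) (hf : c.SmoothAt d f x) :
    c.SmoothAt e (fun y => g (f y)) x := by
  have ht := hf.tendsto
  obtain ⟨hx, T, hT, h⟩ := hf
  obtain ⟨-, S, hS, h'⟩ := hg
  refine ⟨hx, fun v => S (T v), SmoothNear.comp (by rwa [(self_of_nhd h hx).2]) hT, ?_⟩
  filter_upwards [h, ht.eventually h'] with y hy hy'
  exact ⟨hy'.1, by rw [hy.2, hy'.2]⟩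

theorem congr {f' : X → Y} (hf : c.SmoothAt d f x) (h : ∀ᶠ y in c.nhd x, f' y = f y) :
    c.SmoothAt d f' x := by
  obtain ⟨hx, T, hT, h'⟩ := hf
  refine ⟨hx, T, hT, ?_⟩
  filter_upwards [h, h'] with y hy hy'
  rwa [hy]

end SmoothAt

theorem SmoothTransition.smoothAt {c d : BanachChart X} (hc : c.IsChart)
    (h : c.SmoothTransition d) {x : X} (hx : x ∈ c.dom) (hx' : x ∈ d.dom) :
    c.SmoothAt d (fun y => y) x := by
  obtain ⟨ho, T, hT, h⟩ := h
  have hmem : c.map x ∈ c.map '' (c.dom ∩ d.dom) := mem_image_of_mem _ ⟨hx, hx'⟩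
  refine ⟨hx, T, hT.smoothNear ho hmem, eventually_nhd_iff.2 ⟨_, ho, hmem, ?_⟩⟩
  rintro y hy ⟨z, hz, e⟩
  obtain rfl := hc.1 hz.1 hy e
  exact ⟨hz.2, h z hz⟩

/-- The local representatives need no gluing: on the image of the overlap each of them must coincide
with the second chart composed with the inverse of the first. -/
theorem smoothTransition_of_smoothAt {c d : BanachChart X} (hc : c.IsChart)
    (h : ∀ x ∈ c.dom, x ∈ d.dom → c.SmoothAt d (fun y => y) x) : c.SmoothTransition d := by
  -- `invFunOn` needs an inhabited type.
  rcases isEmpty_or_nonempty X with hX | hX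
  · exact ⟨by simp [eq_empty_of_isEmpty], fun _ => 0, contDiffOn_const, fun x => hX.elim x⟩
  have key : ∀ x ∈ c.dom ∩ d.dom, ∀ᶠ v in 𝓝 (c.map x),
      v ∈ c.map '' (c.dom ∩ d.dom) := by
    intro x hx
    obtain ⟨-, T, -, hT⟩ := h x hx.1 hx.2
    filter_upwards [hc.eventually_mem_image hx.1, eventually_nhd.1 hT]
    rintro _ ⟨y, hy, rfl⟩ hv
    exact mem_image_of_mem _ ⟨hy, (hv y hy rfl).1⟩
  refine ⟨?_, ?_⟩
  · rw [isOpen_iff_mem_nhds]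
    rintro _ ⟨x, hx, rfl⟩
    exact key x hx
  · have hinv : ∀ x ∈ c.dom ∩ d.dom, invFunOn c.map (c.dom ∩ d.dom) (c.map x) = x :=
      fun x hx => (hc.1.mono inter_subset_left).leftInvOn_invFunOn hx
    refine ⟨fun v => d.map (invFunOn c.map (c.dom ∩ d.dom) v), ?_,
      fun x hx => congrArg d.map (hinv x hx)⟩
    rintro _ ⟨x, hx, rfl⟩
    obtain ⟨-, T, hT, hT'⟩ := h x hx.1 hx.2
    refine (hT.congr ?_).contDiffAt.contDiffWithinAt
    filter_upwards [key x hx, eventually_nhd.1 hT']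
    rintro _ ⟨y, hy, rfl⟩ hv
    rw [hinv y hy, (hv y hy.1 rfl).2]

/-- `f` is smooth near `x` and has a smooth local section through `x`. -/
def SplitAt (c : BanachChart X) (d : BanachChart Y) (f : X → Y) (x : X) : Prop :=
  c.SmoothAt d f x ∧ ∃ σ : Y → X, σ (f x) = x ∧ d.SmoothAt c σ (f x) ∧
    ∀ᶠ y in d.nhd (f x), f (σ y) = y

/-- The section of the coordinate expression provided by the right inverse is carried back to the
sets. Near the point its values stay in the open image of the chart `c`, so they are coordinates of
actual points. -/
theorem SubmersiveAt.splitAt {c : BanachChart X} {d : BanachChart Y} {f : X → Y} {x : X}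
    (hc : c.IsChart) (hd : d.IsChart) (h : c.SubmersiveAt d f x) : c.SplitAt d f x := by
  obtain ⟨V, T, hT, R, hR⟩ := h
  have hx := hT.1
  have : Nonempty X := ⟨x⟩
  have hfx := self_of_nhd hT.eventually hx
  obtain ⟨s, hs, hsx, hs'⟩ := hT.smoothNear.exists_section R hR
  rw [hfx.2] at hs hsx hs'
  have hinv : ∀ x ∈ c.dom, invFunOn c.map c.dom (c.map x) = x :=
    fun x hx => hc.1.leftInvOn_invFunOn hx
  have hst : Tendsto s (𝓝 (d.map (f x))) (𝓝 (c.map x)) := by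
    have := hs.continuousAt.tendsto
    rwa [hsx] at this
  have hmem : ∀ᶠ y in d.nhd (f x), y ∈ d.dom ∧ T (s (d.map y)) = d.map y ∧
      ∃ x' ∈ c.dom, c.map x' = s (d.map y) ∧ f x' ∈ d.dom ∧ T (c.map x') = d.map (f x') := by
    filter_upwards [d.eventually_mem_dom (f x), (d.tendsto_map (f x)).eventually hs',
      (d.tendsto_map (f x)).eventually (hst.eventually (hc.eventually_mem_image hx)),
      (d.tendsto_map (f x)).eventually (hst.eventually (eventually_nhd.1 hT.eventually))]
    rintro y hy hy' ⟨x', hx', e⟩ h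
    exact ⟨hy, hy', x', hx', e, h x' hx' e⟩
  refine ⟨smoothAt_iff.2 ⟨V, T, hT⟩, fun y => invFunOn c.map c.dom (s (d.map y)), ?_,
    ⟨hfx.1, s, hs, ?_⟩, ?_⟩
  · change invFunOn c.map c.dom (s (d.map (f x))) = x
    rw [hsx, hinv x hx]
  · filter_upwards [hmem]
    rintro y ⟨-, -, x', hx', e, -⟩
    rw [← e, hinv x' hx']
    exact ⟨hx', rfl⟩
  · filter_upwards [hmem]
    rintro y ⟨hy, e1, x', hx', e, hf, e2⟩
    rw [← e, hinv x' hx']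
    refine hd.1 hf hy ?_
    rw [← e2, e, e1]

/-- Differentiating "f after the section is the identity" in coordinates shows that the derivative
of the section is the required right inverse. -/
theorem SplitAt.submersiveAt {c : BanachChart X} {d : BanachChart Y} {f : X → Y} {x : X}
    (hd : d.IsChart) (h : c.SplitAt d f x) : c.SubmersiveAt d f x := by
  obtain ⟨⟨hx, T, hT, h⟩, σ, hσ, ⟨hfx, S, hS, h'⟩, h''⟩ := h
  obtain ⟨V, hV⟩ := exists_represents hx hT h
  refine ⟨V, T, hV, fderiv ℝ S (d.map (f x)), ?_⟩
  have e := (self_of_nhd h' hfx).2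
  rw [hσ] at e
  have ht : Tendsto σ (d.nhd (f x)) (c.nhd x) := by
    have := SmoothAt.tendsto ⟨hfx, S, hS, h'⟩
    rwa [hσ] at this
  have h1 := hT.hasFDerivAt
  rw [← e] at h1 ⊢
  have h2 := h1.comp _ hS.hasFDerivAt
  have h3 : (T ∘ S) =ᶠ[𝓝 (d.map (f x))] id := by
    filter_upwards [hd.eventually_mem_image hfx, eventually_nhd.1 h', eventually_nhd.1 h'',
      eventually_nhd.1 (ht.eventually h)]
    rintro _ ⟨y, hy, rfl⟩ h1 h2 h3
    rw [comp_apply, (h1 y hy rfl).2, (h3 y hy rfl).2, h2 y hy rfl, id]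
  exact (h2.unique ((hasFDerivAt_id _).congr_of_eventuallyEq h3))

end BanachChart

/-! ### Smooth maps between manifolds -/

/-- The neighbourhoods of `x` in the manifold with atlas `A`. -/
def atlasNhd (A : Set (BanachChart X)) (x : X) : Filter X :=
  ⨆ c ∈ {c ∈ A | x ∈ c.dom}, c.nhd x

/-- `f` is smooth near `x`. -/
def SmoothMapAt (A : Set (BanachChart X)) (B : Set (BanachChart Y)) (f : X → Y) (x : X) : Prop :=
  ∃ c ∈ A, ∃ d ∈ B, c.SmoothAt d f x

/-- `f` is smooth near `x` and has a smooth local section through `x`. -/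
def SplitMapAt (A : Set (BanachChart X)) (B : Set (BanachChart Y)) (f : X → Y) (x : X) : Prop :=
  SmoothMapAt A B f x ∧ ∃ σ : Y → X, σ (f x) = x ∧ SmoothMapAt B A σ (f x) ∧
    ∀ᶠ y in atlasNhd B (f x), f (σ y) = y

variable {A : Set (BanachChart X)} {B : Set (BanachChart Y)}

theorem isSmoothMap_iff {f : X → Y} : IsSmoothMap A B f ↔ ∀ x, SmoothMapAt A B f x := by
  simp only [IsSmoothMap, SmoothMapAt, BanachChart.smoothAt_iff]

theorem IsSmoothAtlas.smoothAt_id (hA : IsSmoothAtlas A) {c d : BanachChart X} (hc : c ∈ A)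
    (hd : d ∈ A) {x : X} (hx : x ∈ c.dom) (hx' : x ∈ d.dom) : c.SmoothAt d (fun y => y) x :=
  (hA.transition c hc d hd).smoothAt (hA.chart c hc) hx hx'

theorem IsSmoothAtlas.nhd_eq (hA : IsSmoothAtlas A) {c d : BanachChart X} (hc : c ∈ A)
    (hd : d ∈ A) {x : X} (hx : x ∈ c.dom) (hx' : x ∈ d.dom) : c.nhd x = d.nhd x :=
  le_antisymm (hA.smoothAt_id hc hd hx hx').tendsto (hA.smoothAt_id hd hc hx' hx).tendsto

theorem IsSmoothAtlas.atlasNhd_eq (hA : IsSmoothAtlas A) {c : BanachChart X} (hc : c ∈ A) {x : X}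
    (hx : x ∈ c.dom) : atlasNhd A x = c.nhd x :=
  le_antisymm (iSup₂_le fun _ hd => (hA.nhd_eq hd.1 hc hd.2 hx).le)
    (le_iSup₂_of_le c ⟨hc, hx⟩ le_rfl)

theorem SmoothMapAt.smoothAt (hA : IsSmoothAtlas A) (hB : IsSmoothAtlas B) {f : X → Y} {x : X}
    (h : SmoothMapAt A B f x) {c : BanachChart X} (hc : c ∈ A) (hx : x ∈ c.dom)
    {d : BanachChart Y} (hd : d ∈ B) (hfx : f x ∈ d.dom) : c.SmoothAt d f x := by
  obtain ⟨c', hc', d', hd', h⟩ := h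
  exact (hB.smoothAt_id hd' hd h.mem hfx).comp (h.comp (hA.smoothAt_id hc hc' hx h.1))

theorem SplitMapAt.splitAt (hA : IsSmoothAtlas A) (hB : IsSmoothAtlas B) {f : X → Y} {x : X}
    (h : SplitMapAt A B f x) {c : BanachChart X} (hc : c ∈ A) (hx : x ∈ c.dom)
    {d : BanachChart Y} (hd : d ∈ B) (hfx : f x ∈ d.dom) : c.SplitAt d f x := by
  obtain ⟨h1, σ, h2, h3, h4⟩ := h
  rw [hB.atlasNhd_eq hd hfx] at h4
  exact ⟨h1.smoothAt hA hB hc hx hd hfx, σ, h2, h3.smoothAt hB hA hd hfx hc (by rwa [h2]), h4⟩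

theorem BanachChart.SplitAt.splitMapAt (hB : IsSmoothAtlas B) {f : X → Y} {x : X}
    {c : BanachChart X} (hc : c ∈ A) {d : BanachChart Y} (hd : d ∈ B) (h : c.SplitAt d f x) :
    SplitMapAt A B f x := by
  obtain ⟨h1, σ, h2, h3, h4⟩ := h
  rw [← hB.atlasNhd_eq hd h1.mem] at h4
  exact ⟨⟨c, hc, d, hd, h1⟩, σ, h2, ⟨d, hd, c, hc, h3⟩, h4⟩

/-- The form with sections does not mention derivatives and does not depend on the charts, so a
submersion can be proved by exhibiting a formula for a section. -/
theorem isSubmersion_iff (hA : IsSmoothAtlas A) (hB : IsSmoothAtlas B) {f : X → Y} :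
    IsSubmersion A B f ↔ ∀ x, SplitMapAt A B f x := by
  refine forall_congr' fun x => ⟨?_, fun h => ?_⟩
  · rintro ⟨c, hc, d, hd, h⟩
    exact (h.splitAt (hA.chart c hc) (hB.chart d hd)).splitMapAt hB hc hd
  · have h' := h
    obtain ⟨⟨c, hc, d, hd, hs⟩, -⟩ := h'
    exact ⟨c, hc, d, hd, (h.splitAt hA hB hc hs.1 hd hs.mem).submersiveAt (hB.chart d hd)⟩

end Charts

section Embedded

variable {X Y Z : Type u} {A : Set (BanachChart X)} {B : Set (BanachChart Y)}

/-! ### Manifolds embedded in Banach spaces -/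

variable {E F : Type*} [NormedAddCommGroup E] [NormedSpace ℝ E] [NormedAddCommGroup F]
  [NormedSpace ℝ F]

namespace BanachChart

/-- Near `x`, the chart `c` and the map `j` into a Banach space are smooth functions of each other,
where the second function is defined on a neighbourhood in the Banach space. -/
structure Embeds (c : BanachChart X) (j : X → E) (x : X) : Prop where
  mem : x ∈ c.dom
  smooth : ∃ T : c.E → E, SmoothNear T (c.map x) ∧ ∀ᶠ y in c.nhd x, T (c.map y) = j y
  ambient : ∃ Φ : E → c.E, SmoothNear Φ (j x) ∧
    ∀ᶠ v in 𝓝 (j x), ∀ y, j y = v → y ∈ c.dom ∧ Φ v = c.map y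

namespace Embeds

variable {c : BanachChart X} {d : BanachChart Y} {j : X → E} {k : Y → F} {x : X}

/-- The chart topology is the one induced by j: continuity of j in the chart gives one inclusion,
and the ambient extension of the chart gives the other. -/
theorem nhd_eq (h : c.Embeds j x) : c.nhd x = comap j (𝓝 (j x)) := by
  obtain ⟨hx, ⟨T, hT, hT'⟩, Φ, hΦ, hΦ'⟩ := h
  refine le_antisymm (tendsto_iff_comap.1 ?_)
    (le_inf ?_ (le_principal_iff.2 (eventually_comap.2 (hΦ'.mono fun v hv y hy => (hv y hy).1))))
  · have e := BanachChart.self_of_nhd hT' hx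
    rw [← e]
    exact (hT.continuousAt.tendsto.comp (c.tendsto_map x)).congr' hT'
  · refine tendsto_iff_comap.1 ?_
    rw [← (hΦ'.self_of_nhds x rfl).2]
    refine (hΦ.continuousAt.tendsto.comp tendsto_comap).congr' ?_
    exact eventually_comap.2 (hΦ'.mono fun v hv y hy => by rw [comp_apply, hy, (hv y hy).2])

/-- In coordinates f is the inverse chart into the first ambient space, followed by H, followed by
the ambient extension of the second chart. -/
theorem smoothAt_of_ambient (hc : c.Embeds j x) {f : X → Y} (hd : d.Embeds k (f x)) (H : E → F)
    (hH : SmoothNear H (j x)) (h : ∀ᶠ v in 𝓝 (j x), ∀ y, j y = v → k (f y) = H v) :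
    c.SmoothAt d f x := by
  have hn := hc.nhd_eq
  obtain ⟨hx, ⟨T, hT, hT'⟩, -⟩ := hc
  obtain ⟨-, -, Φ, hΦ, hΦ'⟩ := hd
  have e1 := BanachChart.self_of_nhd hT' hx
  have e2 : k (f x) = H (j x) := h.self_of_nhds x rfl
  rw [e2] at hΦ hΦ'
  refine ⟨hx, fun v => Φ (H (T v)), SmoothNear.comp (by rwa [e1]) (SmoothNear.comp
    (by rwa [e1]) hT), ?_⟩
  have h3 : ∀ᶠ y in c.nhd x, H (j y) = k (f y) ∧ ∀ z, k z = H (j y) → z ∈ d.dom ∧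
      Φ (H (j y)) = d.map z := by
    rw [hn, eventually_comap]
    filter_upwards [h, hH.continuousAt.eventually hΦ']
    rintro v h1 h2 y rfl
    exact ⟨(h1 y rfl).symm, h2⟩
  filter_upwards [hT', h3] with y hy hy'
  rw [hy]
  exact hy'.2 _ hy'.1.symm

/-- An embedding is pulled back along f. The ambient extension of the new chart is that of the old
one followed by g in coordinates, which is why a left inverse is enough. With f the identity this
covers compatible charts; with f a bijection it covers quotients. -/
theorem of_smoothAt {f : Y → X} {g : X → Y} {y : Y} (hc : c.Embeds j (f y))
    (h : d.SmoothAt c f y) (h' : c.SmoothAt d g (f y)) (hg : LeftInverse g f) :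
    d.Embeds (fun z => j (f z)) y := by
  have ht := h.tendsto
  have hn := hc.nhd_eq
  obtain ⟨hx, ⟨T, hT, hT'⟩, Φ, hΦ, hΦ'⟩ := hc
  obtain ⟨hx', S, hS, hS'⟩ := h
  obtain ⟨-, S', hS1, hS2⟩ := h'
  have e := hΦ'.self_of_nhds _ rfl
  refine ⟨hx', ⟨fun v => T (S v), SmoothNear.comp ?_ hS, ?_⟩, fun v => S' (Φ v),
    SmoothNear.comp ?_ hΦ, ?_⟩
  · rwa [(BanachChart.self_of_nhd hS' hx').2]
  · filter_upwards [hS', ht.eventually hT'] with z hz hz'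
    rw [hz.2, hz']
  · rwa [e.2]
  · rw [hn] at hS2
    filter_upwards [hΦ', eventually_comap.1 hS2] with v hv hv' z hz
    have := hv' (f z) hz
    rwa [hg z, ← (hv (f z) hz).2] at this

theorem change (hc : c.Embeds j x) {k : X → F} (G : F → E) (hG : SmoothNear G (k x))
    (hj : ∀ y, G (k y) = j y) (L : E → F) (hL : SmoothNear L (j x)) (hk : ∀ y, L (j y) = k y) :
    c.Embeds k x := by
  obtain ⟨hx, ⟨T, hT, hT'⟩, Φ, hΦ, hΦ'⟩ := hc
  refine ⟨hx, ⟨fun v => L (T v), SmoothNear.comp ?_ hT, ?_⟩, fun v => Φ (G v),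
    SmoothNear.comp ?_ hG, ?_⟩
  · rwa [BanachChart.self_of_nhd hT' hx]
  · filter_upwards [hT'] with y hy
    rw [hy, hk]
  · rwa [hj]
  · have h := hG.continuousAt.tendsto
    rw [hj] at h
    filter_upwards [h.eventually hΦ']
    rintro _ hv y rfl
    exact hv y (hj y).symm

theorem prod {y : Y} (hc : c.Embeds j x) (hd : d.Embeds k y) :
    (c.prod d).Embeds (Prod.map j k) (x, y) := by
  obtain ⟨hx, ⟨T, hT, hT'⟩, Φ, hΦ, hΦ'⟩ := hc
  obtain ⟨hy, ⟨S, hS, hS'⟩, Θ, hΘ, hΘ'⟩ := hd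
  have l1 : Tendsto Prod.fst (𝓝 (c.map x, d.map y)) (𝓝 (c.map x)) := continuous_fst.continuousAt
  have l2 : Tendsto Prod.snd (𝓝 (c.map x, d.map y)) (𝓝 (d.map y)) := continuous_snd.continuousAt
  have l3 : Tendsto Prod.fst (𝓝 (j x, k y)) (𝓝 (j x)) := continuous_fst.continuousAt
  have l4 : Tendsto Prod.snd (𝓝 (j x, k y)) (𝓝 (k y)) := continuous_snd.continuousAt
  refine ⟨⟨hx, hy⟩, ⟨fun v => (T v.1, S v.2), ?_, ?_⟩, fun v => (Φ v.1, Θ v.2), ?_, ?_⟩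
  · exact (SmoothNear.comp (v := (c.map x, d.map y)) hT smoothNear_id.fst).prodMk
      (SmoothNear.comp (v := (c.map x, d.map y)) hS smoothNear_id.snd)
  · refine eventually_nhd.2 ?_
    change ∀ᶠ v in 𝓝 (c.map x, d.map y), _
    filter_upwards [l1.eventually (eventually_nhd.1 hT'), l2.eventually (eventually_nhd.1 hS')]
    rintro _ h1 h2 ⟨x', y'⟩ ⟨hx', hy'⟩ rfl
    exact Prod.ext (h1 x' hx' rfl) (h2 y' hy' rfl)
  · exact (SmoothNear.comp (v := (j x, k y)) hΦ smoothNear_id.fst).prodMk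
      (SmoothNear.comp (v := (j x, k y)) hΘ smoothNear_id.snd)
  · change ∀ᶠ v in 𝓝 (j x, k y), _
    filter_upwards [l3.eventually hΦ', l4.eventually hΘ']
    rintro _ h1 h2 ⟨x', y'⟩ rfl
    exact ⟨⟨(h1 x' rfl).1, (h2 y' rfl).1⟩, Prod.ext (h1 x' rfl).2 (h2 y' rfl).2⟩

end Embeds

end BanachChart

/-- `A` is an atlas of a manifold embedded in the Banach space `E` by `j`. -/
structure IsEmbeddedAtlas (A : Set (BanachChart X)) (j : X → E) : Prop where
  cover : ∀ x, ∃ c ∈ A, x ∈ c.dom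
  chart : ∀ c ∈ A, c.IsChart
  embeds : ∀ c ∈ A, ∀ x ∈ c.dom, c.Embeds j x

theorem exists_separating_charts {c d : BanachChart X} {x y : X} (hx : x ∈ c.dom)
    (hy : y ∈ d.dom) (h : Disjoint (c.nhd x) (d.nhd y)) :
    ∃ (V : Set c.E) (W : Set d.E), IsOpen V ∧ IsOpen W ∧ x ∈ c.dom ∩ c.map ⁻¹' V ∧
      y ∈ d.dom ∩ d.map ⁻¹' W ∧ Disjoint (c.dom ∩ c.map ⁻¹' V) (d.dom ∩ d.map ⁻¹' W) := by
  obtain ⟨s, hs, t, ht, hst⟩ := Filter.disjoint_iff.1 h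
  obtain ⟨V, hV, hxV, h1⟩ := BanachChart.eventually_nhd_iff.1 hs
  obtain ⟨W, hW, hyW, h2⟩ := BanachChart.eventually_nhd_iff.1 ht
  exact ⟨V, W, hV, hW, ⟨hx, hxV⟩, ⟨hy, hyW⟩,
    hst.mono (fun z hz => h1 z hz.1 hz.2) fun z hz => h2 z hz.1 hz.2⟩

namespace IsEmbeddedAtlas

variable {j : X → E} {k : Y → F}

theorem injective (hA : IsEmbeddedAtlas A j) : Injective j := by
  intro x y e
  obtain ⟨c, hc, hx⟩ := hA.cover x
  obtain ⟨-, -, Φ, -, h⟩ := hA.embeds c hc x hx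
  obtain ⟨hy, e'⟩ := h.self_of_nhds y e.symm
  exact (hA.chart c hc).1 hx hy ((h.self_of_nhds x rfl).2.symm.trans e')

theorem smoothAt_of_ambient (hA : IsEmbeddedAtlas A j) {c d : BanachChart X} (hc : c ∈ A)
    (hd : d ∈ A) {x : X} (hx : x ∈ c.dom) (hx' : x ∈ d.dom) : c.SmoothAt d (fun y => y) x :=
  (hA.embeds c hc x hx).smoothAt_of_ambient (hA.embeds d hd x hx') (fun v => v) smoothNear_id
    (Eventually.of_forall fun _ _ h => h)

/-- Any two charts at a point are smooth functions of each other through the ambient space, and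
points are separated by j, which is injective into a Hausdorff space. -/
theorem isSmoothAtlas (hA : IsEmbeddedAtlas A j) : IsSmoothAtlas A where
  cover := hA.cover
  chart := hA.chart
  transition c hc d hd := BanachChart.smoothTransition_of_smoothAt (hA.chart c hc)
    fun _ hx hx' => hA.smoothAt_of_ambient hc hd hx hx'
  hausdorff x y hxy := by
    obtain ⟨c, hc, hx⟩ := hA.cover x
    obtain ⟨d, hd, hy⟩ := hA.cover y
    refine ⟨c, hc, d, hd, exists_separating_charts hx hy ?_⟩
    rw [(hA.embeds c hc x hx).nhd_eq, (hA.embeds d hd y hy).nhd_eq]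
    exact tendsto_comap.disjoint (disjoint_nhds_nhds.2 (hA.injective.ne hxy)) tendsto_comap

theorem atlasNhd_eq (hA : IsEmbeddedAtlas A j) (x : X) : atlasNhd A x = comap j (𝓝 (j x)) := by
  obtain ⟨c, hc, hx⟩ := hA.cover x
  rw [hA.isSmoothAtlas.atlasNhd_eq hc hx, (hA.embeds c hc x hx).nhd_eq]

theorem smoothMapAt (hA : IsEmbeddedAtlas A j) (hB : IsEmbeddedAtlas B k) {f : X → Y} {x : X}
    (H : E → F) (hH : SmoothNear H (j x)) (h : ∀ᶠ v in 𝓝 (j x), ∀ y, j y = v → k (f y) = H v) :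
    SmoothMapAt A B f x := by
  obtain ⟨c, hc, hx⟩ := hA.cover x
  obtain ⟨d, hd, hfx⟩ := hB.cover (f x)
  exact ⟨c, hc, d, hd, (hA.embeds c hc x hx).smoothAt_of_ambient (hB.embeds d hd _ hfx) H hH h⟩

theorem isSmoothMap (hA : IsEmbeddedAtlas A j) (hB : IsEmbeddedAtlas B k) {f : X → Y}
    (H : E → F) (hH : ∀ x, SmoothNear H (j x)) (h : ∀ x, k (f x) = H (j x)) :
    IsSmoothMap A B f :=
  isSmoothMap_iff.2 fun x => hA.smoothMapAt hB H (hH x)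
    (Eventually.of_forall fun _ y hy => by rw [h, hy])

/-- A map is a submersion at `x` if a smooth map `s` of the ambient spaces has values which lie
above the points of `Y` near `f x`. -/
theorem splitMapAt (hA : IsEmbeddedAtlas A j) (hB : IsEmbeddedAtlas B k) {f : X → Y} {x : X}
    (hf : SmoothMapAt A B f x) (s : F → E) (hs : SmoothNear s (k (f x))) (hsx : s (k (f x)) = j x)
    (h : ∀ᶠ v in 𝓝 (k (f x)), ∀ y, k y = v → ∃ x', j x' = s v ∧ f x' = y) :
    SplitMapAt A B f x := by
  classical
  -- The point above y is chosen arbitrarily, but its image under j is prescribed to be s (k y).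
  -- Hence σ is smooth because s is, and it passes through x because j is injective.
  let σ : Y → X := fun y =>
    if h : ∃ x', j x' = s (k y) ∧ f x' = y then h.choose else x
  have hσ : ∀ y, (∃ x', j x' = s (k y) ∧ f x' = y) → j (σ y) = s (k y) ∧ f (σ y) = y := by
    intro y hy
    simp only [σ, dif_pos hy]
    exact hy.choose_spec
  have hx : σ (f x) = x := by
    apply hA.injective
    rw [(hσ (f x) (h.self_of_nhds _ rfl)).1, hsx]
  refine ⟨hf, σ, hx, hB.smoothMapAt hA s hs ?_, ?_⟩
  · filter_upwards [h]
    rintro _ hv y rfl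
    exact (hσ y (hv y rfl)).1
  · rw [hB.atlasNhd_eq, eventually_comap]
    filter_upwards [h] with v hv y hy
    subst hy
    exact (hσ y (hv y rfl)).2

theorem change (hA : IsEmbeddedAtlas A j) {k : X → F} (G : F → E) (hG : ∀ x, SmoothNear G (k x))
    (hj : ∀ y, G (k y) = j y) (L : E → F) (hL : ∀ x, SmoothNear L (j x))
    (hk : ∀ y, L (j y) = k y) : IsEmbeddedAtlas A k :=
  ⟨hA.cover, hA.chart, fun c hc x hx =>
    (hA.embeds c hc x hx).change G (hG x) hj L (hL x) hk⟩

theorem prod (hA : IsEmbeddedAtlas A j) (hB : IsEmbeddedAtlas B k) :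
    IsEmbeddedAtlas (prodAtlas A B) (Prod.map j k) where
  cover := by
    rintro ⟨x, y⟩
    obtain ⟨c, hc, hx⟩ := hA.cover x
    obtain ⟨d, hd, hy⟩ := hB.cover y
    exact ⟨_, ⟨c, hc, d, hd, rfl⟩, hx, hy⟩
  chart := by
    rintro _ ⟨c, hc, d, hd, rfl⟩
    refine ⟨(hA.chart c hc).1.prodMap (hB.chart d hd).1, ?_⟩
    change IsOpen (Prod.map c.map d.map '' (c.dom ×ˢ d.dom))
    rw [prodMap_image_prod]
    exact (hA.chart c hc).2.prod (hB.chart d hd).2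
  embeds := by
    rintro _ ⟨c, hc, d, hd, rfl⟩ ⟨x, y⟩ ⟨hx, hy⟩
    exact (hA.embeds c hc x hx).prod (hB.embeds d hd y hy)

end IsEmbeddedAtlas

theorem isEmbeddedAtlas_vectorAtlas (E : Type u) [NormedAddCommGroup E] [NormedSpace ℝ E]
    [CompleteSpace E] : IsEmbeddedAtlas (vectorAtlas E) (id : E → E) where
  cover x := ⟨_, rfl, mem_univ x⟩
  chart := by
    rintro _ rfl
    exact ⟨injOn_id _, by simp⟩
  embeds := by
    rintro _ rfl x hx
    exact ⟨hx, ⟨id, smoothNear_id, Eventually.of_forall fun _ => rfl⟩, id, smoothNear_id,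
      Eventually.of_forall fun _ _ h => ⟨mem_univ _, h.symm⟩⟩

/-! ### The maximal atlas and submanifolds -/

/-- Compatibility need only be tested, at each point of the new chart, against a single chart of the
atlas; the other charts follow by composing with transitions. -/
theorem mem_maximalAtlas (hA : IsSmoothAtlas A) {c : BanachChart X} (hc : c.IsChart)
    (h : ∀ x ∈ c.dom, ∃ d ∈ A, c.SmoothAt d (fun y => y) x ∧ d.SmoothAt c (fun y => y) x) :
    c ∈ maximalAtlas A := by
  refine ⟨hc, fun d hd => ⟨BanachChart.smoothTransition_of_smoothAt hc fun x hx hx' => ?_,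
    BanachChart.smoothTransition_of_smoothAt (hA.chart d hd) fun x hx' hx => ?_⟩⟩
  · obtain ⟨d', hd', h1, h2⟩ := h x hx
    exact (hA.smoothAt_id hd' hd h2.1 hx').comp h1
  · obtain ⟨d', hd', h1, h2⟩ := h x hx
    exact h2.comp (hA.smoothAt_id hd hd' hx' h2.1)

theorem smoothAt_of_mem_maximalAtlas (hA : IsSmoothAtlas A) {c d : BanachChart X}
    (hc : c ∈ maximalAtlas A) (hd : d ∈ A) {x : X} (hx : x ∈ c.dom) (hx' : x ∈ d.dom) :
    c.SmoothAt d (fun y => y) x ∧ d.SmoothAt c (fun y => y) x :=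
  ⟨(hc.2 d hd).1.smoothAt hc.1 hx hx', (hc.2 d hd).2.smoothAt (hA.chart d hd) hx' hx⟩

theorem toSubspace_of_mem {E : Type u} [NormedAddCommGroup E] [NormedSpace ℝ E]
    {F : Submodule ℝ E} {v : E} (h : v ∈ F) : toSubspace F v = ⟨v, h⟩ := dif_pos h

section Slice

variable {c : BanachChart X} {i : Y → X} {G : Submodule ℝ c.E} {hG : G.ClosedComplemented}

theorem BanachChart.map_mem_of_slice
    (h : c.map '' (c.dom ∩ range i) = c.map '' c.dom ∩ G) {y : Y} (hy : i y ∈ c.dom) :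
    c.map (i y) ∈ G :=
  (h.subset (mem_image_of_mem _ ⟨hy, mem_range_self y⟩)).2

theorem BanachChart.slice_map (h : c.map '' (c.dom ∩ range i) = c.map '' c.dom ∩ G) {y : Y}
    (hy : i y ∈ c.dom) : ((c.slice i G hG).map y : G) = ⟨c.map (i y), c.map_mem_of_slice h hy⟩ :=
  toSubspace_of_mem _

theorem BanachChart.isChart_slice (hi : Injective i) (hc : c.IsChart)
    (h : c.map '' (c.dom ∩ range i) = c.map '' c.dom ∩ G) : (c.slice i G hG).IsChart := by
  refine ⟨fun y hy y' hy' e => ?_, ?_⟩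
  · rw [slice_map h hy, slice_map h hy'] at e
    exact hi (hc.1 hy hy' (congrArg Subtype.val e))
  · have : (c.slice i G hG).map '' (c.slice i G hG).dom =
        (Subtype.val : G → c.E) ⁻¹' (c.map '' c.dom) := by
      ext v
      constructor
      · rintro ⟨y, hy, rfl⟩
        rw [slice_map h hy]
        exact mem_image_of_mem _ hy
      · intro hv
        obtain ⟨_, ⟨hx, y, rfl⟩, e⟩ := h.superset ⟨hv, v.2⟩
        exact ⟨y, hx, by rw [slice_map h hx]; exact Subtype.ext e⟩
    rw [this]
    exact hc.2.preimage continuous_subtype_val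

/-- A continuous projection onto the slice subspace, applied after the ambient extension of the big
chart, extends the slice chart. This is where complementedness is used. -/
theorem BanachChart.Embeds.slice {j : X → E} {y : Y} (hc : c.Embeds j (i y))
    (h : c.map '' (c.dom ∩ range i) = c.map '' c.dom ∩ G) :
    (c.slice i G hG).Embeds (fun y => j (i y)) y := by
  obtain ⟨hx, ⟨T, hT, hT'⟩, Φ, hΦ, hΦ'⟩ := hc
  obtain ⟨P, hP⟩ := id hG
  have e : ((c.slice i G hG).map y : G) = ⟨c.map (i y), c.map_mem_of_slice h hx⟩ :=
    slice_map h hx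
  have e' : G.subtypeL ((c.slice i G hG).map y) = c.map (i y) := congrArg Subtype.val e
  refine ⟨hx, ⟨fun v => T (G.subtypeL v), ?_, ?_⟩, fun v => P (Φ v), hΦ.clm_comp P, ?_⟩
  · exact SmoothNear.comp (by rwa [e']) (G.subtypeL.smoothNear _)
  · refine eventually_nhd.2 ?_
    have ht : Tendsto G.subtypeL (𝓝 ((c.slice i G hG).map y)) (𝓝 (c.map (i y))) := by
      rw [← e']
      exact G.subtypeL.continuous.continuousAt
    filter_upwards [ht.eventually (eventually_nhd.1 hT')]
    rintro _ hv y' hy' rfl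
    rw [slice_map h hy'] at hv ⊢
    exact hv (i y') hy' rfl
  · filter_upwards [hΦ'] with v hv y' hy'
    obtain ⟨h1, h2⟩ := hv (i y') hy'
    refine ⟨h1, ?_⟩
    rw [slice_map h h1, h2]
    exact hP ⟨_, c.map_mem_of_slice h h1⟩

end Slice

/-- Only the existence of slice charts has to be supplied; every slice chart then inherits an
embedding from the ambient manifold. -/
theorem IsEmbeddedAtlas.submanifold {j : X → E} (hA : IsEmbeddedAtlas A j) {i : Y → X}
    (hi : Injective i) (h : ∀ y, ∃ e ∈ submanifoldAtlas A i, y ∈ e.dom) :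
    IsEmbeddedAtlas (submanifoldAtlas A i) (fun y => j (i y)) where
  cover := h
  chart := by
    rintro _ ⟨c, hc, F, hF, e, rfl⟩
    exact BanachChart.isChart_slice hi hc.1 e
  embeds := by
    rintro _ ⟨c, hc, F, hF, e, rfl⟩ y hy
    refine BanachChart.Embeds.slice ?_ e
    obtain ⟨d, hd, hx⟩ := hA.cover (i y)
    have := smoothAt_of_mem_maximalAtlas hA.isSmoothAtlas hc hd hy hx
    exact (hA.embeds d hd _ hx).of_smoothAt (f := fun x => x) this.1 this.2 fun _ => rfl

theorem ContinuousLinearMap.closedComplemented_ker_of_idempotent {Q : E →L[ℝ] E}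
    (h : ∀ v, Q (Q v) = Q v) : (LinearMap.ker (Q : E →ₗ[ℝ] E)).ClosedComplemented := by
  refine ⟨(ContinuousLinearMap.id ℝ E - Q).codRestrict _ fun v => ?_, fun v => ?_⟩
  · simp [h]
  · have hv : Q v = 0 := v.2
    ext
    simp [hv]

/-- If in a chart the points of `Y` are the zeros of `g`, and the derivative `D` of `g` has a right
inverse `L` on the values of `g`, then `Y` has a slice chart. -/
theorem exists_mem_submanifoldAtlas (hA : IsSmoothAtlas A) {i : Y → X} {c : BanachChart X}
    (hc : c ∈ A) {y : Y} (hy : i y ∈ c.dom) (g : c.E → E) (D : c.E →L[ℝ] E) (L : E →L[ℝ] c.E)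
    (hg : SmoothNear g (c.map (i y))) (hD : HasFDerivAt g D (c.map (i y)))
    (hDL : ∀ᶠ v in 𝓝 (c.map (i y)), D (L (g v)) = g v)
    (h : ∀ᶠ x in c.nhd (i y), x ∈ range i ↔ g (c.map x) = 0) :
    ∃ e ∈ submanifoldAtlas A i, y ∈ e.dom := by
  -- N has the same zeros as g near the point, since g = D N there, but it takes values in the model
  -- space of the chart; Q is its derivative at the point.
  let N : c.E → c.E := fun v => L (g v)
  let Q : c.E →L[ℝ] c.E := L.comp D
  have hN : SmoothNear N (c.map (i y)) := hg.clm_comp L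
  have hQ : HasFDerivAt N Q (c.map (i y)) := L.hasFDerivAt.comp _ hD
  have hQN : ∀ᶠ v in 𝓝 (c.map (i y)), Q (N v) = N v := by
    filter_upwards [hDL] with v hv
    exact congrArg L hv
  replace h : ∀ᶠ x in c.nhd (i y), x ∈ range i ↔ N (c.map x) = 0 := by
    filter_upwards [h, (c.tendsto_map _).eventually hDL] with x hx hx'
    rw [hx]
    exact ⟨fun h => by simp only [N, h, map_zero],
      fun h => by rw [← hx']; simp only [N] at h; simp [h]⟩
  -- D L is the identity only on the values of g, so idempotence of Q is not formal. It comes from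
  -- differentiating the identity Q N = N.
  have hQQ : ∀ v, Q (Q v) = Q v := by
    have h1 : HasFDerivAt (fun v => Q (N v)) (Q.comp Q) (c.map (i y)) := Q.hasFDerivAt.comp _ hQ
    have h2 := h1.unique (hQ.congr_of_eventuallyEq hQN)
    exact fun v => congrArg (fun L : c.E →L[ℝ] c.E => L v) h2
  -- This is the straightening map: its derivative at the point is 1 - Q + Q = 1, and Q composed
  -- with it is Q - Q² + Q N = N, so it carries the zeros of N into ker Q.
  have h1 : SmoothNear (fun v => v - Q v + N v) (c.map (i y)) :=
    (smoothNear_id.sub (Q.smoothNear _)).add hN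
  have h2 : HasFDerivAt (fun v => v - Q v + N v)
      ((ContinuousLinearEquiv.refl ℝ c.E : c.E ≃L[ℝ] c.E) : c.E →L[ℝ] c.E) (c.map (i y)) := by
    refine (((hasFDerivAt_id _).sub Q.hasFDerivAt).add hQ).congr_fderiv ?_
    ext v
    simp
  obtain ⟨Ψ, hs, hΨ, hΨ1, hΨ2⟩ := h1.exists_openPartialHomeomorph _ h2
  have hmem : ∀ᶠ v in 𝓝 (c.map (i y)), v ∈ Ψ.source := Ψ.open_source.mem_nhds hs
  obtain ⟨W, hW, hWo, hyW⟩ := eventually_nhds_iff.1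
    (hmem.and (hQN.and (BanachChart.eventually_nhd.1 h)))
  have hWs : W ⊆ Ψ.source := fun v hv => (hW v hv).1
  let c' : BanachChart X :=
    { E := c.E
      dom := c.dom ∩ c.map ⁻¹' W
      map := fun x => Ψ (c.map x) }
  have hc1 : c'.IsChart := by
    refine ⟨fun x hx x' hx' e => (hA.chart c hc).1 hx.1 hx'.1
      (Ψ.injOn (hWs hx.2) (hWs hx'.2) e), ?_⟩
    have : c'.map '' c'.dom = Ψ '' (c.map '' c.dom ∩ W) := by
      rw [← image_inter_preimage, image_image]
    rw [this]
    exact Ψ.isOpen_image_of_subset_source ((hA.chart c hc).2.inter hWo)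
      (inter_subset_right.trans hWs)
  have hc2 : c' ∈ maximalAtlas A := by
    refine mem_maximalAtlas hA hc1 fun x hx => ⟨c, hc, ⟨hx, Ψ.symm, hΨ2 _
      (Ψ.map_source (hWs hx.2)), ?_⟩, hx.1, Ψ, by rw [hΨ]; exact hΨ1 _ (hWs hx.2), ?_⟩
    · filter_upwards [c'.eventually_mem_dom x] with x' hx'
      exact ⟨hx'.1, Ψ.left_inv (hWs hx'.2)⟩
    · filter_upwards [c.eventually_mem_dom x,
        (c.tendsto_map x).eventually (hWo.mem_nhds hx.2)] with x' hx' hx''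
      exact ⟨⟨hx', hx''⟩, rfl⟩
  have key : ∀ x ∈ c'.dom, x ∈ range i ↔ c'.map x ∈ LinearMap.ker (Q : c.E →ₗ[ℝ] c.E) := by
    intro x hx
    obtain ⟨-, e, h3⟩ := hW _ hx.2
    rw [h3 x hx.1 rfl]
    have : Q (Ψ (c.map x)) = N (c.map x) := by
      rw [hΨ]
      simp only [map_add, map_sub, hQQ, sub_self, zero_add, e]
    change _ ↔ Q (Ψ (c.map x)) = 0
    rw [this]
  refine ⟨_, ⟨c', hc2, LinearMap.ker (Q : c.E →ₗ[ℝ] c.E),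
    ContinuousLinearMap.closedComplemented_ker_of_idempotent hQQ, ?_, rfl⟩, hy, hyW⟩
  ext v
  constructor
  · rintro ⟨x, ⟨hx, hx'⟩, rfl⟩
    exact ⟨mem_image_of_mem _ hx, (key x hx).1 hx'⟩
  · rintro ⟨⟨x, hx, rfl⟩, hv⟩
    exact mem_image_of_mem _ ⟨hx, (key x hx).2 hv⟩

end Embedded

section Constructions

variable {X Y : Type u} {A : Set (BanachChart X)} {B : Set (BanachChart Y)}
variable {E F : Type*} [NormedAddCommGroup E] [NormedSpace ℝ E] [NormedAddCommGroup F]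
  [NormedSpace ℝ F]

/-! ### Quotient manifolds -/

/-- If a submersion onto `Y` factors through a bijection `f` of `Y` with a quotient `Q`, then `Q` is
a quotient manifold, and it is embedded by `f` followed by the embedding of `Y`. -/
theorem IsEmbeddedAtlas.quotient {k : Y → F} (hA : IsSmoothAtlas A) (hB : IsEmbeddedAtlas B k)
    {Q : Type u} {π : X → Q} (hπ : Surjective π) {f : Q → Y} (hf : Bijective f)
    (h : ∀ x, SplitMapAt A B (fun x => f (π x)) x) :
    IsEmbeddedAtlas (quotientAtlas A π) (fun q => k (f q)) where
  cover q := by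
    obtain ⟨d, hd, hq⟩ := hB.cover (f q)
    -- The chart of `Q` is a chart of `Y` pulled back by the bijection f.
    refine ⟨{ E := d.E, dom := f ⁻¹' d.dom, map := fun q => d.map (f q) },
      ⟨⟨fun q hq q' hq' e => hf.1 ((hB.chart d hd).1 hq hq' e), ?_⟩, fun x hx => ?_⟩, hq⟩
    · change IsOpen ((fun q => d.map (f q)) '' (f ⁻¹' d.dom))
      rw [← image_image d.map f, image_preimage_eq _ hf.2]
      exact (hB.chart d hd).2
    · obtain ⟨c, hc, hxc⟩ := hA.cover x
      have := ((h x).splitAt hA hB.isSmoothAtlas hc hxc hd hx).submersiveAt (hB.chart d hd)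
      exact ⟨c, hc, this⟩
  chart _ hd := hd.1
  embeds := by
    rintro d ⟨hd, hd'⟩ q hq
    obtain ⟨x, rfl⟩ := hπ q
    obtain ⟨c, hc, hs⟩ := hd' x hq
    -- For an arbitrary chart of the quotient atlas, π has a local section σ and f ∘ π has a local
    -- section τ. Hence f = (f ∘ π) ∘ σ and f⁻¹ = π ∘ τ are both smooth locally.
    obtain ⟨s1, σ, s2, s3, s4⟩ := hs.splitAt (hA.chart c hc) hd
    obtain ⟨e, he, hfq⟩ := hB.cover (f (π x))
    obtain ⟨t1, τ, t2, t3, t4⟩ := (h x).splitAt hA hB.isSmoothAtlas hc s1.1 he hfq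
    obtain ⟨g, hl, hr⟩ := bijective_iff_has_inverse.1 hf
    refine (hB.embeds e he _ hfq).of_smoothAt (g := g) ?_ ?_ hl
    · refine (BanachChart.SmoothAt.comp (by rwa [s2]) s3).congr ?_
      filter_upwards [s4] with q hq
      rw [hq]
    · refine (BanachChart.SmoothAt.comp (g := π) (by rwa [t2]) t3).congr ?_
      filter_upwards [t4] with y hy
      exact hf.1 ((hr y).trans hy.symm)

/-- The bijection of the preceding theorem is a diffeomorphism. -/
theorem IsEmbeddedAtlas.isDiffeo {k : Y → F} (hB : IsEmbeddedAtlas B k) {f : X → Y}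
    (hf : Bijective f) (hA : IsEmbeddedAtlas A (fun x => k (f x))) : IsDiffeo A B f := by
  obtain ⟨g, hl, hr⟩ := bijective_iff_has_inverse.1 hf
  exact ⟨hA.isSmoothMap hB (fun v => v) (fun _ => smoothNear_id) fun _ => rfl, g, hl, hr,
    hB.isSmoothMap hA (fun v => v) (fun _ => smoothNear_id) fun y => by rw [hr y]⟩

/-! ### Banach-Lie groupoids embedded in Banach spaces -/

variable {Γ : SetGroupoid X Y}

/-- In coordinates the composable pairs are the zeros of src(x) - tgt(y). If R is a right inverse
for the differential of the source, then v ↦ (R v, 0) is one for the differential of this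
difference, so the target need only be smooth. -/
theorem SetGroupoid.composable_embedded {j : X → E} {k : Y → F} (hA : IsEmbeddedAtlas A j)
    (hB : IsEmbeddedAtlas B k) (hs : ∀ x, SplitMapAt A B Γ.src x)
    (ht : ∀ x, SmoothMapAt A B Γ.tgt x) :
    IsEmbeddedAtlas (Γ.composableAtlas A) (fun z => (j z.1.1, j z.1.2)) := by
  refine (hA.prod hA).submanifold Subtype.val_injective ?_
  rintro ⟨⟨x, y⟩, e⟩
  replace e : Γ.src x = Γ.tgt y := e
  have hA' := hA.isSmoothAtlas
  have hB' := hB.isSmoothAtlas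
  obtain ⟨c, hc, hx⟩ := hA.cover x
  obtain ⟨c', hc', hy⟩ := hA.cover y
  obtain ⟨d, hd, hb⟩ := hB.cover (Γ.src x)
  obtain ⟨V, T, hT, R, hR⟩ := ((hs x).splitAt hA' hB' hc hx hd hb).submersiveAt (hB.chart d hd)
  obtain ⟨-, S, hS, hS'⟩ := (ht y).smoothAt hA' hB' hc' hy hd (e ▸ hb)
  have hT1 := hT.smoothNear
  have hT2 := hT.eventually
  have hR' : ∀ v, fderiv ℝ T (c.map x) (R v) = v := fun v =>
    congrArg (fun L : d.E →L[ℝ] d.E => L v) hR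
  let K : d.E →L[ℝ] c.E × c'.E := (ContinuousLinearMap.inl ℝ c.E c'.E).comp R
  let D : c.E × c'.E →L[ℝ] d.E := (fderiv ℝ T (c.map x)).comp (ContinuousLinearMap.fst ℝ _ _) -
    (fderiv ℝ S (c'.map y)).comp (ContinuousLinearMap.snd ℝ _ _)
  have hDK : ∀ v, D (K v) = v := fun v => by simp [D, K, hR']
  have h1 : HasFDerivAt (fun v : c.E × c'.E => T v.1) _ (c.map x, c'.map y) :=
    hT1.hasFDerivAt.comp (c.map x, c'.map y) hasFDerivAt_fst
  have h2 : HasFDerivAt (fun v : c.E × c'.E => S v.2) _ (c.map x, c'.map y) :=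
    hS.hasFDerivAt.comp (c.map x, c'.map y) hasFDerivAt_snd
  refine exists_mem_submanifoldAtlas (hA.prod hA).isSmoothAtlas (c := c.prod c')
    (i := (Subtype.val : Γ.Composable → X × X)) ⟨c, hc, c', hc', rfl⟩
    (y := (⟨(x, y), e⟩ : Γ.Composable)) ⟨hx, hy⟩ (fun v => T v.1 - S v.2) D K ?_ ?_ ?_ ?_
  · refine SmoothNear.sub ?_ ?_
    · exact SmoothNear.comp (v := (c.map x, c'.map y)) hT1 smoothNear_id.fst
    · exact SmoothNear.comp (v := (c.map x, c'.map y)) hS smoothNear_id.snd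
  · exact h1.sub h2
  · exact Eventually.of_forall fun v => hDK _
  · have l1 : Tendsto Prod.fst (𝓝 (c.map x, c'.map y)) (𝓝 (c.map x)) :=
      continuous_fst.continuousAt
    have l2 : Tendsto Prod.snd (𝓝 (c.map x, c'.map y)) (𝓝 (c'.map y)) :=
      continuous_snd.continuousAt
    refine BanachChart.eventually_nhd.2 ?_
    change ∀ᶠ v in 𝓝 (c.map x, c'.map y), _
    filter_upwards [l1.eventually (BanachChart.eventually_nhd.1 hT2),
      l2.eventually (BanachChart.eventually_nhd.1 hS')]
    rintro _ h3 h4 ⟨x', y'⟩ ⟨hx', hy'⟩ rfl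
    obtain ⟨h5, h6⟩ := h3 x' hx' rfl
    obtain ⟨h7, h8⟩ := h4 y' hy' rfl
    change _ ↔ T (c.map x') - S (c'.map y') = 0
    rw [sub_eq_zero, h6, h8]
    constructor
    · rintro ⟨z, hz⟩
      have := z.2
      rw [show z.1 = (x', y') from hz] at this
      exact congrArg d.map this
    · intro h
      exact ⟨⟨(x', y'), (hB.chart d hd).1 h5 h7 h⟩, rfl⟩

/-- Product, inversion and units are restrictions of smooth ambient maps, so the submersion property
of source and target is the only geometric input. -/
theorem SetGroupoid.isBanachLie_of_embedded {j : X → E} {k : Y → F} (hA : IsEmbeddedAtlas A j)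
    (hB : IsEmbeddedAtlas B k) (hs : ∀ x, SplitMapAt A B Γ.src x)
    (ht : ∀ x, SplitMapAt A B Γ.tgt x) (μ : E × E → E) (hμ : ∀ v, SmoothNear μ v)
    (hμ' : ∀ x y e, j (Γ.mul x y e) = μ (j x, j y)) (ι : E → E) (hι : ∀ v, SmoothNear ι v)
    (hι' : ∀ x, j (Γ.inv x) = ι (j x)) (ε : F → E) (hε : ∀ v, SmoothNear ε v)
    (hε' : ∀ b, j (Γ.unit b) = ε (k b)) : Γ.IsBanachLie A B where
  arrows := hA.isSmoothAtlas
  objects := hB.isSmoothAtlas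
  src_surjective b := ⟨_, Γ.src_unit b⟩
  tgt_surjective b := ⟨_, Γ.tgt_unit b⟩
  src_submersion := (isSubmersion_iff hA.isSmoothAtlas hB.isSmoothAtlas).2 hs
  tgt_submersion := (isSubmersion_iff hA.isSmoothAtlas hB.isSmoothAtlas).2 ht
  composable := (composable_embedded hA hB hs fun x => (ht x).1).isSmoothAtlas
  smooth_mul := (composable_embedded hA hB hs fun x => (ht x).1).isSmoothMap hA μ
    (fun _ => hμ _) fun z => hμ' _ _ z.2
  smooth_inv := hA.isSmoothMap hA ι (fun _ => hι _) hι'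
  smooth_unit := hB.isSmoothMap hA ε (fun _ => hε _) hε'

end Constructions

section Projections

variable {M : Type u} [CStarAlgebra M]

theorem SmoothNear.star {E : Type*} [NormedAddCommGroup E] [NormedSpace ℝ E] {f : E → M} {v : E}
    (hf : SmoothNear f v) : SmoothNear (fun w => star (f w)) v :=
  hf.clm_comp ((starL' ℝ : M ≃L[ℝ] M) : M →L[ℝ] M)

/-! ### Local polar decompositions -/

/-- A smooth square root near the unit, which respects the involution and the commutant of a given
idempotent. -/
theorem exists_smooth_star_sqrt {e : M} (he : IsIdempotentElem e) :
    ∃ S : M → M, SmoothNear S 1 ∧ S 1 = 1 ∧ ∀ᶠ a in 𝓝 (1 : M), S a * S a = a ∧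
      (star a = a → star (S a) = S a) ∧ (e * a = a * e → e * S a = S a * e) := by
  obtain ⟨S, hS, hS1, h1, h2⟩ := exists_smooth_sqrt M
  refine ⟨S, hS, hS1, ?_⟩
  -- Conjugation by the symmetry 1 - 2e fixes exactly the commutant of e. Both star (S a) and the
  -- conjugate of S a are square roots of a near 1 when a is fixed by the corresponding operation,
  -- so local uniqueness of the root makes them equal to S a.
  have hw : (1 - 2 * e) * (1 - 2 * e) = 1 := by
    have : (1 - 2 * e) * (1 - 2 * e) = 1 - 4 * e + 4 * (e * e) := by noncomm_ring
    rw [this, he.eq]; abel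
  have ht1 : Tendsto (fun a => star (S a)) (𝓝 1) (𝓝 1) := by
    have := hS.star.continuousAt.tendsto
    rwa [hS1, star_one] at this
  have ht2 : Tendsto (fun a => (1 - 2 * e) * S a * (1 - 2 * e)) (𝓝 1) (𝓝 1) := by
    have := ((smoothNear_const.mul hS).mul smoothNear_const :
      SmoothNear (fun a => (1 - 2 * e) * S a * (1 - 2 * e)) 1).continuousAt.tendsto
    rwa [hS1, mul_one, hw] at this
  filter_upwards [h1, ht1.eventually h2, ht2.eventually h2] with a ha ha1 ha2
  refine ⟨ha, fun h => ?_, fun h => ?_⟩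
  · rw [← star_mul, ha, h] at ha1
    exact ha1.symm
  · have e1 : (1 - 2 * e) * S a * (1 - 2 * e) * ((1 - 2 * e) * S a * (1 - 2 * e)) = a := by
      calc _ = (1 - 2 * e) * S a * ((1 - 2 * e) * (1 - 2 * e)) * S a * (1 - 2 * e) := by
            noncomm_ring
        _ = (1 - 2 * e) * (S a * S a) * (1 - 2 * e) := by rw [hw]; noncomm_ring
        _ = a * ((1 - 2 * e) * (1 - 2 * e)) := by
            rw [ha, ← mul_assoc]
            congr 1
            rw [sub_mul, mul_sub, mul_assoc, h]
            noncomm_ring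
        _ = a := by rw [hw, mul_one]
    rw [e1] at ha2
    have e2 : S a * (1 - 2 * e) = (1 - 2 * e) * S a := by
      nth_rw 1 [ha2]
      rw [mul_assoc, hw, mul_one]
    have e3 : (2 : ℝ) • (e * S a) = (2 : ℝ) • (S a * e) := by
      rw [two_smul, two_smul]
      have : S a - (S a * e + S a * e) = S a - (e * S a + e * S a) := by
        calc _ = S a * (1 - 2 * e) := by noncomm_ring
          _ = _ := by rw [e2]; noncomm_ring
      exact (sub_right_injective this).symm
    exact smul_right_injective M (two_ne_zero (α := ℝ)) e3

/-- Near `η η*`, a projection `q` is the final projection of a partial isometry with the same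
initial projection as `η`, which depends smoothly on `q`. -/
theorem exists_isometry_section {η e : M} (he : IsStarProjection e) (hη : star η * η = e) :
    ∃ s : M → M, SmoothNear s (η * star η) ∧ s (η * star η) = η ∧
      ∀ᶠ q in 𝓝 (η * star η), IsStarProjection q →
        star (s q) * s q = e ∧ s q * star (s q) = q := by
  have hηe : η * e = η := by
    rw [← hη, ← mul_assoc]; exact (IsMoorePenrose.of_isometry (hη ▸ he)).h1
  have heη : e * star η = star η := by
    have := congrArg star hηe
    rwa [star_mul, he.isSelfAdjoint.star_eq] at this
  have hee := he.isIdempotentElem.eq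
  have hse := he.isSelfAdjoint.star_eq
  obtain ⟨S, hS, hS1, hS2⟩ := exists_smooth_star_sqrt he.isIdempotentElem
  have ha : star η * (η * star η) * η + (1 - e) = 1 := by
    calc _ = (star η * η) * (star η * η) + (1 - e) := by noncomm_ring
      _ = 1 := by rw [hη, hee]; abel
  -- Two elements equal 1 at q = ηη* and so remain invertible nearby. The first gives the inverse
  -- square root of η*qη, the summand 1 - e making it invertible in all of `M`; the second will
  -- force the final projection to be all of q.
  have hb : (η * star η) * (η * star η) * (η * star η) + (1 - η * star η) = 1 := by
    calc _ = η * (star η * η) * ((star η * η) * star η) + (1 - η * star η) := by noncomm_ring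
      _ = 1 := by rw [hη, hηe, heη]; abel
  have ha1 : SmoothNear (fun q => star η * q * η + (1 - e)) (η * star η) :=
    ((smoothNear_const.mul smoothNear_id).mul smoothNear_const).add smoothNear_const
  have hb1 : SmoothNear (fun q => q * (η * star η) * q + (1 - q)) (η * star η) :=
    ((smoothNear_id.mul smoothNear_const).mul smoothNear_id).add
      (smoothNear_const.sub smoothNear_id)
  have hSa : SmoothNear (fun q => S (star η * q * η + (1 - e))) (η * star η) :=
    SmoothNear.comp (by rwa [ha]) ha1
  have hone : ∀ᶠ a in 𝓝 (1 : M), IsUnit a := Units.isOpen.mem_nhds isUnit_one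
  have ta := ha1.continuousAt.tendsto
  have tb := hb1.continuousAt.tendsto
  have tS := hSa.continuousAt.tendsto
  rw [ha] at ta tS
  rw [hb] at tb
  rw [hS1] at tS
  -- This is the polar part qη(η*qη)^(-1/2), with the inverse root computed in `M` and cut back to
  -- the corner by the last factor e.
  refine ⟨fun q => q * η * Ring.inverse (S (star η * q * η + (1 - e))) * e,
    ((smoothNear_id.mul smoothNear_const).mul (hSa.ringInverse ?_)).mul smoothNear_const, ?_, ?_⟩
  · rw [ha, hS1]; exact isUnit_one
  · change η * star η * η * Ring.inverse (S (star η * (η * star η) * η + (1 - e))) * e = η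
    rw [ha, hS1, Ring.inverse_one, mul_one, mul_assoc η, hη, hηe, hηe]
  · filter_upwards [ta.eventually hS2, tb.eventually hone, tS.eventually hone]
    intro q h1 hub huS hq
    have hqq := hq.isIdempotentElem.eq
    have hsq := hq.isSelfAdjoint.star_eq
    set a := star η * q * η + (1 - e) with hadef
    have hae : a * e = star η * q * η := by
      rw [hadef, add_mul, sub_mul, one_mul, hee, sub_self, add_zero, mul_assoc, hηe]
    have hea : e * a = star η * q * η := by
      rw [hadef, mul_add, mul_sub, mul_one, hee, sub_self, add_zero, ← mul_assoc, ← mul_assoc, heη]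
    have hsa : star a = a := by
      simp [hadef, hsq, hse, mul_assoc]
    obtain ⟨hSS, hSs, hSe⟩ := h1
    replace hSs := hSs hsa
    replace hSe := hSe (hea.trans hae.symm)
    set T := S a
    set I := Ring.inverse T with hI
    have hIT : I * T = 1 := Ring.inverse_mul_cancel _ huS
    have hTI : T * I = 1 := Ring.mul_inverse_cancel _ huS
    have hIs : star I = I := by rw [hI, ← Ring.inverse_star, hSs]
    have hIe : e * I = I * e := by
      calc e * I = (I * T) * e * I := by rw [hIT, one_mul]
        _ = I * (T * e) * I := by noncomm_ring
        _ = I * e * (T * I) := by rw [← hSe]; noncomm_ring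
        _ = I * e := by rw [hTI, mul_one]
    set s := q * η * I * e with hs
    have hstar : star s = e * I * star η * q := by
      simp only [hs, star_mul, hse, hIs, hsq, mul_assoc]
    have hss : star s * s = e := by
      calc star s * s = e * I * (star η * (q * q) * η) * I * e := by
            rw [hstar, hs]; noncomm_ring
        _ = e * I * (a * e) * I * e := by rw [hqq, hae]
        _ = e * (I * T) * T * (e * I) * e := by rw [← hSS]; noncomm_ring
        _ = e * (T * I) * (e * e) := by rw [hIT, hIe]; noncomm_ring
        _ = e := by rw [hTI, hee, mul_one, hee]
    refine ⟨hss, ?_⟩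
    have hse' : s * e = s := by rw [hs, mul_assoc, hee]
    have h2 : s * T = q * η := by
      calc s * T = q * η * I * (e * T) := by rw [hs]; noncomm_ring
        _ = q * η * (I * T) * e := by rw [hSe]; noncomm_ring
        _ = q * η := by rw [hIT, mul_one, mul_assoc, hηe]
    have h3 : s * star s * (q * η) = q * η := by
      calc s * star s * (q * η) = s * (star s * s) * T := by rw [← h2]; noncomm_ring
        _ = q * η := by rw [hss, hse', h2]
    -- The final projection ss* fixes qη and lies below q, so q - ss* annihilates the second
    -- invertible element and must vanish.
    have h4 : (q - s * star s) * (q * (η * star η) * q + (1 - q)) = 0 := by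
      have h5 : s * star s * q = s * star s := by rw [hstar]; simp only [mul_assoc, hqq]
      calc _ = (q * q * η - s * star s * (q * η)) * star η * q + (q - q * q) -
            (s * star s - s * star s * q) := by noncomm_ring
        _ = 0 := by rw [h3, h5, hqq]; noncomm_ring
    exact (sub_eq_zero.1 ((hub.mul_left_eq_zero).1 h4)).symm

/-! ### Transversal projections -/

/-- `s` is the idempotent with the same range as `q` and the same kernel as `p`. -/
structure IsSectionAt (p q s : M) : Prop where
  left_mul : q * s = s
  mul_left : s * q = q
  mul_right : p * s = p
  right_mul : s * p = s

namespace IsSectionAt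

variable {p q s t : M}

theorem unique (h : IsSectionAt p q s) (h' : IsSectionAt p q t) : s = t := by
  calc s = t * q * s := by rw [h'.mul_left, h.left_mul]
    _ = t * p * s := by rw [mul_assoc, h.left_mul, h'.right_mul]
    _ = t := by rw [mul_assoc, h.mul_right, h'.right_mul]

/-- Both projections have the range of s, and an orthogonal projection is determined by its range.
-/
theorem eq_of_eq {q' : M} (hq : IsStarProjection q) (hq' : IsStarProjection q')
    (h : IsSectionAt p q s) (h' : IsSectionAt p q' s) : q = q' := by
  have e1 : q' * q = q := by rw [← h.mul_left, ← mul_assoc, h'.left_mul]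
  have e2 : q * q' = q' := by rw [← h'.mul_left, ← mul_assoc, h.left_mul]
  have e3 := congrArg star e1
  rw [star_mul, hq.isSelfAdjoint.star_eq, hq'.isSelfAdjoint.star_eq, e2] at e3
  exact e3.symm

/-- Since s(pq) = q and (pq)s = p, the section is an arrow from p to q whose groupoid inverse is pq.
-/
theorem isMoorePenrose (hp : IsStarProjection p) (hq : IsStarProjection q)
    (h : IsSectionAt p q s) : IsMoorePenrose s (p * q) := by
  have e1 : s * (p * q) = q := by rw [← mul_assoc, h.right_mul, h.mul_left]
  have e2 : p * q * s = p := by rw [mul_assoc, h.left_mul, h.mul_right]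
  refine ⟨?_, ?_, ?_, ?_⟩
  · rw [e1, h.left_mul]
  · rw [e2, ← mul_assoc, hp.isIdempotentElem.eq]
  · rw [e1, hq.isSelfAdjoint.star_eq]
  · rw [e2, hp.isSelfAdjoint.star_eq]

theorem symm (hp : IsStarProjection p) (hq : IsStarProjection q) (h : IsSectionAt p q s) :
    IsSectionAt q p (star s) := by
  have hps := hp.isSelfAdjoint.star_eq
  have hqs := hq.isSelfAdjoint.star_eq
  refine ⟨?_, ?_, ?_, ?_⟩
  · simpa [hps] using congrArg star h.right_mul
  · simpa [hps] using congrArg star h.mul_right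
  · simpa [hqs] using congrArg star h.mul_left
  · simpa [hqs] using congrArg star h.left_mul

theorem isTransversal (hp : IsStarProjection p) (h : IsSectionAt p q s) :
    IsTransversal p q := by
  have hpp := hp.isIdempotentElem.eq
  constructor
  · rw [Submodule.disjoint_def]
    rintro _ ⟨m, rfl⟩ ⟨n, hn⟩
    rw [LinearMap.mulLeft_apply, LinearMap.mulLeft_apply] at hn
    have e : p * (q * m) = 0 := by rw [← hn, ← mul_assoc, hp.mul_one_sub_self, zero_mul]
    rw [LinearMap.mulLeft_apply, ← h.mul_left, mul_assoc, ← h.right_mul, mul_assoc, e, mul_zero]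
  · rw [codisjoint_iff, eq_top_iff]
    intro m _
    refine Submodule.mem_sup.2 ⟨s * m, ⟨s * m, ?_⟩, m - s * m, ⟨m - s * m, ?_⟩, by abel⟩
    · rw [LinearMap.mulLeft_apply, ← mul_assoc, h.left_mul]
    · rw [LinearMap.mulLeft_apply, sub_mul, one_mul, mul_sub p, ← mul_assoc, h.mul_right, sub_self,
        sub_zero]

end IsSectionAt

theorem IsTransversal.isSectionAt {p q : M} (hp : IsStarProjection p) (hq : IsStarProjection q)
    (h : IsTransversal p q) : IsSectionAt p q (sectionAt p q) := by
  have hs : sectionAt p q = (rightIdeal q).projection (rightIdeal (1 - p)) h p := by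
    rw [sectionAt, dif_pos h]
  obtain ⟨m, hm⟩ : sectionAt p q ∈ rightIdeal q := by
    rw [hs]; exact ((rightIdeal q).projectionOnto _ h p).2
  obtain ⟨n, hn⟩ : p - sectionAt p q ∈ rightIdeal (1 - p) := by
    rw [hs]; exact Submodule.sub_projection_mem h p
  rw [LinearMap.mulLeft_apply] at hm hn
  have hpp := hp.isIdempotentElem.eq
  have hqq := hq.isIdempotentElem.eq
  have h1 : q * sectionAt p q = sectionAt p q := by rw [← hm, ← mul_assoc, hqq]
  have h3 : p * sectionAt p q = p := by
    have : p * (p - sectionAt p q) = 0 := by rw [← hn, ← mul_assoc, hp.mul_one_sub_self, zero_mul]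
    rw [mul_sub, hpp, sub_eq_zero] at this
    exact this.symm
  -- This is qM ∩ (1 - p)M = 0. Each remaining identity holds because the difference of its two
  -- sides lies in this intersection.
  have key : ∀ x, q * x = x → p * x = 0 → x = 0 := fun x hx hx' =>
    Submodule.disjoint_def.1 h.disjoint x ⟨x, by rw [LinearMap.mulLeft_apply, hx]⟩
      ⟨x, by rw [LinearMap.mulLeft_apply, sub_mul, hx', one_mul, sub_zero]⟩
  refine ⟨h1, ?_, h3, ?_⟩
  · refine sub_eq_zero.1 (key _ ?_ ?_)
    · rw [mul_sub, ← mul_assoc, h1, hqq]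
    · rw [mul_sub, ← mul_assoc, h3, sub_self]
  · refine sub_eq_zero.1 (key _ ?_ ?_)
    · rw [mul_sub, ← mul_assoc, h1]
    · rw [mul_sub, ← mul_assoc, h3, hpp, sub_self]

theorem IsSectionAt.sectionAt_eq {p q s : M} (hp : IsStarProjection p) (hq : IsStarProjection q)
    (h : IsSectionAt p q s) : sectionAt p q = s :=
  ((h.isTransversal hp).isSectionAt hp hq).unique h

theorem IsSectionAt.refl {p : M} (hp : IsStarProjection p) : IsSectionAt p p p :=
  ⟨hp.isIdempotentElem.eq, hp.isIdempotentElem.eq, hp.isIdempotentElem.eq, hp.isIdempotentElem.eq⟩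

theorem isTransversal_refl {p : M} (hp : IsStarProjection p) : IsTransversal p p :=
  (IsSectionAt.refl hp).isTransversal hp

/-- The section as a smooth function of the projection. -/
def sectionFun (p q : M) : M := q * p * Ring.inverse (p * q * p + (1 - p))

/-- The inverse is s*s + (1 - p): on the corner at p the element s*s inverts pqp, because qps* = q
and ps = p. -/
theorem IsSectionAt.isUnit {p q s : M} (hp : IsStarProjection p) (hq : IsStarProjection q)
    (h : IsSectionAt p q s) : IsUnit (p * q * p + (1 - p)) := by
  have hpp := hp.isIdempotentElem.eq
  have hps := hp.isSelfAdjoint.star_eq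
  have h1 : q * p * star s = q := by
    have := congrArg star h.mul_left
    rw [star_mul, hq.isSelfAdjoint.star_eq] at this
    have h2 := congrArg star h.right_mul
    rw [star_mul, hps] at h2
    rw [mul_assoc, h2, this]
  have h2 : star s * p = p := by
    have := congrArg star h.mul_right
    rwa [star_mul, hps] at this
  have h3 : p * star s = star s := by
    have := congrArg star h.right_mul
    rwa [star_mul, hps] at this
  have h4 : star s * s * p = star s * s := by rw [mul_assoc, h.right_mul]
  have h5 : (p * q * p + (1 - p)) * (star s * s + (1 - p)) = 1 := by
    calc _ = p * (q * p * star s) * s + p * q * (p - p * p) +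
          (star s - p * star s) * s + (1 - p - p + p * p) := by noncomm_ring
      _ = p * (q * s) + (1 - p) := by rw [h1, h3, hpp]; noncomm_ring
      _ = 1 := by rw [h.left_mul, h.mul_right]; abel
  have h6 : (star s * s + (1 - p)) * (p * q * p + (1 - p)) = 1 := by
    have h7 := congrArg star h5
    have e1 : star (p * q * p + (1 - p)) = p * q * p + (1 - p) := by
      simp [hps, hq.isSelfAdjoint.star_eq, mul_assoc]
    have e2 : star (star s * s + (1 - p)) = star s * s + (1 - p) := by simp [hps]
    rwa [star_mul, e1, e2, star_one] at h7
  exact ⟨⟨_, _, h5, h6⟩, rfl⟩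

/-- Invertibility of pqp in its corner yields ps = p and sp = s; invertibility of qpq in its corner
yields sq = q. Both are open conditions on q, which makes transversality open. -/
theorem isSectionAt_sectionFun {p q : M} (hp : IsStarProjection p) (hq : IsStarProjection q)
    (h : IsUnit (p * q * p + (1 - p))) (h' : IsUnit (q * p * q + (1 - q))) :
    IsSectionAt p q (sectionFun p q) := by
  have hpp := hp.isIdempotentElem.eq
  have hqq := hq.isIdempotentElem.eq
  set a := p * q * p + (1 - p) with ha
  have hpa : p * a = p * q * p := by
    rw [ha, mul_add, mul_sub, mul_one, hpp, sub_self, add_zero, ← mul_assoc, ← mul_assoc, hpp]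
  have hap : a * p = p * q * p := by
    rw [ha, add_mul, sub_mul, one_mul, hpp, sub_self, add_zero, mul_assoc, hpp]
  set I := Ring.inverse a with hI
  have hIa : I * a = 1 := Ring.inverse_mul_cancel _ h
  have haI : a * I = 1 := Ring.mul_inverse_cancel _ h
  have hIp : I * p = p * I := by
    calc I * p = I * (p * a) * I := by rw [mul_assoc, mul_assoc p, haI, mul_one]
      _ = (I * a) * p * I := by rw [hpa, ← hap]; noncomm_ring
      _ = p * I := by rw [hIa, one_mul]
  have e : sectionFun p q = q * p * I := rfl
  have h1 : q * sectionFun p q = sectionFun p q := by rw [e, ← mul_assoc, ← mul_assoc, hqq]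
  have h3 : p * sectionFun p q = p := by
    rw [e, ← mul_assoc, ← mul_assoc, ← hpa, mul_assoc, haI, mul_one]
  have h4 : sectionFun p q * p = sectionFun p q := by
    rw [e, mul_assoc, hIp, ← mul_assoc, mul_assoc q, hpp]
  refine ⟨h1, ?_, h3, h4⟩
  have h5 : sectionFun p q * q * p = q * p := by
    calc _ = sectionFun p q * (p * q * p) := by nth_rw 1 [← h4]; noncomm_ring
      _ = q * p * (I * a) * p := by rw [← hap, e]; noncomm_ring
      _ = q * p := by rw [hIa, mul_one, mul_assoc, hpp]
  have h6 : (sectionFun p q * q - q) * (q * p * q + (1 - q)) = 0 := by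
    calc _ = sectionFun p q * (q * q) * p * q - (q * q) * p * q + sectionFun p q * (q - q * q) -
          (q - q * q) := by noncomm_ring
      _ = sectionFun p q * q * p * q - q * p * q := by rw [hqq]; noncomm_ring
      _ = 0 := by rw [h5, sub_self]
  exact sub_eq_zero.1 (h'.mul_left_eq_zero.1 h6)

/-- The projections transversal to `p` form an open set, on which the section is smooth. -/
theorem eventually_isSectionAt {p q : M} (hp : IsStarProjection p) (hq : IsStarProjection q)
    (h : IsTransversal p q) : SmoothNear (sectionFun p) q ∧
      ∀ᶠ q' in 𝓝 q, IsStarProjection q' → IsSectionAt p q' (sectionFun p q') := by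
  have h1 := h.isSectionAt hp hq
  have hu := h1.isUnit hp hq
  have hu' := (h1.symm hp hq).isUnit hq hp
  have s1 : SmoothNear (fun q => p * q * p + (1 - p)) q :=
    ((smoothNear_const.mul smoothNear_id).mul smoothNear_const).add smoothNear_const
  have s2 : SmoothNear (fun q => q * p * q + (1 - q)) q :=
    ((smoothNear_id.mul smoothNear_const).mul smoothNear_id).add (smoothNear_const.sub smoothNear_id)
  refine ⟨(smoothNear_id.mul smoothNear_const).mul (s1.ringInverse hu), ?_⟩
  filter_upwards [s1.continuousAt.eventually (Units.isOpen.mem_nhds hu),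
    s2.continuousAt.eventually (Units.isOpen.mem_nhds hu')] with q' h2 h3 hq'
  exact isSectionAt_sectionFun hp hq' h2 h3

/-! ### The projection with a given coordinate -/

theorem isUnit_one_add_star_mul [PartialOrder M] [StarOrderedRing M] (φ : M) :
    IsUnit (1 + star φ * φ) :=
  CStarAlgebra.isUnit_of_le 1 (le_add_of_nonneg_right (star_mul_self_nonneg φ))

/-- The projection whose coordinate in the chart at `p` is `φ`. -/
def projOfCoord (p φ : M) : M := (p + φ) * Ring.inverse (1 + star φ * φ) * star (p + φ)

theorem smoothNear_projOfCoord [PartialOrder M] [StarOrderedRing M] (p φ : M) :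
    SmoothNear (projOfCoord p) φ := by
  have h : SmoothNear (fun φ => 1 + star φ * φ) φ :=
    smoothNear_const.add (smoothNear_id.star.mul smoothNear_id)
  exact ((smoothNear_const.add smoothNear_id).mul (h.ringInverse (isUnit_one_add_star_mul φ))).mul
    (smoothNear_const.add smoothNear_id).star

theorem mem_corner_iff {p q a : M} (hp : IsStarProjection p) (hq : IsStarProjection q) :
    a ∈ corner p q ↔ p * a = a ∧ a * q = a := by
  change p * a * q = a ↔ _
  constructor
  · intro h
    constructor
    · rw [← h, ← mul_assoc, ← mul_assoc, hp.isIdempotentElem.eq]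
    · rw [← h, mul_assoc, hq.isIdempotentElem.eq]
  · rintro ⟨h1, h2⟩
    rw [h1, h2]

/-- Because pφ = 0 and φp = φ, the element s = p + φ is idempotent and s*s = p(1 + φ*φ). The formula
s(1 + φ*φ)⁻¹s* is therefore the orthogonal projection onto the range of s. -/
theorem isSectionAt_projOfCoord [PartialOrder M] [StarOrderedRing M] {p φ : M}
    (hp : IsStarProjection p) (hφ : φ ∈ corner (1 - p) p) :
    IsStarProjection (projOfCoord p φ) ∧ IsSectionAt p (projOfCoord p φ) (p + φ) := by
  have hpp := hp.isIdempotentElem.eq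
  have hps := hp.isSelfAdjoint.star_eq
  obtain ⟨h1, h2⟩ := (mem_corner_iff hp.one_sub hp).1 hφ
  have h3 : p * φ = 0 := by
    rw [sub_mul, one_mul] at h1
    exact sub_eq_self.1 h1
  have h3' : star φ * p = 0 := by simpa [hps] using congrArg star h3
  have h2' : p * star φ = star φ := by simpa [hps] using congrArg star h2
  set a := 1 + star φ * φ with ha
  have hu : IsUnit a := isUnit_one_add_star_mul φ
  set I := Ring.inverse a with hI
  have hIa : I * a = 1 := Ring.inverse_mul_cancel _ hu
  have hIs : star I = I := by rw [hI, ← Ring.inverse_star]; simp [ha]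
  have hss : star (p + φ) * (p + φ) = p * a := by
    calc _ = p * p + p * φ + star φ * p + star φ * φ := by rw [star_add, hps]; noncomm_ring
      _ = p * a := by rw [h3, h3', hpp, ha, mul_add, ← mul_assoc p, h2']; simp
  have hsp : (p + φ) * p = p + φ := by rw [add_mul, hpp, h2]
  have hps' : p * (p + φ) = p := by rw [mul_add, hpp, h3, add_zero]
  have hap : p * a = a * p := by
    rw [ha, mul_add, add_mul, ← mul_assoc p, h2', mul_assoc, h2, mul_one, one_mul]
  have hIp : I * p = p * I := by
    have haI : a * I = 1 := Ring.mul_inverse_cancel _ hu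
    calc I * p = I * (p * a) * I := by rw [mul_assoc, mul_assoc p, haI, mul_one]
      _ = (I * a) * p * I := by rw [hap]; noncomm_ring
      _ = p * I := by rw [hIa, one_mul]
  have e : projOfCoord p φ = (p + φ) * I * star (p + φ) := rfl
  have hqs : projOfCoord p φ * (p + φ) = p + φ := by
    calc _ = (p + φ) * (I * p) * a := by rw [e, mul_assoc _ (star _), hss]; noncomm_ring
      _ = (p + φ) * p * (I * a) := by rw [hIp]; noncomm_ring
      _ = p + φ := by rw [hIa, mul_one, hsp]
  refine ⟨⟨?_, ?_⟩, hqs, ?_, hps', hsp⟩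
  · change projOfCoord p φ * projOfCoord p φ = projOfCoord p φ
    nth_rw 2 [e]
    rw [← mul_assoc, ← mul_assoc, hqs, ← e]
  · change star (projOfCoord p φ) = _
    rw [e, star_mul, star_mul, star_star, hIs, mul_assoc]
  · have : (p + φ) * (p + φ) = p + φ := by
      nth_rw 1 [← hsp]
      rw [mul_assoc, hps', hsp]
    rw [e, ← mul_assoc, ← mul_assoc, this]

end Projections

/-! ### The orbit of p₀: polar decomposition and charts -/

section Orbit

variable {M : Type u} [CStarAlgebra M]

theorem eq_of_mul_eq {e f : M} (he : star e = e) (hf : star f = f) (h : e * f = f)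
    (h' : f * e = e) : e = f := by
  have := congrArg star h
  rw [star_mul, he, hf, h'] at this
  exact this

/-- The projection of the algebra onto a corner. -/
def cornerProj {p q : M} (hp : IsStarProjection p) (hq : IsStarProjection q) :
    M →L[ℝ] corner p q :=
  (ContinuousLinearMap.mulLeftRight ℝ M p q).codRestrict (corner p q) fun a => by
    refine (mem_corner_iff hp hq).2 ⟨?_, ?_⟩
    · simp only [ContinuousLinearMap.mulLeftRight_apply, ← mul_assoc, hp.isIdempotentElem.eq]
    · simp only [ContinuousLinearMap.mulLeftRight_apply, mul_assoc, hq.isIdempotentElem.eq]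

theorem cornerProj_coe {p q : M} (hp : IsStarProjection p) (hq : IsStarProjection q) (a : M) :
    (cornerProj hp hq a : M) = p * a * q := rfl

theorem cornerProj_of_mem {p q : M} (hp : IsStarProjection p) (hq : IsStarProjection q) {a : M}
    (h : a ∈ corner p q) : cornerProj hp hq a = ⟨a, h⟩ := Subtype.ext h

variable [PartialOrder M] [StarOrderedRing M] {p₀ : M}

theorem mem_projOrbit_of_moorePenrose {p q s t : M} (hp : p ∈ projOrbit p₀)
    (h : IsMoorePenrose s t) (h1 : t * s = p) (h2 : s * t = q) : q ∈ projOrbit p₀ := by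
  obtain ⟨x, hx, hr, hl⟩ := hp
  obtain ⟨y, hy⟩ := mem_partiallyInvertible_iff.1 hx
  rw [hy.leftSupport_eq] at hl
  rw [hy.rightSupport_eq] at hr
  obtain ⟨hm, e1, e2⟩ := h.mul hy (h1.trans hl.symm)
  exact ⟨_, mem_partiallyInvertible_iff.2 ⟨_, hm⟩, by rw [hm.rightSupport_eq, e2, hr],
    by rw [hm.leftSupport_eq, e1, h2]⟩

/-- Polar decomposition: the orbit consists of the final projections of partial isometries. -/
theorem exists_isometry_of_mem_projOrbit {q : M} (hq : q ∈ projOrbit p₀) :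
    ∃ ξ, star ξ * ξ = p₀ ∧ ξ * star ξ = q := by
  obtain ⟨x, hx, hr, hl⟩ := hq
  obtain ⟨y, h⟩ := mem_partiallyInvertible_iff.1 hx
  rw [h.leftSupport_eq] at hl
  rw [h.rightSupport_eq] at hr
  obtain ⟨p, ⟨⟨hp, hxp⟩, -⟩, b, hb, hxb, hbx⟩ := hx
  have habs : CFC.abs x * CFC.abs x = star x * x := CFC.abs_mul_abs x
  have hsa : star (CFC.abs x) = CFC.abs x := (CFC.abs_nonneg x).isSelfAdjoint.star_eq
  have hpp := hp.isIdempotentElem.eq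
  have hps := hp.isSelfAdjoint.star_eq
  obtain ⟨hpb, hbp⟩ := (mem_corner_iff hp hp).1 hb
  have hbs : star b = b := by
    have h1 : CFC.abs x * star b = p := by simpa [hsa, hps] using congrArg star hbx
    have h2 : p * star b = star b := by simpa [hps] using congrArg star hbp
    calc star b = b * CFC.abs x * star b := by rw [hbx, h2]
      _ = b := by rw [mul_assoc, h1, hbp]
  have hxp' : x * p = x := mul_eq_self_of_star_mul hp (by rw [← habs, mul_assoc, hxp])
  have hax : CFC.abs x * (y * x) = CFC.abs x := by
    apply mul_eq_self_of_star_mul h.right_proj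
    rw [hsa, habs, mul_assoc, ← mul_assoc x, h.h1]
  -- The support of |x| and the right support of x dominate each other.
  have hp0 : p = p₀ := by
    rw [← hr]
    have h1 : p * (y * x) = p := by rw [← hbx, mul_assoc, hax]
    have h2 : y * x * p = y * x := by rw [mul_assoc, hxp']
    have h3 := congrArg star h1
    have h4 := congrArg star h2
    rw [star_mul, h.h4, hps] at h3 h4
    exact eq_of_mul_eq hps h.h4 h4 h3
  have hss : star (x * b) * (x * b) = p := by
    calc _ = b * (star x * x) * b := by rw [star_mul, hbs]; noncomm_ring
      _ = (b * CFC.abs x) * (CFC.abs x * b) := by rw [← habs]; noncomm_ring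
      _ = p := by rw [hbx, hxb, hpp]
  -- As b is the inverse of |x| in its corner, x b is the isometric factor of the polar
  -- decomposition of x.
  refine ⟨x * b, hss.trans hp0, ?_⟩
  rw [← hl]
  have h1 : x * b * CFC.abs x = x := by rw [mul_assoc, hbx, hxp']
  refine eq_of_mul_eq (by simp) h.h3 ?_ ?_
  · calc x * b * star (x * b) * (x * y) = x * b * star (x * b) * ((x * b * CFC.abs x) * y) := by
          rw [h1]
      _ = x * b * (star (x * b) * (x * b)) * CFC.abs x * y := by noncomm_ring
      _ = x * y := by rw [hss, mul_assoc x, hbp, h1]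
  · rw [mul_assoc x b, ← mul_assoc, h.h1]

theorem mem_projOrbit_of_isometry {u p q : M} (hp : p ∈ projOrbit p₀) (h : star u * u = p)
    (h' : u * star u = q) : q ∈ projOrbit p₀ :=
  mem_projOrbit_of_moorePenrose hp
    (.of_isometry (h ▸ isStarProjection_of_mem_projOrbit hp)) h h'

theorem exists_isometry_between {p q : M} (hp : p ∈ projOrbit p₀) (hq : q ∈ projOrbit p₀) :
    ∃ u, star u * u = p ∧ u * star u = q := by
  obtain ⟨ξ, h1, h2⟩ := exists_isometry_of_mem_projOrbit hp
  obtain ⟨η, h3, h4⟩ := exists_isometry_of_mem_projOrbit hq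
  have hpp := (isStarProjection_of_mem_projOrbit hp).isIdempotentElem.eq
  have hqq := (isStarProjection_of_mem_projOrbit hq).isIdempotentElem.eq
  refine ⟨η * star ξ, ?_, ?_⟩
  · calc _ = ξ * (star η * η) * star ξ := by rw [star_mul, star_star]; noncomm_ring
      _ = (ξ * star ξ) * (ξ * star ξ) := by rw [h3, ← h1]; noncomm_ring
      _ = p := by rw [h2, hpp]
  · calc _ = η * (star ξ * ξ) * star η := by rw [star_mul, star_star]; noncomm_ring
      _ = (η * star η) * (η * star η) := by rw [h1, ← h3]; noncomm_ring
      _ = q := by rw [h4, hqq]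

theorem exists_moorePenrose_of_mem {x : M} (hx : x ∈ invertibleArrows p₀) :
    ∃ y, IsMoorePenrose x y ∧ x * y = leftSupport x ∧ y * x = rightSupport x := by
  obtain ⟨y, h⟩ := mem_partiallyInvertible_iff.1 hx.1
  exact ⟨y, h, h.leftSupport_eq.symm, h.rightSupport_eq.symm⟩

/-! ### The atlas of the orbit -/

theorem add_projCoord {p q : M} (hp : IsStarProjection p) (h : IsTransversal p q) :
    p + (projCoord p q : M) = sectionAt p q := by
  rw [projCoord_coe hp h]; abel

theorem projOfCoord_projCoord {p q : M} (hp : IsStarProjection p) (hq : IsStarProjection q)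
    (h : IsTransversal p q) : projOfCoord p (projCoord p q : M) = q := by
  obtain ⟨h1, h2⟩ := isSectionAt_projOfCoord hp (projCoord p q).2
  rw [add_projCoord hp h] at h2
  exact h2.eq_of_eq h1 hq (h.isSectionAt hp hq)

theorem projCoord_projOfCoord {p : M} (hp : IsStarProjection p) (φ : corner (1 - p) p) :
    projCoord p (projOfCoord p φ) = φ := by
  obtain ⟨h1, h2⟩ := isSectionAt_projOfCoord hp φ.2
  apply Subtype.ext
  rw [projCoord_coe hp (h2.isTransversal hp), h2.sectionAt_eq hp h1, add_sub_cancel_left]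

theorem projOfCoord_mem {p φ : M} (hp : p ∈ projOrbit p₀) (hφ : φ ∈ corner (1 - p) p) :
    projOfCoord p φ ∈ projOrbit p₀ := by
  have hp' := isStarProjection_of_mem_projOrbit hp
  obtain ⟨h1, h2⟩ := isSectionAt_projOfCoord hp' hφ
  refine mem_projOrbit_of_moorePenrose hp (h2.isMoorePenrose hp' h1) ?_ ?_
  · rw [mul_assoc, h2.left_mul, h2.mul_right]
  · rw [← mul_assoc, h2.right_mul, h2.mul_left]

theorem projCoord_eq_cornerProj {p q : M} (hp : IsStarProjection p) (hq : IsStarProjection q)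
    (h : IsSectionAt p q (sectionFun p q)) :
    projCoord p q = cornerProj hp.one_sub hp (sectionFun p q - p) := by
  have h1 := projCoord_coe hp (h.isTransversal hp)
  rw [h.sectionAt_eq hp hq] at h1
  rw [cornerProj_of_mem hp.one_sub hp (h1 ▸ (projCoord p q).2)]
  exact Subtype.ext h1

/-- The chart extends to `M` through `sectionFun` and its inverse is `projOfCoord`; both are smooth.
Every element of the corner is a coordinate, so the image of a chart is the whole space. -/
theorem isEmbeddedAtlas_projAtlas (p₀ : M) :
    IsEmbeddedAtlas (projAtlas p₀) (Subtype.val : projOrbit p₀ → M) where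
  cover q := ⟨_, ⟨q.1, q.2, rfl⟩, isTransversal_refl (isStarProjection_of_mem_projOrbit q.2)⟩
  chart := by
    rintro _ ⟨p, hp, rfl⟩
    have hp' := isStarProjection_of_mem_projOrbit hp
    constructor
    · intro q hq q' hq' e
      apply Subtype.ext
      rw [← projOfCoord_projCoord hp' (isStarProjection_of_mem_projOrbit q.2) hq,
        ← projOfCoord_projCoord hp' (isStarProjection_of_mem_projOrbit q'.2) hq']
      exact congrArg (fun φ : corner (1 - p) p => projOfCoord p (φ : M)) e
    · convert! isOpen_univ
      refine eq_univ_of_forall fun φ : corner (1 - p) p => ?_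
      exact ⟨⟨projOfCoord p φ, projOfCoord_mem hp φ.2⟩,
        (isSectionAt_projOfCoord hp' φ.2).2.isTransversal hp', projCoord_projOfCoord hp' φ⟩
  embeds := by
    rintro _ ⟨p, hp, rfl⟩ q hq
    have hp' := isStarProjection_of_mem_projOrbit hp
    have hq' := isStarProjection_of_mem_projOrbit q.2
    obtain ⟨h1, h2⟩ := eventually_isSectionAt hp' hq' hq
    refine ⟨hq, ⟨fun φ => projOfCoord p ((corner (1 - p) p).subtypeL φ),
      SmoothNear.comp (smoothNear_projOfCoord p _) (ContinuousLinearMap.smoothNear _ _), ?_⟩,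
      fun q => cornerProj hp'.one_sub hp' (sectionFun p q - p),
      (h1.sub smoothNear_const).clm_comp _, ?_⟩
    · filter_upwards [(projChart p₀ p).eventually_mem_dom q] with r hr
      exact projOfCoord_projCoord hp' (isStarProjection_of_mem_projOrbit r.2) hr
    · filter_upwards [h2]
      rintro _ h r rfl
      have hr := isStarProjection_of_mem_projOrbit r.2
      exact ⟨(h hr).isTransversal hp', (projCoord_eq_cornerProj hp' hr (h hr)).symm⟩

end Orbit

section Arrows

variable {M : Type u} [CStarAlgebra M] [PartialOrder M] [StarOrderedRing M] {p₀ : M}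

/-! ### The atlas of the groupoid of partially invertible elements -/

/-- The groupoid inverse of σ_{p'}(l(x)) is p'l(x), and l(x)x = x, so the middle coordinate is just
p'xσ_p(r(x)), in which no inverse appears. -/
theorem arrowChart_map {p' p : M} (hp' : IsStarProjection p') (hp : IsStarProjection p)
    (x : invertibleArrows p₀) (h' : IsTransversal p' (leftSupport x.1))
    (h : IsTransversal p (rightSupport x.1)) :
    (arrowChart p₀ p' p).map x = (projCoord p' (leftSupport x.1),
      cornerProj hp' hp (p' * x.1 * sectionAt p (rightSupport x.1)),
      projCoord p (rightSupport x.1)) := by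
  have hl := isStarProjection_of_mem_projOrbit x.2.2.1
  have hr := isStarProjection_of_mem_projOrbit x.2.2.2
  obtain ⟨y, hy, hyl, hyr⟩ := exists_moorePenrose_of_mem x.2
  have hs' := h'.isSectionAt hp' hl
  have hs := h.isSectionAt hp hr
  have e : partialInverse (sectionAt p' (leftSupport x.1)) * x.1 * sectionAt p (rightSupport x.1) =
      p' * x.1 * sectionAt p (rightSupport x.1) := by
    rw [(hs'.isMoorePenrose hp' hl).partialInverse_eq, mul_assoc p', ← hyl, hy.h1]
  have hm : p' * x.1 * sectionAt p (rightSupport x.1) ∈ corner p' p := by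
    refine (mem_corner_iff hp' hp).2 ⟨?_, ?_⟩
    · rw [← mul_assoc, ← mul_assoc, hp'.isIdempotentElem.eq]
    · rw [mul_assoc, hs.right_mul]
  change (_, toSubspace (corner p' p) _, _) = _
  rw [e, toSubspace_of_mem hm, cornerProj_of_mem hp' hp hm]

/-- The arrow with given coordinates in the chart at `p'` and `p`. -/
def arrowOfCoord (p' p : M) (v : M × M × M) : M :=
  (p' + v.1) * v.2.1 * (p * projOfCoord p v.2.2)

theorem arrow_eq {p' p : M} (hp' : IsStarProjection p') (hp : IsStarProjection p)
    {x : M} (hx : x ∈ invertibleArrows p₀) (h' : IsTransversal p' (leftSupport x))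
    (h : IsTransversal p (rightSupport x)) :
    sectionAt p' (leftSupport x) * (p' * x * sectionAt p (rightSupport x)) *
      (p * rightSupport x) = x := by
  have hl := isStarProjection_of_mem_projOrbit hx.2.1
  have hr := isStarProjection_of_mem_projOrbit hx.2.2
  obtain ⟨y, hy, hyl, hyr⟩ := exists_moorePenrose_of_mem hx
  have hs' := h'.isSectionAt hp' hl
  have hs := h.isSectionAt hp hr
  calc _ = sectionAt p' (leftSupport x) * p' * x *
        (sectionAt p (rightSupport x) * p * rightSupport x) := by noncomm_ring
    _ = sectionAt p' (leftSupport x) * (leftSupport x * x) * rightSupport x := by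
        rw [hs'.right_mul, hs.right_mul, hs.mul_left, ← hyl, hy.h1]
    _ = leftSupport x * x * rightSupport x := by rw [← mul_assoc, hs'.mul_left]
    _ = x := by rw [← hyl, hy.h1, ← hyr, ← mul_assoc, hy.h1]

theorem projOfCoord_arrowChart {p' p : M} (hp' : IsStarProjection p') (hp : IsStarProjection p)
    (x : invertibleArrows p₀) (h' : IsTransversal p' (leftSupport x.1))
    (h : IsTransversal p (rightSupport x.1)) (v : corner (1 - p') p' × corner p' p ×
      corner (1 - p) p) (hv : (arrowChart p₀ p' p).map x = v) :
    projOfCoord p' v.1 = leftSupport x.1 ∧ arrowOfCoord p' p (v.1, v.2.1, v.2.2) = x.1 ∧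
      projOfCoord p v.2.2 = rightSupport x.1 := by
  have hl := isStarProjection_of_mem_projOrbit x.2.2.1
  have hr := isStarProjection_of_mem_projOrbit x.2.2.2
  have hs := h.isSectionAt hp hr
  rw [arrowChart_map hp' hp x h' h] at hv
  subst hv
  have e := projOfCoord_projCoord hp hr h
  refine ⟨projOfCoord_projCoord hp' hl h', ?_, e⟩
  have e' : p' * (p' * x.1 * sectionAt p (rightSupport x.1)) * p =
      p' * x.1 * sectionAt p (rightSupport x.1) := by
    rw [← mul_assoc, ← mul_assoc, hp'.isIdempotentElem.eq, mul_assoc, hs.right_mul]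
  simp only [arrowOfCoord]
  rw [e, add_projCoord hp' h', cornerProj_coe, e', arrow_eq hp' hp x.2 h' h]

/-- The middle coordinate a is an invertible arrow from p to p', with inverse b = p y s' for y the
inverse of x. Multiplying by u* moves a into the corner at p, where bu inverts it. -/
theorem isUnit_of_invertibleArrow {p' p u x : M} (hP' : IsStarProjection p')
    (hP : IsStarProjection p) (h : star u * u = p) (h' : u * star u = p')
    (hx : x ∈ invertibleArrows p₀) (ht' : IsTransversal p' (leftSupport x))
    (ht : IsTransversal p (rightSupport x)) :
    IsUnit (star u * (p' * x * sectionAt p (rightSupport x)) + (1 - p)) := by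
  have hpp := hP.isIdempotentElem.eq
  have hm := IsMoorePenrose.of_isometry (h ▸ hP)
  have hup : u * p = u := by rw [← h, ← mul_assoc, hm.h1]
  have hpu : p * star u = star u := by rw [← h, hm.h2]
  have hup' : star u * p' = star u := by rw [← h', ← mul_assoc, hm.h2]
  have hl := isStarProjection_of_mem_projOrbit hx.2.1
  have hr := isStarProjection_of_mem_projOrbit hx.2.2
  obtain ⟨y, hy, hyl, hyr⟩ := exists_moorePenrose_of_mem hx
  have hs' := ht'.isSectionAt hP' hl
  have hs := ht.isSectionAt hP hr
  set s := sectionAt p (rightSupport x)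
  set s' := sectionAt p' (leftSupport x)
  set a := p' * x * s with ha
  set b := p * y * s' with hb
  have hap : a * p = a := by rw [ha, mul_assoc, hs.right_mul]
  have hpb : p * b = b := by rw [hb, ← mul_assoc, ← mul_assoc, hpp]
  have hbp' : b * p' = b := by rw [hb, mul_assoc, hs'.right_mul]
  have hsy : s * y = y := by
    have : rightSupport x * y = y := by rw [← hyr, hy.h2]
    rw [← this, ← mul_assoc, hs.mul_left]
  have hsx : s' * x = x := by
    have : leftSupport x * x = x := by rw [← hyl, hy.h1]
    nth_rw 1 [← this]
    rw [← mul_assoc, hs'.mul_left, this]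
  have hab : a * b = p' := by
    calc a * b = p' * x * (s * p * y) * s' := by rw [ha, hb]; noncomm_ring
      _ = p' * (x * y * s') := by rw [hs.right_mul, hsy]; noncomm_ring
      _ = p' := by rw [hyl, hs'.left_mul, hs'.mul_right]
  have hba : b * a = p := by
    calc b * a = p * y * (s' * p' * x) * s := by rw [ha, hb]; noncomm_ring
      _ = p * (y * x * s) := by rw [hs'.right_mul, hsx]; noncomm_ring
      _ = p := by rw [hyr, hs.left_mul, hs.mul_right]
  refine ⟨⟨_, b * u + (1 - p), ?_, ?_⟩, rfl⟩
  · calc (star u * a + (1 - p)) * (b * u + (1 - p)) =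
          star u * (a * b) * u + star u * (a - a * p) + (b - p * b) * u +
            (1 - p - p + p * p) := by noncomm_ring
      _ = 1 := by rw [hab, hap, hpb, hup', h, hpp]; simp
  · calc (b * u + (1 - p)) * (star u * a + (1 - p)) =
          b * (u * star u) * a + b * (u - u * p) + (star u - p * star u) * a +
            (1 - p - p + p * p) := by noncomm_ring
      _ = 1 := by rw [h', hup, hpu, hbp', hba, hpp]; simp

/-- The inverse of a is b = (u*a + 1 - p)⁻¹u*. Since u*a + 1 - p commutes with p, this element stays
in the right corner. -/
theorem exists_moorePenrose_of_isUnit {p' p u a : M} (hP' : IsStarProjection p')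
    (hP : IsStarProjection p) (h : star u * u = p) (h' : u * star u = p') (ha1 : p' * a = a)
    (ha2 : a * p = a) (hu : IsUnit (star u * a + (1 - p))) :
    ∃ b, IsMoorePenrose a b ∧ a * b = p' ∧ b * a = p := by
  have hpp := hP.isIdempotentElem.eq
  have hm := IsMoorePenrose.of_isometry (h ▸ hP)
  have hup : u * p = u := by rw [← h, ← mul_assoc, hm.h1]
  have hpu : p * star u = star u := by rw [← h, hm.h2]
  set C := star u * a + (1 - p) with hC
  set I := Ring.inverse C
  have hIC : I * C = 1 := Ring.inverse_mul_cancel _ hu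
  have hCI : C * I = 1 := Ring.mul_inverse_cancel _ hu
  have hpC : p * C = star u * a := by
    rw [hC, mul_add, mul_sub, mul_one, hpp, sub_self, add_zero, ← mul_assoc, hpu]
  have hCp : C * p = star u * a := by
    rw [hC, add_mul, sub_mul, one_mul, hpp, sub_self, add_zero, mul_assoc, ha2]
  have hIp : I * p = p * I := by
    calc I * p = I * (p * C) * I := by rw [mul_assoc, mul_assoc p, hCI, mul_one]
      _ = (I * C) * p * I := by rw [hpC, ← hCp]; noncomm_ring
      _ = p * I := by rw [hIC, one_mul]
  set b := I * star u with hb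
  have hba : b * a = p := by
    rw [hb, mul_assoc, ← hCp, ← mul_assoc, hIC, one_mul]
  have hab : a * b = p' := by
    calc a * b = u * (star u * a) * I * star u := by
          nth_rw 1 [← ha1]; rw [← h', hb]; noncomm_ring
      _ = u * (p * (C * I)) * star u := by rw [← hpC]; noncomm_ring
      _ = p' := by rw [hCI, mul_one, hup, h']
  have hpb : p * b = b := by rw [hb, ← mul_assoc, ← hIp, mul_assoc, hpu]
  have hMab : IsMoorePenrose a b := by
    refine ⟨by rw [hab, ha1], by rw [hba, hpb], ?_, ?_⟩
    · rw [hab, hP'.isSelfAdjoint.star_eq]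
    · rw [hba, hP.isSelfAdjoint.star_eq]
  exact ⟨b, hMab, hab, hba⟩

/-- The arrow is s'a(pq), the composite of the inverse of s from q to p, of a from p to p', and of
s' from p' to q'. -/
theorem exists_arrow {p' p q' q s' s a b : M} (hP' : IsStarProjection p')
    (hP : IsStarProjection p) (hq' : IsStarProjection q') (hq : IsStarProjection q)
    (hs' : IsSectionAt p' q' s') (hs : IsSectionAt p q s) (ha1 : p' * a = a) (ha2 : a * p = a)
    (hMab : IsMoorePenrose a b) (hab : a * b = p') (hba : b * a = p) :
    ∃ x ∈ partiallyInvertible M, leftSupport x = q' ∧ rightSupport x = q ∧ p' * x * s = a := by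
  have m1 := hs.isMoorePenrose hP hq
  have e1 : p * q * s = p := by rw [mul_assoc, hs.left_mul, hs.mul_right]
  have e2 : s * (p * q) = q := by rw [← mul_assoc, hs.right_mul, hs.mul_left]
  have e3 : p' * q' * s' = p' := by rw [mul_assoc, hs'.left_mul, hs'.mul_right]
  have e4 : s' * (p' * q') = q' := by rw [← mul_assoc, hs'.right_mul, hs'.mul_left]
  obtain ⟨m2, e5, e6⟩ := hMab.mul m1.symm (hba.trans e1.symm)
  obtain ⟨m3, e7, e8⟩ := (hs'.isMoorePenrose hP' hq').mul m2 (e3.trans (e5.trans hab).symm)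
  have hl : leftSupport (s' * (a * (p * q))) = q' := by rw [m3.leftSupport_eq, e7, e4]
  have hr : rightSupport (s' * (a * (p * q))) = q := by rw [m3.rightSupport_eq, e8, e6, e2]
  refine ⟨_, mem_partiallyInvertible_iff.2 ⟨_, m3⟩, hl, hr, ?_⟩
  calc _ = (p' * s') * a * (p * q * s) := by noncomm_ring
    _ = a := by rw [hs'.mul_right, e1, ha1, ha2]

/-- The partial isometry u identifies arrows from p to p' with elements of the corner at p, so the
only constraint on coordinates is membership of an affine expression in the open set of units. -/
theorem arrowChart_image {p' p u : M} (hp' : p' ∈ projOrbit p₀) (hp : p ∈ projOrbit p₀)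
    (h : star u * u = p) (h' : u * star u = p') :
    (arrowChart p₀ p' p).map '' (arrowChart p₀ p' p).dom =
      {v : corner (1 - p') p' × corner p' p × corner (1 - p) p |
        IsUnit (star u * (v.2.1 : M) + (1 - p))} := by
  have hP' := isStarProjection_of_mem_projOrbit hp'
  have hP := isStarProjection_of_mem_projOrbit hp
  refine Subset.antisymm ?_ ?_
  · rintro _ ⟨x, ⟨hx', hx⟩, rfl⟩
    rw [arrowChart_map hP' hP x hx' hx]
    change IsUnit (star u * (p' * (p' * x.1 * sectionAt p (rightSupport x.1)) * p) + (1 - p))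
    have e : p' * (p' * x.1 * sectionAt p (rightSupport x.1)) * p =
        p' * x.1 * sectionAt p (rightSupport x.1) := by
      rw [← mul_assoc, ← mul_assoc, hP'.isIdempotentElem.eq, mul_assoc,
        (hx.isSectionAt hP (isStarProjection_of_mem_projOrbit x.2.2.2)).right_mul]
    rw [e]
    exact isUnit_of_invertibleArrow hP' hP h h' x.2 hx' hx
  · rintro ⟨φ', ⟨a, ha⟩, φ⟩ hu
    obtain ⟨ha1, ha2⟩ := (mem_corner_iff hP' hP).1 ha
    obtain ⟨b, hMab, hab, hba⟩ := exists_moorePenrose_of_isUnit hP' hP h h' ha1 ha2 hu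
    obtain ⟨hq', hs'⟩ := isSectionAt_projOfCoord hP' φ'.2
    obtain ⟨hq, hs⟩ := isSectionAt_projOfCoord hP φ.2
    obtain ⟨x, hx, hl, hr, e9⟩ := exists_arrow hP' hP hq' hq hs' hs ha1 ha2 hMab hab hba
    have hx : x ∈ invertibleArrows p₀ :=
      ⟨hx, by rw [hl]; exact projOfCoord_mem hp' φ'.2, by rw [hr]; exact projOfCoord_mem hp φ.2⟩
    have t' : IsTransversal p' (leftSupport x) := by rw [hl]; exact hs'.isTransversal hP'
    have t : IsTransversal p (rightSupport x) := by rw [hr]; exact hs.isTransversal hP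
    refine ⟨⟨x, hx⟩, ⟨t', t⟩, ?_⟩
    refine (arrowChart_map hP' hP ⟨x, hx⟩ t' t).trans ?_
    simp only [hl, hr]
    rw [hs.sectionAt_eq hP hq, e9, cornerProj_of_mem hP' hP ha, projCoord_projOfCoord hP',
      projCoord_projOfCoord hP]

/-- The supports are included in the embedding because the supports of a partially invertible
element need not depend on it continuously in norm. As functions of the triple, the coordinates are
smooth by `sectionFun`; conversely `projOfCoord` and `arrowOfCoord` recover the triple. -/
theorem isEmbeddedAtlas_invertibleAtlas (p₀ : M) :
    IsEmbeddedAtlas (invertibleAtlas p₀) fun x : invertibleArrows p₀ =>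
      (leftSupport x.1, x.1, rightSupport x.1) where
  cover x := ⟨_, ⟨_, x.2.2.1, _, x.2.2.2, rfl⟩,
    isTransversal_refl (isStarProjection_of_mem_projOrbit x.2.2.1),
    isTransversal_refl (isStarProjection_of_mem_projOrbit x.2.2.2)⟩
  chart := by
    rintro _ ⟨p', hp', p, hp, rfl⟩
    have hP' := isStarProjection_of_mem_projOrbit hp'
    have hP := isStarProjection_of_mem_projOrbit hp
    constructor
    · intro x hx y hy e
      apply Subtype.ext
      rw [← (projOfCoord_arrowChart hP' hP x hx.1 hx.2 _ rfl).2.1,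
        ← (projOfCoord_arrowChart hP' hP y hy.1 hy.2 _ e.symm).2.1]
    · obtain ⟨u, h, h'⟩ := exists_isometry_between hp hp'
      rw [arrowChart_image hp' hp h h']
      refine Units.isOpen.preimage (?_ : Continuous fun v : corner (1 - p') p' × corner p' p ×
        corner (1 - p) p => star u * (v.2.1 : M) + (1 - p))
      fun_prop
  embeds := by
    rintro _ ⟨p', hp', p, hp, rfl⟩ x hx
    have hP' := isStarProjection_of_mem_projOrbit hp'
    have hP := isStarProjection_of_mem_projOrbit hp
    obtain ⟨k1, k2⟩ := eventually_isSectionAt hP' (isStarProjection_of_mem_projOrbit x.2.2.1) hx.1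
    obtain ⟨h1, h2⟩ := eventually_isSectionAt hP (isStarProjection_of_mem_projOrbit x.2.2.2) hx.2
    have s1 : ∀ v : corner (1 - p') p' × corner p' p × corner (1 - p) p,
        SmoothNear (fun v : corner (1 - p') p' × corner p' p × corner (1 - p) p => (v.1 : M)) v :=
      fun v => smoothNear_id.fst.clm_comp (corner (1 - p') p').subtypeL
    have s2 : ∀ v : corner (1 - p') p' × corner p' p × corner (1 - p) p,
        SmoothNear (fun v : corner (1 - p') p' × corner p' p × corner (1 - p) p => (v.2.1 : M)) v :=
      fun v => smoothNear_id.snd.fst.clm_comp (corner p' p).subtypeL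
    have s3 : ∀ v : corner (1 - p') p' × corner p' p × corner (1 - p) p,
        SmoothNear (fun v : corner (1 - p') p' × corner p' p × corner (1 - p) p => (v.2.2 : M)) v :=
      fun v => smoothNear_id.snd.snd.clm_comp (corner (1 - p) p).subtypeL
    have s4 : ∀ v : corner (1 - p') p' × corner p' p × corner (1 - p) p,
        SmoothNear (fun v : corner (1 - p') p' × corner p' p × corner (1 - p) p =>
          projOfCoord p (v.2.2 : M)) v :=
      fun v => SmoothNear.comp (smoothNear_projOfCoord p _) (s3 v)
    refine ⟨hx, ⟨fun v : corner (1 - p') p' × corner p' p × corner (1 - p) p =>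
      (projOfCoord p' (v.1 : M), arrowOfCoord p' p (v.1, v.2.1, v.2.2), projOfCoord p (v.2.2 : M)),
      ?_, ?_⟩, fun v => (cornerProj hP'.one_sub hP' (sectionFun p' v.1 - p'),
        cornerProj hP' hP (p' * v.2.1 * sectionFun p v.2.2),
        cornerProj hP.one_sub hP (sectionFun p v.2.2 - p)), ?_, ?_⟩
    · refine (SmoothNear.comp (smoothNear_projOfCoord p' _) (s1 _)).prodMk
        (SmoothNear.prodMk ?_ (s4 _))
      exact ((smoothNear_const.add (s1 _)).mul (s2 _)).mul (smoothNear_const.mul (s4 _))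
    · filter_upwards [(arrowChart p₀ p' p).eventually_mem_dom x] with y hy
      obtain ⟨e1, e2, e3⟩ := projOfCoord_arrowChart hP' hP y hy.1 hy.2 _ rfl
      exact Prod.ext e1 (Prod.ext e2 e3)
    · set w := (leftSupport x.1, x.1, rightSupport x.1)
      have t1 : SmoothNear (fun v : M × M × M => sectionFun p' v.1) w :=
        SmoothNear.comp (v := w) k1 smoothNear_id.fst
      have t2 : SmoothNear (fun v : M × M × M => sectionFun p v.2.2) w :=
        SmoothNear.comp (v := w) h1 smoothNear_id.snd.snd
      exact ((t1.sub smoothNear_const).clm_comp _).prodMk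
        ((((smoothNear_const.mul smoothNear_id.snd.fst).mul t2).clm_comp _).prodMk
          ((t2.sub smoothNear_const).clm_comp _))
    · have l1 : Tendsto (fun v : M × M × M => v.1)
          (𝓝 (leftSupport x.1, x.1, rightSupport x.1)) (𝓝 (leftSupport x.1)) :=
        continuous_fst.continuousAt
      have l2 : Tendsto (fun v : M × M × M => v.2.2)
          (𝓝 (leftSupport x.1, x.1, rightSupport x.1)) (𝓝 (rightSupport x.1)) :=
        (continuous_snd.comp continuous_snd).continuousAt
      filter_upwards [l1.eventually k2, l2.eventually h2]
      rintro _ g1 g2 y rfl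
      have hl := isStarProjection_of_mem_projOrbit y.2.2.1
      have hr := isStarProjection_of_mem_projOrbit y.2.2.2
      replace g1 := g1 hl
      replace g2 := g2 hr
      have d1 := g1.isTransversal hP'
      have d2 := g2.isTransversal hP
      refine ⟨⟨d1, d2⟩, ?_⟩
      rw [arrowChart_map hP' hP y d1 d2, projCoord_eq_cornerProj hP' hl g1,
        projCoord_eq_cornerProj hP hr g2, g2.sectionAt_eq hP hr]

end Arrows

/-! ### Partial isometries and the unitary bundle as submanifolds -/

section Isometries

variable {M : Type u} [CStarAlgebra M]

theorem HasFDerivAt.star_mul_self {E : Type*} [NormedAddCommGroup E] [NormedSpace ℝ E]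
    (l : E →L[ℝ] M) (v : E) : ∃ D : E →L[ℝ] M,
      HasFDerivAt (fun w => star (l w) * l w) D v ∧
        ∀ k, D k = star (l v) * l k + star (l k) * l v := by
  have h1 : HasFDerivAt (fun w => star (l w)) _ v :=
    (((starL' ℝ : M ≃L[ℝ] M) : M →L[ℝ] M).comp l).hasFDerivAt
  refine ⟨_, h1.mul' l.hasFDerivAt, fun k => ?_⟩
  simp

theorem star_sub_mul_sub {p q s : M} (hp : IsStarProjection p) (h : IsSectionAt p q s) :
    p + star (s - p) * (s - p) = star s * s := by
  have h1 : star s * p = p := by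
    simpa [hp.isSelfAdjoint.star_eq] using congrArg star h.mul_right
  rw [star_sub, hp.isSelfAdjoint.star_eq]
  calc _ = p + star s * s - star s * p - p * s + p * p := by noncomm_ring
    _ = _ := by rw [h1, h.mul_right, hp.isIdempotentElem.eq]; abel

/-- Partial isometries in coordinates. -/
theorem star_mul_self_eq_iff {p' p q' q s' s x : M} (hp' : IsStarProjection p')
    (hp : IsStarProjection p) (hq : IsStarProjection q) (hs' : IsSectionAt p' q' s')
    (hs : IsSectionAt p q s) (h1 : q' * x = x) (h2 : x * q = x) :
    star x * x = q ↔ star (p' * x * s) * (1 + star (s' - p') * (s' - p')) * (p' * x * s) -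
      (p + star (s - p) * (s - p)) = 0 := by
  have hpp' := hp'.isIdempotentElem.eq
  -- The section s' restores what p' removed. Hence a*(s'*s')a = s*(x*x)s for a = p'xs, and the
  -- equation compares x*x with q after compression by s.
  have e1 : s' * (p' * x * s) = x * s := by
    calc _ = s' * p' * x * s := by noncomm_ring
      _ = s' * (q' * x) * s := by rw [hs'.right_mul, h1]
      _ = x * s := by rw [← mul_assoc, hs'.mul_left, h1]
  have e2 : star (p' * x * s) * p' = star (p' * x * s) := by
    have : p' * (p' * x * s) = p' * x * s := by rw [← mul_assoc, ← mul_assoc, hpp']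
    simpa [hp'.isSelfAdjoint.star_eq, mul_assoc] using congrArg star this
  have e3 : star (p' * x * s) * (1 + star (s' - p') * (s' - p')) * (p' * x * s) =
      star s * (star x * x) * s := by
    calc _ = star (p' * x * s) * (p' * x * s) +
          star (p' * x * s) * (star (s' - p') * (s' - p')) * (p' * x * s) := by noncomm_ring
      _ = star (p' * x * s) * (p' + star (s' - p') * (s' - p')) * (p' * x * s) := by
          nth_rw 1 [← e2]; noncomm_ring
      _ = star (s' * (p' * x * s)) * (s' * (p' * x * s)) := by
          rw [star_sub_mul_sub hp' hs', star_mul s']; noncomm_ring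
      _ = _ := by rw [e1, star_mul]; noncomm_ring
  have e4 : star s * s = star s * q * s := by rw [mul_assoc, hs.left_mul]
  rw [e3, star_sub_mul_sub hp hs, e4]
  constructor
  · intro h
    rw [h, sub_self]
  · intro h
    -- Multiplying by pq on the right and by its adjoint on the left undoes the compression by s.
    have e5 : s * (p * q) = q := by rw [← mul_assoc, hs.right_mul, hs.mul_left]
    have e6 : q * star x = star x := by
      simpa [hq.isSelfAdjoint.star_eq] using congrArg star h2
    have e7 : star (p * q) * (star s * (star x * x) * s - star s * q * s) * (p * q) =
        star x * x - q := by
      calc _ = star (s * (p * q)) * (star x * x - q) * (s * (p * q)) := by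
            rw [star_mul s]; noncomm_ring
        _ = q * star x * (x * q) - q * q * q := by
            rw [e5, hq.isSelfAdjoint.star_eq]; noncomm_ring
        _ = _ := by rw [e6, h2, hq.isIdempotentElem.eq, hq.isIdempotentElem.eq]
    rw [h, mul_zero, zero_mul] at e7
    exact (sub_eq_zero.1 e7.symm)

variable [PartialOrder M] [StarOrderedRing M] {p₀ : M}

theorem rightSupport_isometry {u : M} (hu : u ∈ isometryArrows p₀) :
    rightSupport u = star u * u := (IsMoorePenrose.of_isometry hu.1).rightSupport_eq

theorem leftSupport_isometry {u : M} (hu : u ∈ isometryArrows p₀) :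
    leftSupport u = u * star u := (IsMoorePenrose.of_isometry hu.1).leftSupport_eq

theorem mem_isometryArrows_iff {x : M} (hx : x ∈ invertibleArrows p₀) :
    x ∈ isometryArrows p₀ ↔ star x * x = rightSupport x :=
  ⟨fun h => (rightSupport_isometry h).symm,
    fun h => ⟨h ▸ isStarProjection_of_mem_projOrbit hx.2.2, hx⟩⟩

theorem mem_isometryArrows {u : M} (h : star u * u ∈ projOrbit p₀) : u ∈ isometryArrows p₀ := by
  have hm := IsMoorePenrose.of_isometry (isStarProjection_of_mem_projOrbit h)
  refine ⟨isStarProjection_of_mem_projOrbit h, mem_partiallyInvertible_iff.2 ⟨_, hm⟩, ?_, ?_⟩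
  · rw [hm.leftSupport_eq]; exact mem_projOrbit_of_isometry h rfl rfl
  · rwa [hm.rightSupport_eq]

/-! ### The atlas of the partial isometries -/

/-- In the chart centred at (l(u), r(u)) both outer coordinates of u vanish, so the quadratic terms
in them do not contribute to the differential of the defining equation. What remains is k ↦ u*k +
k*u. -/
theorem exists_mem_isometryAtlas (u : isometryArrows p₀) :
    ∃ e ∈ isometryAtlas p₀, u ∈ e.dom := by
  obtain ⟨u, hu⟩ := u
  have hl := leftSupport_isometry hu
  have hr := rightSupport_isometry hu
  have hp' : leftSupport u ∈ projOrbit p₀ := hu.2.2.1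
  have hp : rightSupport u ∈ projOrbit p₀ := hu.2.2.2
  set p' := leftSupport u with hp'def
  set p := rightSupport u with hpdef
  have hP' := isStarProjection_of_mem_projOrbit hp'
  have hP := isStarProjection_of_mem_projOrbit hp
  have hpp := hP.isIdempotentElem.eq
  have hps := hP.isSelfAdjoint.star_eq
  have hm := IsMoorePenrose.of_isometry hu.1
  have hup : u * p = u := by rw [hr, ← mul_assoc, hm.h1]
  have hpu : p' * u = u := by rw [hl, hm.h1]
  have t' : IsTransversal p' p' := isTransversal_refl hP'
  have t : IsTransversal p p := isTransversal_refl hP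
  let Ec := corner (1 - p') p' × corner p' p × corner (1 - p) p
  let l1 : Ec →L[ℝ] M := (corner (1 - p') p').subtypeL.comp (ContinuousLinearMap.fst ℝ _ _)
  let l2 : Ec →L[ℝ] M := (corner p' p).subtypeL.comp
    ((ContinuousLinearMap.fst ℝ _ _).comp (ContinuousLinearMap.snd ℝ _ _))
  let l3 : Ec →L[ℝ] M := (corner (1 - p) p).subtypeL.comp
    ((ContinuousLinearMap.snd ℝ _ _).comp (ContinuousLinearMap.snd ℝ _ _))
  let g : Ec → M := fun v => star (l2 v) * (1 + star (l1 v) * l1 v) * l2 v -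
    (p + star (l3 v) * l3 v)
  let v₀ : Ec := (arrowChart p₀ p' p).map ⟨u, hu.2⟩
  have hv₀ : v₀ = (0, cornerProj hP' hP u, 0) := by
    refine (arrowChart_map hP' hP ⟨u, hu.2⟩ t' t).trans ?_
    have e1 : sectionAt p p = p := (IsSectionAt.refl hP).sectionAt_eq hP hP
    have e2 : sectionAt p' p' = p' := (IsSectionAt.refl hP').sectionAt_eq hP' hP'
    refine Prod.ext ?_ (Prod.ext ?_ ?_)
    · exact Subtype.ext ((projCoord_coe hP' t').trans (by rw [e2, sub_self]; rfl))
    · change cornerProj hP' hP (p' * u * sectionAt p p) = cornerProj hP' hP u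
      rw [e1, hpu, hup]
    · exact Subtype.ext ((projCoord_coe hP t).trans (by rw [e1, sub_self]; rfl))
  have h1 : l1 v₀ = 0 := by rw [hv₀]; rfl
  have h2 : l2 v₀ = u := by
    rw [hv₀]
    exact (cornerProj_coe hP' hP u).trans (by rw [hpu, hup])
  have h3 : l3 v₀ = 0 := by rw [hv₀]; rfl
  obtain ⟨D1, hD1, hD1'⟩ := HasFDerivAt.star_mul_self l1 v₀
  obtain ⟨D3, hD3, hD3'⟩ := HasFDerivAt.star_mul_self l3 v₀
  obtain ⟨D, hD, hD'⟩ : ∃ D : Ec →L[ℝ] M, HasFDerivAt g D v₀ ∧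
      ∀ k, D k = star u * l2 k + star (l2 k) * u := by
    have h4 : HasFDerivAt (fun w => star (l2 w)) _ v₀ :=
      (((starL' ℝ : M ≃L[ℝ] M) : M →L[ℝ] M).comp l2).hasFDerivAt
    refine ⟨_, ((h4.mul' (hD1.const_add 1)).mul' l2.hasFDerivAt).sub (hD3.const_add p),
      fun k => ?_⟩
    simp [hD1', hD3', h1, h2, h3]
  -- For self-adjoint m with pm = m, the choice k = um/2 gives u*k + k*u = m; only the middle
  -- coordinate is moved.
  let L : M →L[ℝ] Ec := (ContinuousLinearMap.inr ℝ _ _).comp ((ContinuousLinearMap.inl ℝ _ _).comp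
    ((1 / 2 : ℝ) • (cornerProj hP' hP).comp (ContinuousLinearMap.mul ℝ M u)))
  have hL : ∀ m, l2 (L m) = (1 / 2 : ℝ) • (p' * (u * m) * p) := fun m => rfl
  -- The values of g are self-adjoint elements of the corner at p, so it suffices that L is a right
  -- inverse there; on all of `M` it is not one.
  have hg : ∀ v, star (g v) = g v ∧ g v * p = g v := by
    intro v
    have e2 : l2 v * p = l2 v := ((mem_corner_iff hP' hP).1 v.2.1.2).2
    have e3 : l3 v * p = l3 v := ((mem_corner_iff hP.one_sub hP).1 v.2.2.2).2
    constructor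
    · simp only [g, star_sub, star_add, star_mul, star_star, star_one, hps, mul_assoc]
    · simp only [g, sub_mul, add_mul, mul_assoc, e2, e3, hpp]
  have hDL : ∀ v, D (L (g v)) = g v := by
    intro v
    obtain ⟨e1, e2⟩ := hg v
    have e3 : p * g v = g v := by
      have := congrArg star e2
      rwa [star_mul, hps, e1] at this
    have e4 : p' * (u * g v) * p = u * g v := by
      rw [← mul_assoc, hpu, mul_assoc, e2]
    have e5 : star u * (u * g v) = g v := by rw [← mul_assoc, ← hr, e3]
    have e6 : star (u * g v) * u = g v := by rw [star_mul, e1, mul_assoc, ← hr, e2]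
    rw [hD', hL, e4, star_smul, mul_smul_comm, smul_mul_assoc, e5, e6, ← add_smul]
    norm_num
  have hsm : ∀ v, SmoothNear g v := fun v =>
    (((l2.smoothNear v).star.mul (smoothNear_const.add
      ((l1.smoothNear v).star.mul (l1.smoothNear v)))).mul (l2.smoothNear v)).sub
      (smoothNear_const.add ((l3.smoothNear v).star.mul (l3.smoothNear v)))
  refine exists_mem_submanifoldAtlas (isEmbeddedAtlas_invertibleAtlas p₀).isSmoothAtlas
    (c := arrowChart p₀ p' p) (i := inclusion (isArrowSet_isometryArrows p₀).subset)
    ⟨p', hp', p, hp, rfl⟩ (y := ⟨u, hu⟩) ⟨t', t⟩ g D L (hsm v₀) hD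
    (Eventually.of_forall hDL) ?_
  filter_upwards [(arrowChart p₀ p' p).eventually_mem_dom _] with x hx
  have hxl := isStarProjection_of_mem_projOrbit x.2.2.1
  have hxr := isStarProjection_of_mem_projOrbit x.2.2.2
  have hs' := hx.1.isSectionAt hP' hxl
  have hs := hx.2.isSectionAt hP hxr
  obtain ⟨y, hy, hyl, hyr⟩ := exists_moorePenrose_of_mem x.2
  have e1 : x ∈ range (inclusion (isArrowSet_isometryArrows p₀).subset) ↔
      x.1 ∈ isometryArrows p₀ := by
    rw [range_inclusion]; rfl
  have f1 : p' * (p' * x.1 * sectionAt p (rightSupport x.1)) * p =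
      p' * x.1 * sectionAt p (rightSupport x.1) := by
    rw [← mul_assoc, ← mul_assoc, hP'.isIdempotentElem.eq, mul_assoc, hs.right_mul]
  have e2 := arrowChart_map hP' hP x hx.1 hx.2
  have g1 : l1 ((arrowChart p₀ p' p).map x) = sectionAt p' (leftSupport x.1) - p' := by
    rw [e2]; exact projCoord_coe hP' hx.1
  have g2 : l2 ((arrowChart p₀ p' p).map x) = p' * x.1 * sectionAt p (rightSupport x.1) := by
    rw [e2]; exact f1
  have g3 : l3 ((arrowChart p₀ p' p).map x) = sectionAt p (rightSupport x.1) - p := by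
    rw [e2]; exact projCoord_coe hP hx.2
  rw [e1, mem_isometryArrows_iff x.2, star_mul_self_eq_iff hP' hP hxr hs' hs
    (by rw [← hyl, hy.h1]) (by rw [← hyr, ← mul_assoc, hy.h1])]
  change _ ↔ star (l2 _) * (1 + star (l1 _) * l1 _) * l2 _ - (p + star (l3 _) * l3 _) = 0
  rw [g1, g2, g3]

/-- For a partial isometry the supports uu* and u*u are smooth functions of u, so u alone replaces
the triple. -/
theorem isEmbeddedAtlas_isometryAtlas (p₀ : M) :
    IsEmbeddedAtlas (isometryAtlas p₀) (Subtype.val : isometryArrows p₀ → M) := by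
  have h := (isEmbeddedAtlas_invertibleAtlas p₀).submanifold
    (inclusion_injective (isArrowSet_isometryArrows p₀).subset) exists_mem_isometryAtlas
  refine h.change (fun v : M => (v * star v, v, star v * v)) (fun _ => ?_) (fun u => ?_)
    (fun v => v.2.1) (fun _ => smoothNear_id.snd.fst) fun _ => rfl
  · exact (smoothNear_id.mul smoothNear_id.star).prodMk
      (smoothNear_id.prodMk (smoothNear_id.star.mul smoothNear_id))
  · exact Prod.ext (leftSupport_isometry u.2).symm
      (Prod.ext rfl (rightSupport_isometry u.2).symm)

/-! ### The atlas of the unitary bundle -/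

/-- The equation η*η = p₀ has differential k ↦ η*k + k*η, and k = ηm/2 solves η*k + k*η = m for
self-adjoint m in the corner at p₀. -/
theorem exists_mem_bundleAtlas (hp₀ : IsStarProjection p₀) (η : isometryBundle p₀) :
    ∃ e ∈ bundleAtlas p₀, η ∈ e.dom := by
  have hη := η.2.2
  have hpp := hp₀.isIdempotentElem.eq
  have hps := hp₀.isSelfAdjoint.star_eq
  have hm := IsMoorePenrose.of_isometry (u := η.1) (by rw [hη]; exact hp₀)
  let l : corner 1 p₀ →L[ℝ] M := (corner 1 p₀).subtypeL
  let g : corner 1 p₀ → M := fun v => star (l v) * l v - p₀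
  obtain ⟨D, hD, hD'⟩ := HasFDerivAt.star_mul_self l (bundleInclusion p₀ η)
  have h1 : l (bundleInclusion p₀ η) = η.1 := rfl
  rw [h1] at hD'
  have hone : IsStarProjection (1 : M) := .one M
  let L : M →L[ℝ] corner 1 p₀ :=
    (1 / 2 : ℝ) • (cornerProj hone hp₀).comp (ContinuousLinearMap.mul ℝ M η.1)
  have hL : ∀ m, l (L m) = (1 / 2 : ℝ) • (1 * (η.1 * m) * p₀) := fun m => rfl
  have hg : ∀ v, star (g v) = g v ∧ g v * p₀ = g v := by
    intro v
    have e2 : l v * p₀ = l v := ((mem_corner_iff hone hp₀).1 v.2).2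
    constructor
    · simp only [g, star_sub, star_mul, star_star, hps]
    · simp only [g, sub_mul, mul_assoc, e2, hpp]
  have hDL : ∀ v, D (L (g v)) = g v := by
    intro v
    obtain ⟨e1, e2⟩ := hg v
    have e3 : p₀ * g v = g v := by
      have := congrArg star e2
      rwa [star_mul, hps, e1] at this
    have e4 : 1 * (η.1 * g v) * p₀ = η.1 * g v := by rw [one_mul, mul_assoc, e2]
    have e5 : star η.1 * (η.1 * g v) = g v := by rw [← mul_assoc, hη, e3]
    have e6 : star (η.1 * g v) * η.1 = g v := by rw [star_mul, e1, mul_assoc, hη, e2]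
    rw [hD', hL, e4, star_smul, mul_smul_comm, smul_mul_assoc, e5, e6, ← add_smul]
    norm_num
  refine exists_mem_submanifoldAtlas (isEmbeddedAtlas_vectorAtlas (corner 1 p₀)).isSmoothAtlas
    (i := bundleInclusion p₀) rfl (y := η) (mem_univ _) g D L
    (((l.smoothNear _).star.mul (l.smoothNear _)).sub smoothNear_const) (hD.sub_const p₀)
    (Eventually.of_forall hDL) (Eventually.of_forall fun v => ?_)
  change _ ↔ star (v : M) * v - p₀ = 0
  rw [sub_eq_zero]
  constructor
  · rintro ⟨η, rfl⟩
    exact η.2.2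
  · exact fun h => ⟨⟨v.1, mem_isometryBundle hp₀ h⟩, rfl⟩

theorem isEmbeddedAtlas_bundleAtlas (hp₀ : IsStarProjection p₀) :
    IsEmbeddedAtlas (bundleAtlas p₀) (Subtype.val : isometryBundle p₀ → M) := by
  have h := (isEmbeddedAtlas_vectorAtlas (corner 1 p₀)).submanifold
    (i := bundleInclusion p₀)
    (fun η ξ e => Subtype.ext (congrArg (fun v : corner 1 p₀ => (v : M)) e))
    (exists_mem_bundleAtlas hp₀)
  refine h.change (cornerProj (.one M) hp₀)
    (fun _ => ContinuousLinearMap.smoothNear _ _) (fun η => ?_)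
    (corner 1 p₀).subtypeL (fun _ => ContinuousLinearMap.smoothNear _ _) fun _ => rfl
  exact cornerProj_of_mem (.one M) hp₀ (bundleInclusion p₀ η).2

end Isometries

section Groupoids

variable {M : Type u} [CStarAlgebra M]

/-! ### Banach-Lie groupoids of partial isometries -/

/-- A groupoid with the structure maps of partial isometries is a Banach-Lie groupoid. -/
theorem isBanachLie_of_isometries {G B : Type u} {Γ : SetGroupoid G B}
    {A : Set (BanachChart G)} {A₀ : Set (BanachChart B)} {j : G → M} {k : B → M}
    (hA : IsEmbeddedAtlas A j) (hB : IsEmbeddedAtlas A₀ k) (hk : ∀ b, IsStarProjection (k b))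
    (hs : ∀ x, k (Γ.src x) = star (j x) * j x) (ht : ∀ x, k (Γ.tgt x) = j x * star (j x))
    (hm : ∀ x y e, j (Γ.mul x y e) = j x * j y) (hi : ∀ x, j (Γ.inv x) = star (j x))
    (hu : ∀ b, j (Γ.unit b) = k b)
    (hr : ∀ u b b', star u * u = k b → u * star u = k b' → u ∈ range j) :
    Γ.IsBanachLie A A₀ := by
  -- The polar section is taken at η = k b, a projection regarded as a partial isometry; s(q) is
  -- then an arrow from k b to q.
  have hsec : ∀ b, ∃ s : M → M, SmoothNear s (k b) ∧ s (k b) = k b ∧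
      ∀ᶠ q in 𝓝 (k b), IsStarProjection q → star (s q) * s q = k b ∧ s q * star (s q) = q ∧
        s q * k b = s q := by
    intro b
    have h1 := (hk b).isIdempotentElem.eq
    have h2 := (hk b).isSelfAdjoint.star_eq
    obtain ⟨s, h3, h4, h5⟩ := exists_isometry_section (hk b) (η := k b) (by rw [h2, h1])
    rw [h2, h1] at h3 h4 h5
    refine ⟨s, h3, h4, ?_⟩
    filter_upwards [h5] with q h5 hq
    obtain ⟨h6, h7⟩ := h5 hq
    refine ⟨h6, h7, ?_⟩
    rw [← h6, ← mul_assoc]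
    exact (IsMoorePenrose.of_isometry (h6 ▸ hk b)).h1
  have hMP : ∀ x, IsMoorePenrose (j x) (star (j x)) := fun x =>
    .of_isometry (hs x ▸ hk _)
  refine SetGroupoid.isBanachLie_of_embedded hA hB (fun x => ?_) (fun x => ?_) (fun v => v.1 * v.2)
    (fun _ => smoothNear_id.fst.mul smoothNear_id.snd) hm star
    (fun _ => smoothNear_id.star) hi (fun v => v) (fun _ => smoothNear_id) hu
  · obtain ⟨s, h1, h2, h3⟩ := hsec (Γ.src x)
    -- The section of the source through x is q ↦ x s(q)*: it precomposes x with an arrow from q to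
    -- the source of x and keeps the target. The hypothesis `hr` says that this partial isometry is
    -- an arrow of the groupoid.
    refine hA.splitMapAt hB (hA.smoothMapAt hB (fun v => star v * v)
      (smoothNear_id.star.mul smoothNear_id) (Eventually.of_forall fun _ y hy => by rw [hs, hy]))
      (fun q => j x * star (s q)) (smoothNear_const.mul h1.star) ?_ ?_
    · rw [h2, (hk _).isSelfAdjoint.star_eq, hs, ← mul_assoc, (hMP x).h1]
    · filter_upwards [h3]
      rintro _ h b rfl
      obtain ⟨h4, h5, h6⟩ := h (hk b)
      have e1 : star (j x * star (s (k b))) * (j x * star (s (k b))) = k b := by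
        calc _ = s (k b) * (star (j x) * j x) * star (s (k b)) := by
              rw [star_mul, star_star]; noncomm_ring
          _ = k b := by rw [← hs, h6, h5]
      have e2 : j x * star (s (k b)) * star (j x * star (s (k b))) = k (Γ.tgt x) := by
        calc _ = j x * (star (s (k b)) * s (k b)) * star (j x) := by
              rw [star_mul, star_star]; noncomm_ring
          _ = k (Γ.tgt x) := by rw [h4, hs, ← mul_assoc, (hMP x).h1, ht]
      obtain ⟨x', hx'⟩ := hr _ _ _ e1 e2
      exact ⟨x', hx', hB.injective (by rw [hs, hx', e1])⟩
  · obtain ⟨s, h1, h2, h3⟩ := hsec (Γ.tgt x)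
    -- Dually, s(q) x moves the target to q and keeps the source.
    refine hA.splitMapAt hB (hA.smoothMapAt hB (fun v => v * star v)
      (smoothNear_id.mul smoothNear_id.star) (Eventually.of_forall fun _ y hy => by rw [ht, hy]))
      (fun q => s q * j x) (h1.mul smoothNear_const) ?_ ?_
    · rw [h2, ht, (hMP x).h1]
    · filter_upwards [h3]
      rintro _ h b rfl
      obtain ⟨h4, h5, h6⟩ := h (hk b)
      have e1 : s (k b) * j x * star (s (k b) * j x) = k b := by
        calc _ = s (k b) * (j x * star (j x)) * star (s (k b)) := by
              rw [star_mul]; noncomm_ring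
          _ = k b := by rw [← ht, h6, h5]
      have e2 : star (s (k b) * j x) * (s (k b) * j x) = k (Γ.src x) := by
        calc _ = star (j x) * (star (s (k b)) * s (k b)) * j x := by
              rw [star_mul]; noncomm_ring
          _ = k (Γ.src x) := by rw [h4, ht, ← mul_assoc, (hMP x).h2, hs]
      obtain ⟨x', hx'⟩ := hr _ _ _ e2 e1
      exact ⟨x', hx', hB.injective (by rw [ht, hx', e1])⟩

variable [PartialOrder M] [StarOrderedRing M] {p₀ : M}

theorem isometryGroupoid_src (u : isometryArrows p₀) :
    ((isometryGroupoid p₀).src u : M) = star u.1 * u.1 := rightSupport_isometry u.2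

theorem isometryGroupoid_tgt (u : isometryArrows p₀) :
    ((isometryGroupoid p₀).tgt u : M) = u.1 * star u.1 := leftSupport_isometry u.2

theorem isometryGroupoid_inv (u : isometryArrows p₀) :
    ((isometryGroupoid p₀).inv u : M) = star u.1 :=
  (IsMoorePenrose.of_isometry u.2.1).partialInverse_eq

theorem isometryGroupoid_isBanachLie (p₀ : M) :
    (isometryGroupoid p₀).IsBanachLie (isometryAtlas p₀) (projAtlas p₀) :=
  isBanachLie_of_isometries (isEmbeddedAtlas_isometryAtlas p₀)
    (isEmbeddedAtlas_projAtlas p₀) (fun b => isStarProjection_of_mem_projOrbit b.2)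
    isometryGroupoid_src isometryGroupoid_tgt (fun _ _ _ => rfl) isometryGroupoid_inv
    (fun _ => rfl) fun u b _ h _ => ⟨⟨u, mem_isometryArrows (h ▸ b.2)⟩, rfl⟩

/-! ### The isomorphism with the gauge groupoid -/

theorem isMoorePenrose_of_mem_isometryBundle (hp₀ : IsStarProjection p₀)
    (η : isometryBundle p₀) :
    IsMoorePenrose η.1 (star η.1) :=
  .of_isometry (by rw [η.2.2]; exact hp₀)

theorem mul_star_mem_projOrbit (hp₀ : IsStarProjection p₀) (η : isometryBundle p₀) :
    η.1 * star η.1 ∈ projOrbit p₀ := by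
  rw [← (isMoorePenrose_of_mem_isometryBundle hp₀ η).leftSupport_eq]
  exact η.2.1.1.2.1

theorem star_mul_self_mul_star (η ξ : isometryBundle p₀) :
    star (η.1 * star ξ.1) * (η.1 * star ξ.1) = ξ.1 * star ξ.1 := by
  calc _ = ξ.1 * (star η.1 * η.1) * star ξ.1 := by rw [star_mul, star_star]; noncomm_ring
    _ = _ := by rw [η.2.2, ξ.2.1.2]

variable (hp₀ : IsStarProjection p₀)

/-- The map `[η] ↦ η η*`. -/
def gaugeBaseMap : GaugeBase hp₀ → projOrbit p₀ :=
  Quotient.lift (fun η => ⟨η.1 * star η.1, mul_star_mem_projOrbit hp₀ η⟩) <| by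
    rintro η _ ⟨g, rfl⟩
    apply Subtype.ext
    change η.1 * star η.1 = η.1 * g.1 * star (η.1 * g.1)
    rw [star_mul, mul_assoc, ← mul_assoc g.1, g.2.2.2, ← mul_assoc, η.2.1.2]

/-- The map `⟨η, ξ⟩ ↦ η ξ*`. -/
def gaugeArrowMap : GaugeArrows hp₀ → isometryArrows p₀ :=
  Quotient.lift (fun a => ⟨a.1.1 * star a.2.1, mem_isometryArrows <| by
    rw [star_mul_self_mul_star]; exact mul_star_mem_projOrbit hp₀ a.2⟩) <| by
    rintro ⟨η, ξ⟩ _ ⟨g, rfl⟩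
    apply Subtype.ext
    change η.1 * star ξ.1 = η.1 * g.1 * star (ξ.1 * g.1)
    rw [star_mul, mul_assoc, ← mul_assoc g.1, g.2.2.2, ← mul_assoc, η.2.1.2]

theorem gaugeBaseMap_mk (η : isometryBundle p₀) :
    (gaugeBaseMap hp₀ (baseClass hp₀ η) : M) = η.1 * star η.1 := rfl

theorem gaugeArrowMap_mk (η ξ : isometryBundle p₀) :
    (gaugeArrowMap hp₀ (pairClass hp₀ (η, ξ)) : M) = η.1 * star ξ.1 := rfl

/-- If ηη* = ξξ*, then g = η*ξ is unitary in the corner at p₀ and ξ = ηg. Surjectivity is polar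
decomposition. -/
theorem gaugeBaseMap_bijective : Bijective (gaugeBaseMap hp₀) := by
  constructor
  · rintro ⟨η⟩ ⟨ξ⟩ e
    replace e : η.1 * star η.1 = ξ.1 * star ξ.1 := congrArg Subtype.val e
    have hη := isMoorePenrose_of_mem_isometryBundle hp₀ η
    have hξ := isMoorePenrose_of_mem_isometryBundle hp₀ ξ
    have e1 : η.1 * (star η.1 * ξ.1) = ξ.1 := by rw [← mul_assoc, e, hξ.h1]
    have e3 : p₀ * star η.1 = star η.1 :=
      (congrArg (fun x => x * star η.1) η.2.2.symm).trans hη.h2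
    refine (baseClass_eq hp₀).2 ⟨⟨star η.1 * ξ.1, ?_, ?_, ?_⟩, Subtype.ext e1.symm⟩
    · rw [mul_assoc, mul_assoc, ξ.2.1.2, ← mul_assoc, e3]
    · rw [star_mul, star_star, mul_assoc, e1, ξ.2.2]
    · rw [star_mul, star_star, mul_assoc, ← mul_assoc ξ.1, ← e, hη.h1, η.2.2]
  · intro q
    obtain ⟨ξ, h1, h2⟩ := exists_isometry_of_mem_projOrbit q.2
    exact ⟨baseClass hp₀ ⟨ξ, mem_isometryBundle hp₀ h1⟩, Subtype.ext h2⟩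

/-- An equality ηξ* = η'ξ'* determines ηη*, and the single unitary g = η*η' carries both components.
For surjectivity choose ξ with ξξ* = u*u; then u = (uξ)ξ*. -/
theorem gaugeArrowMap_bijective : Bijective (gaugeArrowMap hp₀) := by
  constructor
  · rintro ⟨η, ξ⟩ ⟨η', ξ'⟩ e
    replace e : η.1 * star ξ.1 = η'.1 * star ξ'.1 := congrArg Subtype.val e
    have hη := isMoorePenrose_of_mem_isometryBundle hp₀ η
    have hη' := isMoorePenrose_of_mem_isometryBundle hp₀ η'
    have f1 := star_mul_self_mul_star ξ η
    have f2 := star_mul_self_mul_star ξ' η'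
    have e' := congrArg star e
    rw [star_mul, star_mul, star_star, star_star] at e'
    rw [e'] at f1
    have e0 : η.1 * star η.1 = η'.1 * star η'.1 := f1.symm.trans f2
    have e1 : η.1 * (star η.1 * η'.1) = η'.1 := by rw [← mul_assoc, e0, hη'.h1]
    have e2 : ξ.1 * (star η.1 * η'.1) = ξ'.1 := by
      rw [← mul_assoc, e', mul_assoc, η'.2.2, ξ'.2.1.2]
    have e3 : p₀ * star η.1 = star η.1 :=
      (congrArg (fun x => x * star η.1) η.2.2.symm).trans hη.h2
    refine (pairClass_eq hp₀).2 ⟨⟨star η.1 * η'.1, ?_, ?_, ?_⟩,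
      Prod.ext (Subtype.ext e1.symm) (Subtype.ext e2.symm)⟩
    · rw [mul_assoc, mul_assoc, η'.2.1.2, ← mul_assoc, e3]
    · rw [star_mul, star_star, mul_assoc, e1, η'.2.2]
    · rw [star_mul, star_star, mul_assoc, ← mul_assoc η'.1, ← e0, hη.h1, η.2.2]
  · intro u
    have hr := rightSupport_isometry u.2 ▸ u.2.2.2.2
    obtain ⟨ξ, h1, h2⟩ := exists_isometry_of_mem_projOrbit hr
    have hm := IsMoorePenrose.of_isometry u.2.1
    have hm' := IsMoorePenrose.of_isometry (u := ξ) (by rw [h1]; exact hp₀)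
    refine ⟨pairClass hp₀ (⟨u.1 * ξ, mem_isometryBundle hp₀ ?_⟩, ⟨ξ, mem_isometryBundle hp₀ h1⟩),
      Subtype.ext ?_⟩
    · calc _ = star ξ * (star u.1 * u.1) * ξ := by rw [star_mul]; noncomm_ring
        _ = p₀ := by rw [← h2, ← mul_assoc, hm'.h2, h1]
    · change u.1 * ξ * star ξ = u.1
      rw [mul_assoc, h2, ← mul_assoc, hm.h1]

theorem gaugeMap_isHom :
    (gaugeGroupoid hp₀).IsHom (isometryGroupoid p₀) (gaugeArrowMap hp₀) (gaugeBaseMap hp₀) where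
  map_src := by
    rintro ⟨η, ξ⟩
    apply Subtype.ext
    rw [isometryGroupoid_src]
    exact star_mul_self_mul_star η ξ
  map_tgt := by
    rintro ⟨η, ξ⟩
    apply Subtype.ext
    rw [isometryGroupoid_tgt]
    change η.1 * star ξ.1 * star (η.1 * star ξ.1) = η.1 * star η.1
    rw [star_mul, star_star, mul_assoc, ← mul_assoc (star ξ.1), ξ.2.2, ← mul_assoc, η.2.1.2]
  map_unit := by rintro ⟨η⟩; rfl
  map_inv := by
    rintro ⟨η, ξ⟩
    apply Subtype.ext
    rw [isometryGroupoid_inv]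
    change ξ.1 * star η.1 = star (η.1 * star ξ.1)
    rw [star_mul, star_star]
  map_mul := by
    rintro ⟨η, ξ⟩ ⟨l, k⟩ e e'
    obtain ⟨g, hg⟩ := (baseClass_eq hp₀).1 (Eq.symm e)
    apply Subtype.ext
    refine (congrArg (fun x => (gaugeArrowMap hp₀ x : M))
      (gaugeMul_mk hp₀ η ξ l k g hg e)).trans ?_
    change η.1 * star (k.1 * g.1) = η.1 * star ξ.1 * (l.1 * star k.1)
    -- From ξ = λg follows ξ*λ = g*, so (ηξ*)(λκ*) = η(κg)*.
    have h1 : star ξ.1 * l.1 = star g.1 := by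
      rw [show ξ = bundleAct hp₀ l g from hg]
      change star (l.1 * g.1) * l.1 = star g.1
      rw [star_mul, mul_assoc, l.2.2, cornerUnitary_right hp₀ (cornerUnitary_star hp₀ g.2)]
    rw [star_mul, ← h1]
    noncomm_ring

/-! ### Local sections over the orbit and over the arrows; the quotient atlases -/

theorem gaugeBaseMap_submersion (η : isometryBundle p₀) :
    SplitMapAt (bundleAtlas p₀) (projAtlas p₀)
      (fun η => gaugeBaseMap hp₀ (baseClass hp₀ η)) η := by
  have hA := isEmbeddedAtlas_bundleAtlas hp₀
  have hB := isEmbeddedAtlas_projAtlas p₀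
  obtain ⟨s, h1, h2, h3⟩ := exists_isometry_section hp₀ η.2.2
  refine hA.splitMapAt hB (hA.smoothMapAt hB (fun v => v * star v)
    (smoothNear_id.mul smoothNear_id.star) (Eventually.of_forall ?_)) s h1 h2 ?_
  · rintro _ ξ rfl
    rfl
  · change ∀ᶠ v in 𝓝 (η.1 * star η.1), _
    filter_upwards [h3]
    rintro _ h q rfl
    obtain ⟨h4, h5⟩ := h (isStarProjection_of_mem_projOrbit q.2)
    exact ⟨⟨s q, mem_isometryBundle hp₀ h4⟩, rfl, Subtype.ext h5⟩

/-- With s a local section of η ↦ ηη* near ξξ*, the section is u ↦ (u s(u*u), s(u*u)), which passes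
through (η, ξ) at u = ηξ*. -/
theorem gaugeArrowMap_submersion (a : isometryBundle p₀ × isometryBundle p₀) :
    SplitMapAt (prodAtlas (bundleAtlas p₀) (bundleAtlas p₀)) (isometryAtlas p₀)
      (fun a => gaugeArrowMap hp₀ (pairClass hp₀ a)) a := by
  obtain ⟨η, ξ⟩ := a
  have hA := (isEmbeddedAtlas_bundleAtlas hp₀).prod (isEmbeddedAtlas_bundleAtlas hp₀)
  have hB := isEmbeddedAtlas_isometryAtlas p₀
  obtain ⟨s, h1, h2, h3⟩ := exists_isometry_section hp₀ ξ.2.2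
  have e := star_mul_self_mul_star η ξ
  have h4 : SmoothNear (fun u : M => star u * u) (η.1 * star ξ.1) :=
    smoothNear_id.star.mul smoothNear_id
  have h5 : SmoothNear (fun u : M => s (star u * u)) (η.1 * star ξ.1) :=
    SmoothNear.comp (by rwa [e]) h4
  have ht := h4.continuousAt.tendsto
  rw [e] at ht
  refine hA.splitMapAt hB (hA.smoothMapAt hB (fun v => v.1 * star v.2)
    (smoothNear_id.fst.mul smoothNear_id.snd.star) (Eventually.of_forall ?_))
    (fun u => (u * s (star u * u), s (star u * u))) ((smoothNear_id.mul h5).prodMk h5) ?_ ?_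
  · rintro _ ξ rfl
    rfl
  · change (η.1 * star ξ.1 * s (star (η.1 * star ξ.1) * (η.1 * star ξ.1)),
      s (star (η.1 * star ξ.1) * (η.1 * star ξ.1))) = (η.1, ξ.1)
    rw [e, h2, mul_assoc, ξ.2.2, η.2.1.2]
  · change ∀ᶠ v in 𝓝 (η.1 * star ξ.1), _
    filter_upwards [ht.eventually h3]
    rintro _ h u rfl
    obtain ⟨h6, h7⟩ := h u.2.1
    have hm := IsMoorePenrose.of_isometry u.2.1
    have hm' := IsMoorePenrose.of_isometry (u := s (star u.1 * u.1)) (by rw [h6]; exact hp₀)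
    refine ⟨(⟨u.1 * s (star u.1 * u.1), mem_isometryBundle hp₀ ?_⟩,
      ⟨s (star u.1 * u.1), mem_isometryBundle hp₀ h6⟩), rfl, Subtype.ext ?_⟩
    · calc _ = star (s (star u.1 * u.1)) * (star u.1 * u.1) * s (star u.1 * u.1) := by
            rw [star_mul]; noncomm_ring
        _ = star (s (star u.1 * u.1)) * (s (star u.1 * u.1) * star (s (star u.1 * u.1))) *
            s (star u.1 * u.1) := by rw [h7]
        _ = p₀ := by rw [← mul_assoc, hm'.h2, h6]
    · change u.1 * s (star u.1 * u.1) * star (s (star u.1 * u.1)) = u.1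
      rw [mul_assoc, h7, ← mul_assoc, hm.h1]

theorem isEmbeddedAtlas_gaugeBaseAtlas :
    IsEmbeddedAtlas (gaugeBaseAtlas hp₀) fun b => (gaugeBaseMap hp₀ b : M) :=
  IsEmbeddedAtlas.quotient (isEmbeddedAtlas_bundleAtlas hp₀).isSmoothAtlas
    (isEmbeddedAtlas_projAtlas p₀) Quotient.mk_surjective (gaugeBaseMap_bijective hp₀)
    (gaugeBaseMap_submersion hp₀)

theorem isEmbeddedAtlas_gaugeAtlas :
    IsEmbeddedAtlas (gaugeAtlas hp₀) fun x => (gaugeArrowMap hp₀ x : M) :=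
  IsEmbeddedAtlas.quotient
    ((isEmbeddedAtlas_bundleAtlas hp₀).prod (isEmbeddedAtlas_bundleAtlas hp₀)).isSmoothAtlas
    (isEmbeddedAtlas_isometryAtlas p₀) Quotient.mk_surjective (gaugeArrowMap_bijective hp₀)
    (gaugeArrowMap_submersion hp₀)

/-- Seen in `M` through the two bijections, the gauge operations are those of partial isometries,
because the maps form a morphism. The same criterion therefore serves for both groupoids. -/
theorem gaugeGroupoid_isBanachLie :
    (gaugeGroupoid hp₀).IsBanachLie (gaugeAtlas hp₀) (gaugeBaseAtlas hp₀) := by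
  have h := gaugeMap_isHom hp₀
  refine isBanachLie_of_isometries (isEmbeddedAtlas_gaugeAtlas hp₀)
    (isEmbeddedAtlas_gaugeBaseAtlas hp₀)
    (fun b => isStarProjection_of_mem_projOrbit (gaugeBaseMap hp₀ b).2) (fun x => ?_)
    (fun x => ?_) (fun x y e => ?_) (fun x => ?_) (fun b => ?_) fun u b _ e _ => ?_
  · rw [← isometryGroupoid_src, h.map_src]
  · rw [← isometryGroupoid_tgt, h.map_tgt]
  · exact congrArg Subtype.val (h.map_mul x y e (by rw [h.map_src, h.map_tgt, e]))
  · rw [← isometryGroupoid_inv, h.map_inv]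
  · exact congrArg Subtype.val (h.map_unit b)
  · obtain ⟨x, hx⟩ := (gaugeArrowMap_bijective hp₀).2
      ⟨u, mem_isometryArrows (e ▸ (gaugeBaseMap hp₀ b).2)⟩
    exact ⟨x, congrArg Subtype.val hx⟩

/-! ### The partial isometries inside the partially invertible elements -/

theorem isometryGroupoid_isHom (p₀ : M) :
    (isometryGroupoid p₀).IsHom (invertibleGroupoid p₀)
      (inclusion (isArrowSet_isometryArrows p₀).subset) id where
  map_src _ := rfl
  map_tgt _ := rfl
  map_unit _ := rfl
  map_inv _ := rfl
  map_mul _ _ _ _ := rfl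

theorem isSmoothMap_isometryInclusion (p₀ : M) :
    IsSmoothMap (isometryAtlas p₀) (invertibleAtlas p₀)
      (inclusion (isArrowSet_isometryArrows p₀).subset) :=
  (isEmbeddedAtlas_isometryAtlas p₀).isSmoothMap (isEmbeddedAtlas_invertibleAtlas p₀)
    (fun v => (v * star v, v, star v * v))
    (fun _ => (smoothNear_id.mul smoothNear_id.star).prodMk
      (smoothNear_id.prodMk (smoothNear_id.star.mul smoothNear_id)))
    fun u => Prod.ext (leftSupport_isometry u.2) (Prod.ext rfl (rightSupport_isometry u.2))

end Groupoids

end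

/-! ### The main theorem -/

theorem mainTheorem2 {M : Type u} [CStarAlgebra M] [WStarAlgebra M] [PartialOrder M]
    [StarOrderedRing M] (p₀ : M) (hp₀ : IsStarProjection p₀) :
    -- the manifold structures are well defined
    IsSmoothAtlas (invertibleAtlas p₀) ∧
    IsSmoothAtlas (bundleAtlas p₀) ∧
    -- both groupoids are real Banach-Lie groupoids
    (gaugeGroupoid hp₀).IsBanachLie (gaugeAtlas hp₀) (gaugeBaseAtlas hp₀) ∧
    (isometryGroupoid p₀).IsBanachLie (isometryAtlas p₀) (projAtlas p₀) ∧
    -- the two maps are well defined and form an isomorphism of Banach-Lie groupoids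
    (∃ (F : GaugeArrows hp₀ → isometryArrows p₀) (f : GaugeBase hp₀ → projOrbit p₀),
      (∀ η ξ : isometryBundle p₀, (F (pairClass hp₀ (η, ξ)) : M) = η.1 * star ξ.1) ∧
      (∀ η : isometryBundle p₀, (f (baseClass hp₀ η) : M) = η.1 * star η.1) ∧
      (gaugeGroupoid hp₀).IsHom (isometryGroupoid p₀) F f ∧
      IsDiffeo (gaugeAtlas hp₀) (isometryAtlas p₀) F ∧
      IsDiffeo (gaugeBaseAtlas hp₀) (projAtlas p₀) f) ∧
    -- the partial isometries form a subgroupoid, with the same objects, of the groupoid of partially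
    -- invertible elements; by the definition of its atlas it is a real submanifold
    (isometryGroupoid p₀).IsHom (invertibleGroupoid p₀)
      (inclusion (isArrowSet_isometryArrows p₀).subset) id ∧
    IsSmoothMap (isometryAtlas p₀) (invertibleAtlas p₀)
      (inclusion (isArrowSet_isometryArrows p₀).subset) := by
  have hg := gaugeGroupoid_isBanachLie hp₀
  exact ⟨(isEmbeddedAtlas_invertibleAtlas p₀).isSmoothAtlas,
    (isEmbeddedAtlas_bundleAtlas hp₀).isSmoothAtlas, hg, isometryGroupoid_isBanachLie p₀,
    ⟨gaugeArrowMap hp₀, gaugeBaseMap hp₀, gaugeArrowMap_mk hp₀, gaugeBaseMap_mk hp₀,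
      gaugeMap_isHom hp₀,
      (isEmbeddedAtlas_isometryAtlas p₀).isDiffeo (gaugeArrowMap_bijective hp₀)
        (isEmbeddedAtlas_gaugeAtlas hp₀),
      (isEmbeddedAtlas_projAtlas p₀).isDiffeo (gaugeBaseMap_bijective hp₀)
        (isEmbeddedAtlas_gaugeBaseAtlas hp₀)⟩,
    isometryGroupoid_isHom p₀, isSmoothMap_isometryInclusion p₀⟩
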